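/- **Theorem 19.** For $\nu\in\mathbb{C}$ and $z>0$ let $P_\nu(z)={}_2F_1\left(-\nu,\nu+1;1;\tfrac{1-z}{2}\right)$ (continued analytically to all $z>0$) be the Legendre function of the first kind. Let $L_2=L_2(0,\infty)$ be the space of complex-valued square-integrable functions on the half-line, and consider in $L_2$ the zero-order-smoothness Buschman–Erdélyi operators $$({}_1S_{0+}^{\nu}f)(x)=\frac{d}{dx}\int_0^x P_\nu\left(\frac{x}{t}\right)f(t)\,dt,\qquad ({}_1P_{0+}^{\nu}f)(x)=\int_0^x P_\nu\left(\frac{t}{x}\right)f'(t)\,dt,$$ $$({}_1P_{-}^{\nu}f)(x)=\int_x^\infty P_\nu\left(\frac{t}{x}\right)\bigl(-f'(t)\bigr)\,dt,\qquad ({}_1S_{-}^{\nu}f)(x)=-\frac{d}{dx}\int_x^\infty P_\nu\left(\frac{x}{t}\right)f(t)\,dt,$$ each defined on its natural domain: those $f\in L_2$ (locally absolutely continuous on $(0,\infty)$ for the two operators containing $f'$) for which the integrals converge absolutely for every $x>0$ and the result, the derivatives being taken almost everywhere, exists and lies in $L_2$. Call such an operator unitary in $L_2$ if it is densely defined and extends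 to a (necessarily unique) unitary operator of $L_2$ onto itself. For each of the four operators and each $\nu\in\mathbb{C}$: the operator is unitary in $L_2$ if and only if $\nu$ is an integer. If $\nu$ is an integer, then ${}_1S_{0+}^{\nu}$ and ${}_1P_{-}^{\nu}$ (that is, their unitary extensions) are inverse to each other, and so are ${}_1S_{-}^{\nu}$ and ${}_1P_{0+}^{\nu}$. -/

import Mathlib

open MeasureTheory Set

namespace BuschmanErdelyi

/-- The Hilbert space `L₂(0, ∞)` of complex-valued functions. -/
abbrev L2 : Type := Lp ℂ 2 (volume.restrict (Ioi (0 : ℝ)))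

/-- The Legendre function of the first kind `P_ν(z)`, of arbitrary complex degree `ν`, for `z > 0`
(on the cut for `0 < z < 1`; the two standard functions agree at `z = 1`). It is the analytic
continuation to `z > 0` of `₂F₁(-ν, ν + 1; 1; (1 - z)/2)`; Pfaff's transformation turns this into
`((1 + z)/2) ^ ν * ₂F₁(-ν, -ν; 1; (z - 1)/(z + 1))`, whose hypergeometric series converges for every
`z > 0`. -/
noncomputable def legendreP (ν : ℂ) (z : ℝ) : ℂ :=
  (((1 + z) / 2 : ℝ) : ℂ) ^ ν * ₂F₁ (-ν) (-ν) (1 : ℂ) (((z - 1) / (z + 1) : ℝ) : ℂ)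

/-- `f` is locally absolutely continuous on `(0, ∞)` and `h` is its (almost everywhere)
derivative there. -/
def HasLocACDeriv (f h : ℝ → ℂ) : Prop :=
  ∀ a b : ℝ, 0 < a → 0 < b →
    IntervalIntegrable h volume a b ∧ f b - f a = ∫ t in a..b, h t

/-- Graph in `L₂(0, ∞)` of
`(₁S_{0+}^ν f)(x) = d/dx ∫_0^x P_ν(x/t) f(t) dt`, on its natural domain: `f ∈ L₂`, the integrals
converge absolutely for `x > 0`, and the derivative exists almost everywhere and equals `g ∈ L₂`. -/
def SZeroPlus (ν : ℂ) (f g : L2) : Prop :=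
  (∀ x : ℝ, 0 < x → IntegrableOn (fun t : ℝ => legendreP ν (x / t) * f t) (Ioo 0 x)) ∧
    ∀ᵐ x ∂(volume.restrict (Ioi (0 : ℝ))),
      HasDerivAt (fun y : ℝ => ∫ t in Ioo 0 y, legendreP ν (y / t) * f t) (g x) x

/-- Graph in `L₂(0, ∞)` of `(₁P_{0+}^ν f)(x) = ∫_0^x P_ν(t/x) f'(t) dt`, on its natural domain:
`f ∈ L₂` is locally absolutely continuous on `(0, ∞)` (up to the choice of a representative), the
integrals converge absolutely for `x > 0`, and their value is `g ∈ L₂`. -/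
def PZeroPlus (ν : ℂ) (f g : L2) : Prop :=
  ∃ f₀ h : ℝ → ℂ, f =ᵐ[volume.restrict (Ioi (0 : ℝ))] f₀ ∧ HasLocACDeriv f₀ h ∧
    (∀ x : ℝ, 0 < x → IntegrableOn (fun t : ℝ => legendreP ν (t / x) * h t) (Ioo 0 x)) ∧
    ∀ᵐ x ∂(volume.restrict (Ioi (0 : ℝ))), g x = ∫ t in Ioo 0 x, legendreP ν (t / x) * h t

/-- Graph in `L₂(0, ∞)` of `(₁P_-^ν f)(x) = ∫_x^∞ P_ν(t/x) (-f'(t)) dt`, on its natural domain. -/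
def PMinus (ν : ℂ) (f g : L2) : Prop :=
  ∃ f₀ h : ℝ → ℂ, f =ᵐ[volume.restrict (Ioi (0 : ℝ))] f₀ ∧ HasLocACDeriv f₀ h ∧
    (∀ x : ℝ, 0 < x → IntegrableOn (fun t : ℝ => legendreP ν (t / x) * -h t) (Ioi x)) ∧
    ∀ᵐ x ∂(volume.restrict (Ioi (0 : ℝ))), g x = ∫ t in Ioi x, legendreP ν (t / x) * -h t

/-- Graph in `L₂(0, ∞)` of `(₁S_-^ν f)(x) = (-d/dx) ∫_x^∞ P_ν(x/t) f(t) dt`, on its natural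
domain. -/
def SMinus (ν : ℂ) (f g : L2) : Prop :=
  (∀ x : ℝ, 0 < x → IntegrableOn (fun t : ℝ => legendreP ν (x / t) * f t) (Ioi x)) ∧
    ∀ᵐ x ∂(volume.restrict (Ioi (0 : ℝ))),
      HasDerivAt (fun y : ℝ => ∫ t in Ioi y, legendreP ν (y / t) * f t) (-(g x)) x

/-- The operator in `L₂(0, ∞)` with graph `T` is densely defined and the unitary operator `U` of
`L₂(0, ∞)` extends it (so that `U` is its unique extension by continuity). -/
def ExtendsTo (T : L2 → L2 → Prop) (U : L2 ≃ₗᵢ[ℂ] L2) : Prop :=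
  Dense {f : L2 | ∃ g : L2, T f g} ∧ ∀ f g : L2, T f g → U f = g

/-- The operator in `L₂(0, ∞)` with graph `T` is unitary: it is densely defined, and its extension
by continuity is a unitary operator of `L₂(0, ∞)`. -/
def IsUnitary (T : L2 → L2 → Prop) : Prop :=
  ∃ U : L2 ≃ₗᵢ[ℂ] L2, ExtendsTo T U

end BuschmanErdelyi

/-! Write P for the Legendre function and p for its derivative. Since P(1) = 1, carrying out the
outer derivative, or integrating the inner one by parts, turns the operators into perturbations of
the identity: S_{0+} = 1 + C, P_{0+} = 1 - A, P_- = 1 + D, S_- = 1 - B. Here A has kernel p(t/x)/x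
and C has kernel p(x/t)/t, both on t < x, while B and D are the transposes of A and C. The expansion
of P at 1 converges beyond 0, so p is bounded on (0, 1]; hence A and B are dominated by M / max(x,
t) and are bounded by Schur's test. The kernels C and D see p at arguments above 1, where it may
grow, and they are reached only as inverses.

Legendre's equation gives an explicit antiderivative of t ↦ p(t/x) p(t/y)
(`hasDerivAt_prodAntideriv`). Evaluated between x and y it yields AC = CA = C - A on kernels, for
every degree: 1 + C inverts 1 - A and, by transposition, 1 + D inverts 1 - B. Evaluated down to 0,
or after inversion up to infinity, it yields AB = BA = A + B apart from a boundary term proportional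
to P(0) p(0). For integral degree P is a Legendre polynomial, even or odd, so this term vanishes;
the kernels are real, so A = B*, and (1 - A)(1 - B) = (1 - B)(1 - A) = 1 says that 1 - B is unitary
with inverse 1 - A. Thus S_{0+} and S_- are restrictions of 1 - B, and P_- and P_{0+} are
restrictions of 1 - A. This has to be shown on the whole natural domains (`sZeroPlus_imp`,
`pZeroPlus_imp`, `pMinus_imp`, `sMinus_iff`), while density comes from test functions and their
images.

Conversely, the graphs contain enough pairs built from test functions to make 1 - A or 1 - B an
isometry of the whole space whenever an operator is unitary. For 1 - B this means B*B = B + B*.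
Applied to the function 1/t on (1, ∞), it shows that b(x) = (P(x) - P(0))/x satisfies b(x) = ∫_0^1
conj(p(r)) b(xr) dr on (0, 1). The right-hand side preserves polynomials and contracts remainders of
size x^N once N is large, so b is a polynomial (`exists_polynomial_of_fixed`). Then P is a
polynomial too, and the leading coefficient in Legendre's equation forces ν to be an integer. -/

namespace BuschmanErdelyi
open Filter Topology

/-! ### Power series with coefficients of subexponential growth -/

/-- The power series with coefficients `c` converges in the open unit disc. -/
def ConvergesInDisc (c : ℕ → ℂ) : Prop :=
  ∀ r : ℝ, 0 < r → r < 1 → ∃ C : ℝ, ∀ k, ‖c k‖ * r ^ k ≤ C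

/-- Coefficients of the termwise derivative. -/
def derivCoeff (c : ℕ → ℂ) (k : ℕ) : ℂ := (k + 1) * c (k + 1)

theorem ConvergesInDisc.summable {c : ℕ → ℂ} (hc : ConvergesInDisc c) {r : ℝ} (h0 : 0 ≤ r)
    (h1 : r < 1) : Summable fun k => ‖c k‖ * r ^ k := by
  obtain ⟨s, hrs, hs1⟩ := exists_between h1
  have hs0 : 0 < s := h0.trans_lt hrs
  obtain ⟨C, hC⟩ := hc s hs0 hs1
  have hq : r / s < 1 := (div_lt_one hs0).2 hrs
  refine Summable.of_nonneg_of_le (fun k => by positivity) (fun k => ?_)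
    ((summable_geometric_of_lt_one (by positivity) hq).mul_left C)
  calc ‖c k‖ * r ^ k = (‖c k‖ * s ^ k) * (r / s) ^ k := by
        rw [div_pow]; field_simp
    _ ≤ C * (r / s) ^ k := by gcongr; exact hC k

theorem ConvergesInDisc.hasSum {c : ℕ → ℂ} (hc : ConvergesInDisc c) {w : ℂ} (hw : ‖w‖ < 1) :
    HasSum (fun k => c k * w ^ k) (∑' k, c k * w ^ k) := by
  refine Summable.hasSum (Summable.of_norm ?_)
  simpa [norm_mul, norm_pow] using hc.summable (norm_nonneg w) hw

theorem ConvergesInDisc.derivCoeff {c : ℕ → ℂ} (hc : ConvergesInDisc c) :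
    ConvergesInDisc (derivCoeff c) := by
  intro r h0 h1
  obtain ⟨s, hrs, hs1⟩ := exists_between h1
  have hs0 : 0 < s := h0.trans hrs
  obtain ⟨C, hC⟩ := hc s hs0 hs1
  have hq : r / s < 1 := (div_lt_one hs0).2 hrs
  have hlim : Tendsto (fun k : ℕ => ((k : ℝ) + 1) * (r / s) ^ k) atTop (𝓝 0) := by
    have h2 := tendsto_self_mul_const_pow_of_lt_one (div_nonneg h0.le hs0.le) hq
    have h3 := tendsto_pow_atTop_nhds_zero_of_lt_one (div_nonneg h0.le hs0.le) hq
    simpa [add_mul] using h2.add h3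
  obtain ⟨B, hB⟩ := hlim.bddAbove_range
  refine ⟨B * (C / s), fun k => ?_⟩
  have hBk : ((k : ℝ) + 1) * (r / s) ^ k ≤ B := hB ⟨k, rfl⟩
  have hnorm : ‖BuschmanErdelyi.derivCoeff c k‖ = (k + 1) * ‖c (k + 1)‖ := by
    rw [BuschmanErdelyi.derivCoeff, norm_mul]
    congr 1
    exact_mod_cast Complex.norm_natCast (k + 1)
  calc ‖BuschmanErdelyi.derivCoeff c k‖ * r ^ k
      = (((k : ℝ) + 1) * (r / s) ^ k) * ((‖c (k + 1)‖ * s ^ (k + 1)) / s) := by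
        rw [hnorm, div_pow, pow_succ]; field_simp
    _ ≤ B * (C / s) := by
        have : (‖c (k + 1)‖ * s ^ (k + 1)) / s ≤ C / s := by gcongr; exact hC _
        refine mul_le_mul hBk this (by positivity) (le_trans ?_ hBk)
        positivity

theorem ConvergesInDisc.hasDerivAt {c : ℕ → ℂ} (hc : ConvergesInDisc c) {w : ℂ} (hw : ‖w‖ < 1) :
    HasDerivAt (fun w => ∑' k, c k * w ^ k)
      (∑' k, BuschmanErdelyi.derivCoeff c k * w ^ k) w := by
  obtain ⟨r, hwr, hr1⟩ := exists_between hw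
  have hr0 : 0 < r := (norm_nonneg w).trans_lt hwr
  have hsum := hc.derivCoeff.summable hr0.le hr1
  have hu : Summable fun k : ℕ => ‖c k * k‖ * r ^ (k - 1) := by
    rw [← summable_nat_add_iff 1]
    refine hsum.congr fun k => ?_
    simp only [BuschmanErdelyi.derivCoeff, add_tsub_cancel_right, Nat.cast_add, Nat.cast_one]
    rw [mul_comm (c (k + 1))]
  have key := hasDerivAt_tsum_of_isPreconnected (t := Metric.ball (0 : ℂ) r)
    (g := fun k w => c k * w ^ k) (g' := fun k w => c k * (k * w ^ (k - 1))) (y₀ := 0) (y := w)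
    hu Metric.isOpen_ball (convex_ball _ _).isPreconnected
    (fun k y _ => (hasDerivAt_pow k y).const_mul (c k))
    (fun k y hy => by
      rw [← mul_assoc, norm_mul, norm_pow]
      gcongr
      simpa using (mem_ball_zero_iff.1 hy).le)
    (Metric.mem_ball_self hr0)
    (hc.hasSum (by simp)).summable (mem_ball_zero_iff.2 hwr)
  have hs : Summable fun k : ℕ => c k * (k * w ^ (k - 1)) := by
    rw [← summable_nat_add_iff 1]
    refine (hc.derivCoeff.hasSum hw).summable.congr fun k => ?_
    simp only [BuschmanErdelyi.derivCoeff, add_tsub_cancel_right]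
    push_cast
    ring
  have e : ∑' k, BuschmanErdelyi.derivCoeff c k * w ^ k = ∑' k : ℕ, c k * (k * w ^ (k - 1)) := by
    rw [hs.tsum_eq_zero_add]
    simp only [CharP.cast_eq_zero, zero_mul, mul_zero, zero_add, BuschmanErdelyi.derivCoeff]
    refine tsum_congr fun k => ?_
    push_cast
    ring
  rw [e]
  exact key

/-- This brings the terms of the hypergeometric equation, which carry factors w and w², to common
powers of w, so that coefficients can be compared. -/
theorem hasSum_mul_shift {d : ℕ → ℂ} {w S : ℂ} (h : HasSum (fun k => d k * w ^ k) S) :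
    HasSum (fun k => (if k = 0 then 0 else d (k - 1)) * w ^ k) (w * S) := by
  rw [← hasSum_nat_add_iff' 1]
  have := h.mul_left w
  convert! this using 1
  · funext k
    simp [pow_succ]
    ring
  · simp

/-! ### The hypergeometric equation -/

/-- Coefficients of `₂F₁(a, b; 1; ·)`. -/
noncomputable def hypCoeff (a b : ℂ) (k : ℕ) : ℂ := ordinaryHypergeometricCoefficient a b 1 k

theorem hypCoeff_succ (a b : ℂ) (k : ℕ) :
    ((k : ℂ) + 1) ^ 2 * hypCoeff a b (k + 1) = (a + k) * (b + k) * hypCoeff a b k := by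
  have h1 : (Polynomial.eval (1 : ℂ) (ascPochhammer ℂ k)) ≠ 0 := by
    rw [ascPochhammer_eval_one]; exact_mod_cast Nat.factorial_ne_zero k
  have h2 : ((k : ℂ) + 1) ≠ 0 := by exact_mod_cast Nat.succ_ne_zero k
  have h3 : ((Nat.factorial k : ℕ) : ℂ) ≠ 0 := by exact_mod_cast Nat.factorial_ne_zero k
  simp only [hypCoeff, ordinaryHypergeometricCoefficient, ascPochhammer_succ_eval,
    Nat.factorial_succ]
  have h4 : (1 : ℂ) + k ≠ 0 := by rwa [add_comm]
  push_cast
  rw [mul_inv, mul_inv]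
  field_simp
  ring

/-- The ratio of consecutive coefficients tends to 1, so for r < 1 the terms weighted by r ^ k
eventually decrease. -/
theorem convergesInDisc_hypCoeff (a b : ℂ) : ConvergesInDisc (hypCoeff a b) := by
  intro r h0 h1
  have hlim : Tendsto (fun k : ℕ => ‖(a + k) * (b + k) / ((k : ℂ) + 1) ^ 2‖) atTop (𝓝 1) := by
    have ha := tendsto_add_mul_div_add_mul_atTop_nhds a (1 : ℂ) (1 : ℂ) one_ne_zero
    have hb := tendsto_add_mul_div_add_mul_atTop_nhds b (1 : ℂ) (1 : ℂ) one_ne_zero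
    have := (ha.mul hb).norm
    simp only [div_one, mul_one, norm_one, one_mul] at this
    refine this.congr fun k => ?_
    congr 1
    rw [add_comm (1 : ℂ) (k : ℂ), div_mul_div_comm, sq]
  have hev : ∀ᶠ k : ℕ in atTop, ‖(a + k) * (b + k) / ((k : ℂ) + 1) ^ 2‖ < 1 / r :=
    hlim.eventually_lt_const ((one_lt_div h0).2 h1)
  obtain ⟨K, hK⟩ := eventually_atTop.1 hev
  have hstep : ∀ k, K ≤ k → ‖hypCoeff a b (k + 1)‖ * r ^ (k + 1) ≤ ‖hypCoeff a b k‖ * r ^ k := by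
    intro k hk
    have h2 : ((k : ℂ) + 1) ^ 2 ≠ 0 := by
      have : ((k : ℂ) + 1) ≠ 0 := by exact_mod_cast Nat.succ_ne_zero k
      positivity
    have e : hypCoeff a b (k + 1) = (a + k) * (b + k) / ((k : ℂ) + 1) ^ 2 * hypCoeff a b k := by
      rw [div_mul_eq_mul_div, eq_div_iff h2, mul_comm, hypCoeff_succ]
    rw [e, norm_mul]
    calc _ ≤ (1 / r) * ‖hypCoeff a b k‖ * r ^ (k + 1) := by gcongr; exact (hK k hk).le
      _ = _ := by rw [pow_succ]; field_simp
  have htail : ∀ j, ‖hypCoeff a b (K + j)‖ * r ^ (K + j) ≤ ‖hypCoeff a b K‖ * r ^ K := by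
    intro j
    induction j with
    | zero => simp
    | succ j ih => exact (hstep (K + j) (Nat.le_add_right _ _)).trans ih
  refine ⟨∑ k ∈ Finset.range (K + 1), ‖hypCoeff a b k‖ * r ^ k, fun k => ?_⟩
  have hle : ∀ k, k ∈ Finset.range (K + 1) → ‖hypCoeff a b k‖ * r ^ k ≤
      ∑ k ∈ Finset.range (K + 1), ‖hypCoeff a b k‖ * r ^ k := fun k hk =>
    Finset.single_le_sum (f := fun k => ‖hypCoeff a b k‖ * r ^ k) (fun i _ => by positivity) hk
  rcases le_total k K with hk | hk
  · exact hle k (Finset.mem_range.2 (by omega))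
  · obtain ⟨j, rfl⟩ := Nat.exists_eq_add_of_le hk
    exact (htail j).trans (hle K (by simp))

/-- The first derivative of `₂F₁(a, b; 1; ·)`. -/
noncomputable def hypDeriv (a b : ℂ) (w : ℂ) : ℂ := ∑' k, derivCoeff (hypCoeff a b) k * w ^ k

/-- The second derivative of `₂F₁(a, b; 1; ·)`. -/
noncomputable def hypDeriv₂ (a b : ℂ) (w : ℂ) : ℂ :=
  ∑' k, derivCoeff (derivCoeff (hypCoeff a b)) k * w ^ k

theorem hyp_eq_tsum (a b w : ℂ) : ₂F₁ a b (1 : ℂ) w = ∑' k, hypCoeff a b k * w ^ k := by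
  rw [ordinaryHypergeometric_eq_tsum]
  rfl

theorem hasDerivAt_hyp (a b : ℂ) {w : ℂ} (hw : ‖w‖ < 1) :
    HasDerivAt (₂F₁ a b (1 : ℂ)) (hypDeriv a b w) w := by
  have := (convergesInDisc_hypCoeff a b).hasDerivAt hw
  convert! this using 1
  funext v
  exact hyp_eq_tsum a b v

theorem hasDerivAt_hypDeriv (a b : ℂ) {w : ℂ} (hw : ‖w‖ < 1) :
    HasDerivAt (hypDeriv a b) (hypDeriv₂ a b w) w :=
  (convergesInDisc_hypCoeff a b).derivCoeff.hasDerivAt hw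

theorem hypergeometric_equation (a b : ℂ) {w : ℂ} (hw : ‖w‖ < 1) :
    w * (1 - w) * hypDeriv₂ a b w + (1 - (a + b + 1) * w) * hypDeriv a b w
      - a * b * ₂F₁ a b (1 : ℂ) w = 0 := by
  have h0 := (convergesInDisc_hypCoeff a b).hasSum hw
  have h1 := (convergesInDisc_hypCoeff a b).derivCoeff.hasSum hw
  have h2 := (convergesInDisc_hypCoeff a b).derivCoeff.derivCoeff.hasSum hw
  rw [← hyp_eq_tsum] at h0
  change HasSum _ (hypDeriv a b w) at h1
  change HasSum _ (hypDeriv₂ a b w) at h2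
  have w1 := hasSum_mul_shift h1
  have w2 := hasSum_mul_shift h2
  have ww2 := hasSum_mul_shift w2
  have total := (((w2.sub ww2).add h1).sub (w1.mul_left (a + b + 1))).sub (h0.mul_left (a * b))
  have hz : HasSum (fun _ : ℕ => (0 : ℂ)) 0 := hasSum_zero
  have e : w * hypDeriv₂ a b w - w * (w * hypDeriv₂ a b w) + hypDeriv a b w
      - (a + b + 1) * (w * hypDeriv a b w) - a * b * ₂F₁ a b (1 : ℂ) w = 0 := by
    refine total.unique ?_
    convert! hz using 1
    funext k
    -- Two of the terms are shifted by one place and one by two places, so the coefficients of index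
    -- 0 and 1 lack some of them.
    rcases k with _ | _ | k
    · have := hypCoeff_succ a b 0
      simp only [derivCoeff] at this ⊢
      simp at this ⊢
      linear_combination this
    · have := hypCoeff_succ a b 1
      simp only [derivCoeff] at this ⊢
      simp at this ⊢
      linear_combination w * this
    · have := hypCoeff_succ a b (k + 2)
      simp only [derivCoeff] at this ⊢
      simp at this ⊢
      linear_combination w ^ (k + 2) * this
  linear_combination e

end BuschmanErdelyi

namespace BuschmanErdelyi
open Filter Topology

/-! ### Legendre's equation -/

/-- `P`, with derivative `p`, solves Legendre's equation `((z² - 1) P')' = Λ P` on `s`. -/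
def SolvesLegendre (Λ : ℂ) (P p : ℝ → ℂ) (s : Set ℝ) : Prop :=
  ∀ z ∈ s, HasDerivAt P (p z) z ∧
    HasDerivAt (fun z : ℝ => ((z : ℂ) ^ 2 - 1) * p z) (Λ * P z) z

theorem SolvesLegendre.sub {Λ : ℂ} {P p Q q : ℝ → ℂ} {s : Set ℝ} (hP : SolvesLegendre Λ P p s)
    (hQ : SolvesLegendre Λ Q q s) :
    SolvesLegendre Λ (fun z => P z - Q z) (fun z => p z - q z) s := by
  intro z hz
  refine ⟨(hP z hz).1.sub (hQ z hz).1, ?_⟩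
  convert! (hP z hz).2.sub (hQ z hz).2 using 1
  · funext y
    simp only [Pi.sub_apply]
    ring
  · ring

theorem SolvesLegendre.mono {Λ : ℂ} {P p : ℝ → ℂ} {s t : Set ℝ} (hP : SolvesLegendre Λ P p s)
    (h : t ⊆ s) : SolvesLegendre Λ P p t := fun z hz => hP z (h hz)

/-- A solution of Legendre's equation that is regular at `1` and vanishes there is zero. -/
theorem SolvesLegendre.eq_zero {Λ : ℂ} {D d : ℝ → ℂ} {s : Set ℝ} (hD : SolvesLegendre Λ D d s)
    (hs : Convex ℝ s) (h1s : (1 : ℝ) ∈ s) (hpos : ∀ z ∈ s, -1 < z) (hD1 : D 1 = 0)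
    (hd1 : ContinuousAt d 1)
    {z₁ : ℝ} (hz₁ : z₁ ∈ s) : D z₁ = 0 := by
  set φ : ℝ → ℝ := fun θ => 1 + θ * (z₁ - 1) with hφ
  have hφs : ∀ θ ∈ Icc (0 : ℝ) 1, φ θ ∈ s := by
    intro θ hθ
    have := hs h1s hz₁ (sub_nonneg.2 hθ.2) hθ.1 (by ring)
    simp only [smul_eq_mul] at this
    convert this using 1
    simp only [hφ]; ring
  have hφd : ∀ θ, HasDerivAt φ (z₁ - 1) θ := fun θ => by
    simpa [hφ] using ((hasDerivAt_id' θ).mul_const (z₁ - 1)).const_add 1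
  -- The function φ + 1 is affine in θ with end values 2 and z₁ + 1, so c bounds it from below.
  set c : ℝ := min 2 (z₁ + 1) with hc
  have hc0 : 0 < c := lt_min two_pos (by linarith [hpos z₁ hz₁])
  have hcφ : ∀ θ ∈ Icc (0 : ℝ) 1, c ≤ φ θ + 1 := by
    intro θ hθ
    have h2 : c ≤ 2 := min_le_left _ _
    have h3 : c ≤ z₁ + 1 := min_le_right _ _
    simp only [hφ]
    nlinarith [hθ.1, hθ.2]
  set f : ℝ → ℂ := fun θ => D (φ θ) with hf
  set f' : ℝ → ℂ := fun θ => ((z₁ - 1 : ℝ) : ℂ) * d (φ θ) with hf'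
  set e : ℝ → ℂ := fun θ => ((φ θ : ℂ) ^ 2 - 1) * d (φ θ) with he
  have hfd : ∀ θ ∈ Icc (0 : ℝ) 1, HasDerivAt f (f' θ) θ := by
    intro θ hθ
    have := (hD _ (hφs θ hθ)).1.scomp θ (hφd θ)
    simpa [hf, hf', Function.comp_def] using this
  have hed : ∀ θ ∈ Icc (0 : ℝ) 1, HasDerivAt e (((z₁ - 1 : ℝ) : ℂ) * (Λ * f θ)) θ := by
    intro θ hθ
    have := (hD _ (hφs θ hθ)).2.scomp θ (hφd θ)
    simpa [he, hf, Function.comp_def] using this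
  have hef : ∀ θ, e θ = θ * (φ θ + 1) * f' θ := by
    intro θ
    simp only [he, hf', hφ]
    push_cast
    ring
  obtain ⟨M, hM⟩ : ∃ M, ∀ θ ∈ Icc (0 : ℝ) 1, ‖f θ‖ ≤ M :=
    isCompact_Icc.exists_bound_of_continuousOn
      (fun θ hθ => (hfd θ hθ).continuousAt.continuousWithinAt)
  have hM0 : 0 ≤ M := (norm_nonneg _).trans (hM 0 (by simp))
  set K : ℝ := |z₁ - 1| * ‖Λ‖ / c with hK
  have hK0 : 0 ≤ K := by positivity
  -- Picard iteration along the segment: a bound on f is integrated to a bound on e, divided by θ (φ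
  -- + 1) to bound f', and integrated again. The extra power of θ gained by e pays for the singular
  -- division.
  have key : ∀ k : ℕ, ∀ θ ∈ Icc (0 : ℝ) 1, ‖f θ‖ ≤ M * K ^ k / k.factorial * θ ^ k := by
    intro k
    induction k with
    | zero => intro θ hθ; simpa using hM θ hθ
    | succ k ih =>
      have hkf : (0 : ℝ) < k.factorial := by exact_mod_cast k.factorial_pos
      have hE : ∀ θ ∈ Icc (0 : ℝ) 1,
          ‖e θ‖ ≤ |z₁ - 1| * ‖Λ‖ * (M * K ^ k / k.factorial) * θ ^ (k + 1) / (k + 1) := by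
        refine image_norm_le_of_norm_deriv_right_le_deriv_boundary'
          (f' := fun θ => ((z₁ - 1 : ℝ) : ℂ) * (Λ * f θ))
          (B' := fun θ => |z₁ - 1| * ‖Λ‖ * (M * K ^ k / k.factorial) * θ ^ k)
          (fun θ hθ => (hed θ hθ).continuousAt.continuousWithinAt)
          (fun θ hθ => (hed θ (Ico_subset_Icc_self hθ)).hasDerivWithinAt) ?_ ?_ ?_ ?_
        · simp [hef]
        · exact Continuous.continuousOn (by fun_prop)
        · intro θ _
          have := (((hasDerivAt_pow (k + 1) θ).const_mul
            (|z₁ - 1| * ‖Λ‖ * (M * K ^ k / k.factorial))).div_const ((k : ℝ) + 1)).hasDerivWithinAt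
            (s := Ici θ)
          convert! this using 1
          push_cast
          field_simp
        · intro θ hθ
          rw [norm_mul, norm_mul, Complex.norm_real, Real.norm_eq_abs]
          have := ih θ (Ico_subset_Icc_self hθ)
          calc _ ≤ |z₁ - 1| * (‖Λ‖ * (M * K ^ k / k.factorial * θ ^ k)) := by gcongr
            _ = _ := by ring
      refine image_norm_le_of_norm_deriv_right_le_deriv_boundary' (f' := f')
        (B' := fun θ => M * K ^ (k + 1) / k.factorial * θ ^ k)
        (fun θ hθ => (hfd θ hθ).continuousAt.continuousWithinAt)
        (fun θ hθ => (hfd θ (Ico_subset_Icc_self hθ)).hasDerivWithinAt) ?_ ?_ ?_ ?_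
      · simp [hf, hφ, hD1]
      · exact Continuous.continuousOn (by fun_prop)
      · intro θ _
        have := ((hasDerivAt_pow (k + 1) θ).const_mul
            (M * K ^ (k + 1) / (k + 1).factorial)).hasDerivWithinAt (s := Ici θ)
        convert! this using 1
        rw [Nat.factorial_succ]
        push_cast
        field_simp
      · have hint : ∀ θ ∈ Ioo (0 : ℝ) 1, ‖f' θ‖ ≤ M * K ^ (k + 1) / k.factorial * θ ^ k := by
          intro θ hθ
          have hθ' := Ioo_subset_Icc_self hθ
          have h0 : 0 < θ := hθ.1
          have hcl := hcφ θ hθ'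
          have h2 := hE θ hθ'
          rw [hef, norm_mul, norm_mul] at h2
          have h3 : ‖((φ θ : ℂ) + 1)‖ = φ θ + 1 := by
            rw [← Complex.ofReal_one, ← Complex.ofReal_add, Complex.norm_real, Real.norm_eq_abs,
              abs_of_nonneg (hc0.le.trans hcl)]
          rw [h3, Complex.norm_real, Real.norm_eq_abs, abs_of_pos h0] at h2
          have h4 : θ * c * ‖f' θ‖ ≤ θ * (c * (M * K ^ (k + 1) / k.factorial * θ ^ k)) := by
            calc θ * c * ‖f' θ‖ ≤ θ * (φ θ + 1) * ‖f' θ‖ := by gcongr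
              _ ≤ _ := h2
              _ ≤ |z₁ - 1| * ‖Λ‖ * (M * K ^ k / k.factorial) * θ ^ (k + 1) := by
                -- The factor 1 / (k + 1) is given away here; the integration of f' supplies the one
                -- that builds (k + 1)!.
                refine div_le_self (by positivity) ?_
                linarith [Nat.cast_nonneg (α := ℝ) k]
              _ = _ := by
                rw [pow_succ K, pow_succ θ, hK]; field_simp
          rw [mul_assoc] at h4
          exact le_of_mul_le_mul_left (le_of_mul_le_mul_left h4 h0) hc0
        intro θ hθ
        rcases hθ.1.eq_or_lt with rfl | h0
        -- At θ = 0 the relation between e and f' degenerates; the bound there is the limit of the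
        -- bounds at positive θ.
        · have hc1 : ContinuousAt f' 0 := by
            refine continuousAt_const.mul (ContinuousAt.comp ?_ (hφd 0).continuousAt)
            simpa [hφ] using hd1
          have hc2 : ContinuousAt (fun θ : ℝ => M * K ^ (k + 1) / k.factorial * θ ^ k) 0 := by
            fun_prop
          refine le_of_tendsto_of_tendsto (b := 𝓝[>] (0 : ℝ))
            (hc1.norm.tendsto.mono_left nhdsWithin_le_nhds)
            (hc2.tendsto.mono_left nhdsWithin_le_nhds) ?_
          exact eventually_of_mem (Ioo_mem_nhdsGT one_pos) hint
        · exact hint θ ⟨h0, hθ.2⟩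
  have hlim : Tendsto (fun k : ℕ => M * K ^ k / k.factorial * (1 : ℝ) ^ k) atTop (𝓝 0) := by
    have := (FloorSemiring.tendsto_pow_div_factorial_atTop K).const_mul M
    simpa [mul_div_assoc] using this
  have h0 : ‖f 1‖ ≤ 0 := ge_of_tendsto' hlim fun k => key k 1 (by simp)
  have : f 1 = D z₁ := by simp [hf, hφ]
  rw [← this]
  exact norm_le_zero_iff.1 h0

theorem SolvesLegendre.eq {Λ : ℂ} {P p Q q : ℝ → ℂ} {s : Set ℝ} (hP : SolvesLegendre Λ P p s)
    (hQ : SolvesLegendre Λ Q q s) (hs : Convex ℝ s) (h1s : (1 : ℝ) ∈ s) (hpos : ∀ z ∈ s, -1 < z)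
    (h1 : P 1 = Q 1) (hp : ContinuousAt p 1) (hq : ContinuousAt q 1) {z : ℝ} (hz : z ∈ s) :
    P z = Q z :=
  sub_eq_zero.1 ((hP.sub hQ).eq_zero hs h1s hpos (by simp [h1]) (hp.sub hq) hz)

/-! ### The Legendre function as a solution -/

/-- The derivative of `legendreP`. -/
noncomputable def legendreP' (ν : ℂ) (z : ℝ) : ℂ :=
  (((1 + z) / 2 : ℝ) : ℂ) ^ ν *
    (ν / (1 + z) * ₂F₁ (-ν) (-ν) (1 : ℂ) (((z - 1) / (z + 1) : ℝ) : ℂ)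
      + 2 / (z + 1) ^ 2 * hypDeriv (-ν) (-ν) (((z - 1) / (z + 1) : ℝ) : ℂ))

theorem norm_cayley_lt_one {z : ℝ} (hz : 0 < z) : ‖(((z - 1) / (z + 1) : ℝ) : ℂ)‖ < 1 := by
  rw [Complex.norm_real, Real.norm_eq_abs, abs_div, abs_of_pos (by linarith : 0 < z + 1),
    div_lt_one (by linarith), abs_lt]
  constructor <;> linarith

theorem hasDerivAt_cayley {z : ℝ} (hz : 0 < z) :
    HasDerivAt (fun z : ℝ => (((z - 1) / (z + 1) : ℝ) : ℂ)) (2 / ((z : ℂ) + 1) ^ 2) z := by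
  have h : HasDerivAt (fun z : ℝ => (z - 1) / (z + 1)) (2 / (z + 1) ^ 2) z := by
    have := ((hasDerivAt_id z).sub_const 1).div ((hasDerivAt_id z).add_const 1)
      (by simp; linarith)
    convert! this using 1
    simp; ring
  have := h.ofReal_comp
  convert! this using 1
  push_cast; rfl

theorem hasDerivAt_half_one_add_cpow (ν : ℂ) {z : ℝ} (hz : 0 < z) :
    HasDerivAt (fun z : ℝ => (((1 + z) / 2 : ℝ) : ℂ) ^ ν)
      ((((1 + z) / 2 : ℝ) : ℂ) ^ ν * (ν / (1 + z))) z := by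
  have h : HasDerivAt (fun z : ℝ => (((1 + z) / 2 : ℝ) : ℂ)) (1 / 2) z := by
    have := ((((hasDerivAt_id z).const_add 1).div_const 2)).ofReal_comp
    simpa using this
  have hpos : 0 < (1 + z) / 2 := by linarith
  have hs : (((1 + z) / 2 : ℝ) : ℂ) ∈ Complex.slitPlane := by
    rw [Complex.ofReal_mem_slitPlane]; exact hpos
  have := (hasDerivAt_id ((((1 + z) / 2 : ℝ) : ℂ))).cpow_const (c := ν) hs
  have h2 := this.comp_of_eq z h rfl
  convert! h2 using 1
  have hne : (((1 + z) / 2 : ℝ) : ℂ) ≠ 0 := by exact_mod_cast hpos.ne'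
  have hne' : (1 + (z : ℂ)) ≠ 0 := by exact_mod_cast (by linarith : (1 + z) ≠ 0)
  simp only [id]
  rw [Complex.cpow_sub _ _ hne, Complex.cpow_one]
  push_cast
  field_simp

/-- With w = (z - 1)/(z + 1), F the hypergeometric factor and Y the power of (1 + z)/2, the quantity
(z² - 1) P' equals Y (ν (z - 1) F + 2 w F'). Differentiating it once more reproduces the
hypergeometric equation for F. -/
theorem solvesLegendre_legendreP (ν : ℂ) :
    SolvesLegendre (ν * (ν + 1)) (legendreP ν) (legendreP' ν) (Ioi 0) := by
  intro z hz
  have hz : 0 < z := hz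
  have hw := norm_cayley_lt_one hz
  have hne : ((z : ℂ) + 1) ≠ 0 := by exact_mod_cast (by linarith : (z + 1) ≠ 0)
  have hne' : (1 + (z : ℂ)) ≠ 0 := by rwa [add_comm]
  have hy := hasDerivAt_half_one_add_cpow ν hz
  have hF := (hasDerivAt_hyp (-ν) (-ν) hw).comp z (hasDerivAt_cayley hz)
  have hF' := (hasDerivAt_hypDeriv (-ν) (-ν) hw).comp z (hasDerivAt_cayley hz)
  refine ⟨?_, ?_⟩
  · have := hy.mul hF
    convert! this using 1
    simp only [legendreP', Function.comp_apply]
    ring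
  · have hid : HasDerivAt (fun z : ℝ => (z : ℂ)) 1 z := Complex.ofRealCLM.hasDerivAt
    have hmain := hy.mul ((((hid.sub_const 1).const_mul ν).mul hF).add
      (((hasDerivAt_cayley hz).const_mul 2).mul hF'))
    refine (hmain.congr_of_eventuallyEq (f₁ := fun z : ℝ => ((z : ℂ) ^ 2 - 1) * legendreP' ν z)
      ?_).congr_deriv ?_
    · refine eventuallyEq_of_mem (Ioi_mem_nhds hz) ?_
      intro y hy
      have hy : 0 < y := hy
      have hne : ((y : ℂ) + 1) ≠ 0 := by exact_mod_cast (by linarith : (y + 1) ≠ 0)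
      have hne' : (1 + (y : ℂ)) ≠ 0 := by rwa [add_comm]
      have e1 : ((y : ℂ) ^ 2 - 1) * (ν / (1 + y)) = ν * (y - 1) := by
        field_simp; ring
      have e2 : ((y : ℂ) ^ 2 - 1) * (2 / (y + 1) ^ 2) = 2 * (((y - 1) / (y + 1) : ℝ) : ℂ) := by
        push_cast; field_simp; ring
      simp only [legendreP', Pi.mul_apply, Pi.add_apply, Function.comp_apply]
      rw [← e1, ← e2]
      ring
    have ode := hypergeometric_equation (-ν) (-ν) hw
    simp only [legendreP, Pi.mul_apply, Pi.add_apply, Function.comp_apply]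
    set F := ₂F₁ (-ν) (-ν) (1 : ℂ) (((z - 1) / (z + 1) : ℝ) : ℂ)
    set F' := hypDeriv (-ν) (-ν) (((z - 1) / (z + 1) : ℝ) : ℂ)
    set F'' := hypDeriv₂ (-ν) (-ν) (((z - 1) / (z + 1) : ℝ) : ℂ)
    set Y := (((1 + z) / 2 : ℝ) : ℂ) ^ ν
    -- In terms of v = 1/(z + 1) everything becomes polynomial, modulo the single relation (z + 1) v
    -- = 1.
    have hwz : (((z - 1) / (z + 1) : ℝ) : ℂ) = 1 - 2 * ((z : ℂ) + 1)⁻¹ := by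
      push_cast; field_simp; ring
    have hi : ((z : ℂ) + 1) * ((z : ℂ) + 1)⁻¹ = 1 := mul_inv_cancel₀ hne
    rw [hwz] at ode ⊢
    rw [add_comm (1 : ℂ) (z : ℂ)]
    simp only [div_eq_mul_inv, ← inv_pow]
    generalize ((z : ℂ) + 1)⁻¹ = v at *
    linear_combination Y * 2 * v * ode + (2 * Y * ν * v * F' + Y * ν ^ 2 * F) * hi

end BuschmanErdelyi

namespace BuschmanErdelyi
open Filter Topology

theorem legendreP_one (ν : ℂ) : legendreP ν 1 = 1 := by
  simp [legendreP]

theorem continuousOn_legendreP' (ν : ℂ) : ContinuousOn (legendreP' ν) (Ioi 0) := by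
  intro z hz
  have hz : 0 < z := hz
  have hw := norm_cayley_lt_one hz
  have hne : ((z : ℂ) + 1) ≠ 0 := by exact_mod_cast (by linarith : (z + 1) ≠ 0)
  have hne' : (1 + (z : ℂ)) ≠ 0 := by rwa [add_comm]
  have hid : ContinuousAt (fun z : ℝ => (z : ℂ)) z := Complex.continuous_ofReal.continuousAt
  have hy := (hasDerivAt_half_one_add_cpow ν hz).continuousAt
  have hF := ((hasDerivAt_hyp (-ν) (-ν) hw).comp z (hasDerivAt_cayley hz)).continuousAt
  have hF' := ((hasDerivAt_hypDeriv (-ν) (-ν) hw).comp z (hasDerivAt_cayley hz)).continuousAt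
  refine ContinuousAt.continuousWithinAt (hy.mul (ContinuousAt.add (ContinuousAt.mul ?_ hF)
    (ContinuousAt.mul ?_ hF')))
  · exact continuousAt_const.div (continuousAt_const.add hid) hne'
  · exact continuousAt_const.div ((hid.add continuousAt_const).pow 2) (pow_ne_zero 2 hne)

theorem continuousOn_legendreP (ν : ℂ) : ContinuousOn (legendreP ν) (Ioi 0) := fun z hz =>
  ((solvesLegendre_legendreP ν z hz).1).continuousAt.continuousWithinAt

/-! ### Behaviour near the origin -/

/-- The expansion of the Legendre function at `1`, valid on `(-1, 3)`. -/
noncomputable def legendreSeries (ν : ℂ) (z : ℝ) : ℂ :=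
  ₂F₁ (-ν) (ν + 1) (1 : ℂ) (((1 - z) / 2 : ℝ) : ℂ)

/-- The derivative of `legendreSeries`. -/
noncomputable def legendreSeries' (ν : ℂ) (z : ℝ) : ℂ :=
  -1 / 2 * hypDeriv (-ν) (ν + 1) (((1 - z) / 2 : ℝ) : ℂ)

theorem norm_half_one_sub_lt_one {z : ℝ} (hz : z ∈ Ioo (-1 : ℝ) 3) :
    ‖(((1 - z) / 2 : ℝ) : ℂ)‖ < 1 := by
  rw [Complex.norm_real, Real.norm_eq_abs, abs_lt]
  constructor <;> linarith [hz.1, hz.2]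

theorem hasDerivAt_half_one_sub (z : ℝ) :
    HasDerivAt (fun z : ℝ => (((1 - z) / 2 : ℝ) : ℂ)) (-1 / 2) z := by
  have := (((hasDerivAt_id z).const_sub 1).div_const 2).ofReal_comp
  convert! this using 1
  push_cast; rfl

theorem solvesLegendre_legendreSeries (ν : ℂ) :
    SolvesLegendre (ν * (ν + 1)) (legendreSeries ν) (legendreSeries' ν) (Ioo (-1) 3) := by
  intro z hz
  have hw := norm_half_one_sub_lt_one hz
  have hF := (hasDerivAt_hyp (-ν) (ν + 1) hw).comp z (hasDerivAt_half_one_sub z)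
  have hF' := (hasDerivAt_hypDeriv (-ν) (ν + 1) hw).comp z (hasDerivAt_half_one_sub z)
  refine ⟨?_, ?_⟩
  · convert! hF using 1
    rw [legendreSeries']; ring
  · have hid : HasDerivAt (fun z : ℝ => (z : ℂ)) 1 z := Complex.ofRealCLM.hasDerivAt
    have := ((hid.pow 2).sub_const 1).mul (hF'.const_mul (-1 / 2))
    refine this.congr_deriv ?_
    have ode := hypergeometric_equation (-ν) (ν + 1) hw
    simp only [legendreSeries, Function.comp_apply]
    have hwz : (z : ℂ) = 1 - 2 * (((1 - z) / 2 : ℝ) : ℂ) := by push_cast; ring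
    generalize (((1 - z) / 2 : ℝ) : ℂ) = w at *
    simp
    rw [hwz]
    linear_combination -ode

theorem continuousOn_legendreSeries' (ν : ℂ) :
    ContinuousOn (legendreSeries' ν) (Ioo (-1) 3) := fun z hz =>
  ContinuousAt.continuousWithinAt (((hasDerivAt_hypDeriv (-ν) (ν + 1)
    (norm_half_one_sub_lt_one hz)).comp z (hasDerivAt_half_one_sub z)).const_mul
      (-1 / 2)).continuousAt

/-- The hypergeometric function is holomorphic in the unit disc, which contains the image of [0, 1].
This is the source of the Taylor expansions at 0 in the case of non-integral degree. -/
theorem contDiffOn_legendreSeries (ν : ℂ) (n : ℕ) :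
    ContDiffOn ℝ n (legendreSeries ν) (Icc 0 1) := by
  have h1 : DifferentiableOn ℂ (₂F₁ (-ν) (ν + 1) (1 : ℂ)) (Metric.ball (0 : ℂ) 1) := fun w hw =>
    (hasDerivAt_hyp (-ν) (ν + 1) (mem_ball_zero_iff.1 hw)).differentiableAt.differentiableWithinAt
  have h2 : ContDiffOn ℝ n (₂F₁ (-ν) (ν + 1) (1 : ℂ)) (Metric.ball (0 : ℂ) 1) :=
    (h1.contDiffOn Metric.isOpen_ball).restrict_scalars ℝ
  have h3 : ContDiff ℝ n (fun z : ℝ => (((1 - z) / 2 : ℝ) : ℂ)) :=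
    Complex.ofRealCLM.contDiff.comp ((contDiff_const.sub contDiff_id).div_const 2)
  refine h2.comp h3.contDiffOn fun z hz => ?_
  exact mem_ball_zero_iff.2 (norm_half_one_sub_lt_one ⟨by linarith [hz.1], by linarith [hz.2]⟩)

/-- Both sides solve Legendre's equation, are regular at 1 and take the value 1 there. The series
still converges at 0 and beyond, so it carries the regularity of P up to the origin. -/
theorem legendreP_eq_legendreSeries (ν : ℂ) {z : ℝ} (hz : z ∈ Ioo (0 : ℝ) 3) :
    legendreP ν z = legendreSeries ν z := by
  refine SolvesLegendre.eq ((solvesLegendre_legendreP ν).mono Ioo_subset_Ioi_self)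
    ((solvesLegendre_legendreSeries ν).mono (Ioo_subset_Ioo_left (by norm_num)))
    (convex_Ioo 0 3) (by norm_num) (fun z hz => by linarith [hz.1]) ?_ ?_ ?_ hz
  · simp [legendreP_one, legendreSeries]
  · exact (continuousOn_legendreP' ν).continuousAt (Ioi_mem_nhds one_pos)
  · exact (continuousOn_legendreSeries' ν).continuousAt (Ioo_mem_nhds (by norm_num) (by norm_num))

theorem legendreP'_eq_legendreSeries' (ν : ℂ) {z : ℝ} (hz : z ∈ Ioo (0 : ℝ) 3) :
    legendreP' ν z = legendreSeries' ν z := by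
  refine ((solvesLegendre_legendreP ν z hz.1).1).unique (HasDerivAt.congr_of_eventuallyEq
    ((solvesLegendre_legendreSeries ν z ⟨by linarith [hz.1], hz.2⟩).1) ?_)
  exact eventuallyEq_of_mem (Ioo_mem_nhds hz.1 hz.2) fun y hy => legendreP_eq_legendreSeries ν hy

theorem exists_bound_legendreP' (ν : ℂ) :
    ∃ M : ℝ, 0 ≤ M ∧ ∀ z ∈ Ioc (0 : ℝ) 1, ‖legendreP' ν z‖ ≤ M := by
  obtain ⟨M, hM⟩ := isCompact_Icc.exists_bound_of_continuousOn
    ((continuousOn_legendreSeries' ν).mono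
      (fun z (hz : z ∈ Icc (0 : ℝ) 1) => ⟨by linarith [hz.1], by linarith [hz.2]⟩))
  refine ⟨M, (norm_nonneg _).trans (hM 0 (by simp)), fun z hz => ?_⟩
  rw [legendreP'_eq_legendreSeries' ν ⟨hz.1, by linarith [hz.2]⟩]
  exact hM z ⟨hz.1.le, hz.2⟩

/-- A Legendre function that is a polynomial on `(0, 1)` has integral degree. -/
theorem exists_int_of_legendreP_eq_polynomial {ν : ℂ} (Q : Polynomial ℂ)
    (hQ : ∀ z ∈ Ioo (0 : ℝ) 1, legendreP ν z = Q.eval (z : ℂ)) : ∃ n : ℤ, ν = n := by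
  have hev : ∀ (R : Polynomial ℂ) (z : ℝ),
      HasDerivAt (fun z : ℝ => R.eval (z : ℂ)) (R.derivative.eval (z : ℂ)) z := fun R z =>
    (R.hasDerivAt (z : ℂ)).comp_ofReal
  have hQ' : ∀ z ∈ Ioo (0 : ℝ) 1, legendreP' ν z = Q.derivative.eval (z : ℂ) := fun z hz =>
    ((solvesLegendre_legendreP ν z hz.1).1).unique ((hev Q z).congr_of_eventuallyEq
      (eventuallyEq_of_mem (Ioo_mem_nhds hz.1 hz.2) hQ))
  set R : Polynomial ℂ := (Polynomial.X ^ 2 - 1) * Q.derivative with hR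
  have hode : ∀ z ∈ Ioo (0 : ℝ) 1, (R.derivative - Polynomial.C (ν * (ν + 1)) * Q).eval (z : ℂ)
      = 0 := by
    intro z hz
    have h1 := (solvesLegendre_legendreP ν z hz.1).2
    have h2 := (hev R z).congr_of_eventuallyEq (f₁ := fun z : ℝ => ((z : ℂ) ^ 2 - 1) * legendreP' ν z)
      (eventuallyEq_of_mem (Ioo_mem_nhds hz.1 hz.2) fun y hy => by simp [hR, hQ' y hy])
    have := h1.unique h2
    rw [hQ z hz] at this
    simp [← this]
  -- An identity of polynomials at infinitely many points is an identity of polynomials, so its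
  -- coefficients may be compared.
  have hzero : R.derivative - Polynomial.C (ν * (ν + 1)) * Q = 0 := by
    refine Polynomial.eq_zero_of_infinite_isRoot _ (Set.Infinite.mono ?_
      ((Ioo_infinite (zero_lt_one (α := ℝ))).image Complex.ofReal_injective.injOn))
    rintro _ ⟨z, hz, rfl⟩
    exact hode z hz
  have hQ0 : Q ≠ 0 := by
    rintro rfl
    have hc : ContinuousAt (legendreP ν) 1 :=
      (continuousOn_legendreP ν).continuousAt (Ioi_mem_nhds one_pos)
    have h1 : Tendsto (legendreP ν) (𝓝[<] 1) (𝓝 1) := by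
      have := hc.tendsto.mono_left (nhdsWithin_le_nhds (s := Iio 1))
      rwa [legendreP_one] at this
    have h2 : Tendsto (legendreP ν) (𝓝[<] 1) (𝓝 0) := by
      refine tendsto_const_nhds.congr' (eventually_of_mem (Ioo_mem_nhdsLT one_pos) fun z hz => ?_)
      simp [hQ z hz]
    exact one_ne_zero (tendsto_nhds_unique h1 h2)
  set d := Q.natDegree with hd
  have hlead : Q.coeff d ≠ 0 := by simpa [hd] using hQ0
  -- This is the coefficient of degree d in Legendre's equation: it equates d (d + 1) with ν (ν +
  -- 1).
  have hcoef : ((d : ℂ) * (d + 1) - ν * (ν + 1)) * Q.coeff d = 0 := by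
    have h1 := congrArg (fun S : Polynomial ℂ => S.coeff d) hzero
    have hup : ∀ j, d < j → Q.coeff j = 0 := fun j hj => Polynomial.coeff_eq_zero_of_natDegree_lt hj
    have h2 : R.coeff (d + 1) = d * Q.coeff d := by
      rw [hR, sub_mul, one_mul, Polynomial.coeff_sub, Polynomial.coeff_derivative,
        hup (d + 1 + 1) (by omega)]
      rcases Nat.eq_zero_or_pos d with h0 | h0
      · rw [h0, Polynomial.coeff_X_pow_mul']
        simp
      · obtain ⟨e, he⟩ : ∃ e, d = e + 1 := ⟨d - 1, by omega⟩
        rw [show d + 1 = e + 2 by omega, Polynomial.coeff_X_pow_mul, Polynomial.coeff_derivative,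
          ← he, he]
        push_cast
        ring
    simp only [Polynomial.coeff_sub, Polynomial.coeff_derivative, Polynomial.coeff_C_mul, h2,
      Polynomial.coeff_zero] at h1
    linear_combination h1
  have hfac : ((d : ℂ) - ν) * (d + ν + 1) = 0 := by
    have := (mul_eq_zero.1 hcoef).resolve_right hlead
    linear_combination this
  rcases mul_eq_zero.1 hfac with h | h
  · exact ⟨d, by push_cast; linear_combination -h⟩
  · exact ⟨-d - 1, by push_cast; linear_combination h⟩

/-! ### Integral degree -/

/-- `choose n k * choose (n + k) k`, the coefficients of the Legendre polynomial of degree `n` in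
powers of `(z - 1) / 2`. -/
noncomputable def legendreCoeff (n k : ℕ) : ℝ := (n.choose k * (n + k).choose k : ℕ)

theorem legendreCoeff_succ (n k : ℕ) :
    ((k : ℝ) + 1) ^ 2 * legendreCoeff n (k + 1)
      = (n * (n + 1) - k * (k + 1)) * legendreCoeff n k := by
  have h1 : (n.choose (k + 1) : ℝ) * (k + 1) = n.choose k * (n - k) := by
    rcases le_total k n with h | h
    · have := Nat.choose_succ_right_eq n k
      rw [← Nat.cast_sub h]; exact_mod_cast this
    · rcases h.eq_or_lt with rfl | h
      · simp
      · rw [Nat.choose_eq_zero_of_lt h, Nat.choose_eq_zero_of_lt (by omega)]; simp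
  have h2 : ((n + (k + 1)).choose (k + 1) : ℝ) * (k + 1) = (n + k + 1) * (n + k).choose k := by
    have := Nat.add_one_mul_choose_eq (n + k) k
    exact_mod_cast this.symm
  simp only [legendreCoeff]
  push_cast
  linear_combination ((n + (k + 1)).choose (k + 1) : ℝ) * (k + 1) * h1
    + (n.choose k : ℝ) * (n - k) * h2

/-- The Legendre polynomial in the variable `(z - 1) / 2`. -/
noncomputable def shiftedPoly (n : ℕ) : Polynomial ℝ :=
  ∑ k ∈ Finset.range (n + 1), Polynomial.monomial k (legendreCoeff n k)

theorem coeff_shiftedPoly (n k : ℕ) : (shiftedPoly n).coeff k = legendreCoeff n k := by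
  simp only [shiftedPoly, Polynomial.finsetSum_coeff, Polynomial.coeff_monomial]
  rw [Finset.sum_ite_eq' (Finset.range (n + 1)) k]
  split_ifs with h
  · rfl
  · have : n < k := by simpa using h
    simp [legendreCoeff, Nat.choose_eq_zero_of_lt this]

open Polynomial in
-- Coefficient by coefficient this is the recursion `legendreCoeff_succ`; it is Legendre's equation
-- in the variable (z - 1)/2.
theorem shiftedPoly_equation (n : ℕ) :
    X * (1 + X) * derivative (derivative (shiftedPoly n))
      + (1 + C 2 * X) * derivative (shiftedPoly n) = C ((n : ℝ) * (n + 1)) * shiftedPoly n := by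
  have e : X * (1 + X) * derivative (derivative (shiftedPoly n))
      + (1 + C 2 * X) * derivative (shiftedPoly n)
      = X * derivative (derivative (shiftedPoly n)) + X ^ 2 * derivative (derivative (shiftedPoly n))
        + derivative (shiftedPoly n) + C 2 * (X * derivative (shiftedPoly n)) := by ring
  rw [e]
  ext k
  have hk := legendreCoeff_succ n k
  rw [coeff_C_mul, coeff_shiftedPoly]
  rcases k with _ | _ | k
  · simp [coeff_derivative, coeff_shiftedPoly] at hk ⊢
    linear_combination hk
  · simp [coeff_derivative, coeff_shiftedPoly, coeff_X_pow_mul'] at hk ⊢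
    linear_combination hk
  · simp [coeff_derivative, coeff_shiftedPoly, coeff_X_pow_mul'] at hk ⊢
    linear_combination hk

/-- The Legendre polynomial of degree `n`. -/
noncomputable def legendrePoly (n : ℕ) (z : ℝ) : ℝ := (shiftedPoly n).eval ((z - 1) / 2)

/-- The derivative of the Legendre polynomial of degree `n`. -/
noncomputable def legendrePoly' (n : ℕ) (z : ℝ) : ℝ :=
  1 / 2 * (shiftedPoly n).derivative.eval ((z - 1) / 2)

theorem hasDerivAt_eval_half_sub_one (Q : Polynomial ℝ) (z : ℝ) :
    HasDerivAt (fun z : ℝ => Q.eval ((z - 1) / 2)) (1 / 2 * Q.derivative.eval ((z - 1) / 2)) z := by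
  have h : HasDerivAt (fun z : ℝ => (z - 1) / 2) (1 / 2) z :=
    ((hasDerivAt_id z).sub_const 1).div_const 2
  have := (Q.hasDerivAt ((z - 1) / 2)).comp z h
  rwa [mul_comm] at this

theorem hasDerivAt_legendrePoly (n : ℕ) (z : ℝ) :
    HasDerivAt (legendrePoly n) (legendrePoly' n z) z :=
  hasDerivAt_eval_half_sub_one _ z

theorem continuous_legendrePoly (n : ℕ) : Continuous (legendrePoly n) :=
  continuous_iff_continuousAt.2 fun z => (hasDerivAt_legendrePoly n z).continuousAt

theorem continuous_legendrePoly' (n : ℕ) : Continuous (legendrePoly' n) :=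
  continuous_iff_continuousAt.2 fun z =>
    ((hasDerivAt_eval_half_sub_one (shiftedPoly n).derivative z).const_mul (1 / 2)).continuousAt

theorem hasDerivAt_legendrePoly_equation (n : ℕ) (z : ℝ) :
    HasDerivAt (fun z => (z ^ 2 - 1) * legendrePoly' n z) (n * (n + 1) * legendrePoly n z) z := by
  have h := (((hasDerivAt_id z).pow 2).sub_const 1).mul
    ((hasDerivAt_eval_half_sub_one (shiftedPoly n).derivative z).const_mul (1 / 2))
  refine h.congr_deriv ?_
  have ode := congrArg (Polynomial.eval ((z - 1) / 2)) (shiftedPoly_equation n)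
  simp only [Polynomial.eval_add, Polynomial.eval_mul, Polynomial.eval_X, Polynomial.eval_C,
    Polynomial.eval_one] at ode
  simp only [legendrePoly, Pi.pow_apply, id]
  push_cast
  linear_combination ode

theorem legendrePoly_one (n : ℕ) : legendrePoly n 1 = 1 := by
  simp [legendrePoly, ← Polynomial.coeff_zero_eq_eval_zero, coeff_shiftedPoly, legendreCoeff]

theorem legendrePoly_eq_sum (n : ℕ) (z : ℝ) : legendrePoly n z =
    1 + ∑ k ∈ Finset.range n, legendreCoeff n (k + 1) * ((z - 1) / 2) ^ (k + 1) := by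
  rw [legendrePoly, shiftedPoly, Polynomial.eval_finsetSum, Finset.sum_range_succ']
  simp [legendreCoeff, add_comm]

theorem legendrePoly'_eq_sum (n : ℕ) (z : ℝ) : legendrePoly' n z =
    1 / 2 * ∑ k ∈ Finset.range n, legendreCoeff n (k + 1) * (k + 1) * ((z - 1) / 2) ^ k := by
  rw [legendrePoly', shiftedPoly, Polynomial.derivative_sum, Polynomial.eval_finsetSum,
    Finset.sum_range_succ']
  simp

theorem legendreCoeff_nonneg (n k : ℕ) : 0 ≤ legendreCoeff n k := Nat.cast_nonneg _

theorem legendrePoly'_nonneg (n : ℕ) {z : ℝ} (hz : 1 ≤ z) : 0 ≤ legendrePoly' n z := by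
  rw [legendrePoly'_eq_sum]
  have : 0 ≤ (z - 1) / 2 := by linarith
  exact mul_nonneg (by norm_num) (Finset.sum_nonneg fun k _ => mul_nonneg
    (mul_nonneg (legendreCoeff_nonneg _ _) (by positivity)) (by positivity))

theorem one_le_legendrePoly (n : ℕ) {z : ℝ} (hz : 1 ≤ z) : 1 ≤ legendrePoly n z := by
  rw [legendrePoly_eq_sum]
  have : 0 ≤ (z - 1) / 2 := by linarith
  have : 0 ≤ ∑ k ∈ Finset.range n, legendreCoeff n (k + 1) * ((z - 1) / 2) ^ (k + 1) :=
    Finset.sum_nonneg fun k _ => mul_nonneg (legendreCoeff_nonneg _ _) (by positivity)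
  linarith

/-- Legendre polynomials are even or odd, so that one of `P(0)`, `P'(0)` vanishes. -/
theorem legendrePoly_zero_mul_legendrePoly'_zero (n : ℕ) :
    legendrePoly n 0 * legendrePoly' n 0 = 0 := by
  -- Up to the factor z² - 1 this is the Wronskian of the two solutions P(z) and P(-z). It is
  -- constant, vanishes at 1 and equals -2 P(0) P'(0) at 0.
  set W : ℝ → ℝ := fun z => legendrePoly n (-z) * ((z ^ 2 - 1) * legendrePoly' n z)
    + legendrePoly n z * (((-z) ^ 2 - 1) * legendrePoly' n (-z)) with hW
  have hWd : ∀ z, HasDerivAt W 0 z := by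
    intro z
    have hn : HasDerivAt (fun z : ℝ => -z) (-1) z := hasDerivAt_neg z
    have h1 := (hasDerivAt_legendrePoly n (-z)).comp z hn
    have h2 := (hasDerivAt_legendrePoly_equation n (-z)).comp z hn
    have h3 := (h1.mul (hasDerivAt_legendrePoly_equation n z)).add
      ((hasDerivAt_legendrePoly n z).mul h2)
    refine h3.congr_deriv ?_
    simp only [Function.comp_apply]
    ring
  have hc := is_const_of_deriv_eq_zero (fun z => (hWd z).differentiableAt)
    (fun z => (hWd z).deriv) 0 1
  simp [hW] at hc
  rcases hc with h | h <;> simp [h]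

/-- Only ν (ν + 1) enters Legendre's equation, and it is invariant under ν ↦ -ν - 1, which sends the
negative degrees to the natural numbers. -/
theorem exists_legendrePoly {ν : ℂ} (hν : ∃ m : ℤ, ν = m) :
    ∃ n : ℕ, ν * (ν + 1) = n * (n + 1) := by
  obtain ⟨m, rfl⟩ := hν
  rcases m with n | n
  · exact ⟨n, by simp⟩
  · exact ⟨n, by push_cast; ring⟩

/-- Uniqueness of the solution of Legendre's equation that is regular at 1 with value 1. -/
theorem legendreP_eq_legendrePoly {ν : ℂ} {n : ℕ} (h : ν * (ν + 1) = n * (n + 1)) {z : ℝ}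
    (hz : 0 < z) : legendreP ν z = legendrePoly n z := by
  refine SolvesLegendre.eq (q := fun z => (legendrePoly' n z : ℂ)) (solvesLegendre_legendreP ν)
    (fun z _ => ⟨(hasDerivAt_legendrePoly n z).ofReal_comp, ?_⟩)
    (convex_Ioi 0) (by simp) (fun z hz => by linarith [mem_Ioi.1 hz]) ?_ ?_ ?_ hz
  · rw [h]
    have := (hasDerivAt_legendrePoly_equation n z).ofReal_comp
    convert! this using 1
    · funext y; push_cast; ring
    · push_cast; ring
  · simp [legendreP_one, legendrePoly_one]
  · exact (continuousOn_legendreP' ν).continuousAt (Ioi_mem_nhds one_pos)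
  · exact (Complex.continuous_ofReal.comp (continuous_legendrePoly' n)).continuousAt

theorem legendreP'_eq_legendrePoly' {ν : ℂ} {n : ℕ} (h : ν * (ν + 1) = n * (n + 1)) {z : ℝ}
    (hz : 0 < z) : legendreP' ν z = legendrePoly' n z :=
  ((solvesLegendre_legendreP ν z hz).1).unique
    ((hasDerivAt_legendrePoly n z).ofReal_comp.congr_of_eventuallyEq
      (eventuallyEq_of_mem (Ioi_mem_nhds hz) fun _ hy => legendreP_eq_legendrePoly h hy))

end BuschmanErdelyi

namespace BuschmanErdelyi
open Filter Topology ENNReal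

/-! ### Integral operators on the half-line -/

/-- Lebesgue measure on the half-line `(0, ∞)`. -/
noncomputable abbrev halfLine : Measure ℝ := volume.restrict (Ioi (0 : ℝ))

theorem ae_halfLine_pos : ∀ᵐ x ∂halfLine, 0 < x := ae_restrict_mem measurableSet_Ioi

theorem sq_lintegral_mul_le {α : Type*} [MeasurableSpace α] {μ : Measure α} {f g : α → ℝ≥0∞}
    (hf : AEMeasurable f μ) (hg : AEMeasurable g μ) :
    (∫⁻ a, f a * g a ∂μ) ^ 2 ≤ (∫⁻ a, f a ^ 2 ∂μ) * ∫⁻ a, g a ^ 2 ∂μ := by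
  have h := ENNReal.lintegral_mul_le_Lp_mul_Lq μ (p := 2) (q := 2)
    (by constructor <;> norm_num) hf hg
  have h2 := pow_le_pow_left' h 2
  rw [mul_pow, ← ENNReal.rpow_natCast, ← ENNReal.rpow_natCast, ← ENNReal.rpow_natCast,
    ← ENNReal.rpow_mul, ← ENNReal.rpow_mul] at h2
  simpa using h2

/-- Schur's test. -/
theorem lintegral_sq_le_of_schur {μ : Measure ℝ} [SFinite μ] {K : ℝ → ℝ → ℝ≥0∞} {w : ℝ → ℝ≥0∞}
    {C : ℝ≥0∞} (hK : Measurable (Function.uncurry K)) (hw : Measurable w)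
    (hw0 : ∀ᵐ t ∂μ, w t ≠ 0) (hwt : ∀ᵐ t ∂μ, w t ≠ ∞)
    (h1 : ∀ᵐ x ∂μ, ∫⁻ t, K x t * w t ∂μ ≤ C * w x)
    (h2 : ∀ᵐ t ∂μ, ∫⁻ x, K x t * w x ∂μ ≤ C * w t)
    {F : ℝ → ℝ≥0∞} (hF : AEMeasurable F μ) :
    ∫⁻ x, (∫⁻ t, K x t * F t ∂μ) ^ 2 ∂μ ≤ C ^ 2 * ∫⁻ t, F t ^ 2 ∂μ := by
  have hsq : ∀ a : ℝ≥0∞, (a ^ (1 / 2 : ℝ)) ^ 2 = a := fun a => by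
    rw [← ENNReal.rpow_natCast, ← ENNReal.rpow_mul]; norm_num
  have hKx : ∀ x, Measurable (K x) := fun x => hK.comp (measurable_const.prodMk measurable_id)
  have hKt : ∀ t, Measurable (fun x => K x t) := fun t =>
    hK.comp (measurable_id.prodMk measurable_const)
  have step : ∀ᵐ x ∂μ, (∫⁻ t, K x t * F t ∂μ) ^ 2
      ≤ C * ∫⁻ t, w x * (K x t * ((w t)⁻¹ * F t ^ 2)) ∂μ := by
    filter_upwards [h1] with x hx
    -- The split K F = (K w)^(1/2) (K F² / w)^(1/2) prepares Cauchy–Schwarz; the first factor is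
    -- then controlled by the row condition.
    have e : ∫⁻ t, K x t * F t ∂μ =
        ∫⁻ t, (K x t * w t) ^ (1 / 2 : ℝ) * (K x t * ((w t)⁻¹ * F t ^ 2)) ^ (1 / 2 : ℝ) ∂μ := by
      refine lintegral_congr_ae ?_
      filter_upwards [hw0, hwt] with t ht0 htt
      rw [← ENNReal.mul_rpow_of_nonneg _ _ (by norm_num : (0 : ℝ) ≤ 1 / 2)]
      have : K x t * w t * (K x t * ((w t)⁻¹ * F t ^ 2)) = (K x t * F t) ^ 2 := by
        calc _ = (K x t * F t) ^ 2 * (w t * (w t)⁻¹) := by ring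
          _ = _ := by rw [ENNReal.mul_inv_cancel ht0 htt, mul_one]
      rw [this, ← ENNReal.rpow_natCast, ← ENNReal.rpow_mul]
      norm_num
    rw [e]
    refine (sq_lintegral_mul_le ?_ ?_).trans ?_
    · exact (((hKx x).mul hw).pow_const _).aemeasurable
    · exact ((hKx x).aemeasurable.mul (hw.inv.aemeasurable.mul (hF.pow_const 2))).pow_const _
    simp only [hsq]
    have hm : AEMeasurable (fun t => K x t * ((w t)⁻¹ * F t ^ 2)) μ :=
      (hKx x).aemeasurable.mul (hw.inv.aemeasurable.mul (hF.pow_const 2))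
    rw [lintegral_const_mul'' _ hm, ← mul_assoc]
    gcongr
  have hmeas : AEMeasurable (Function.uncurry fun x t => w x * (K x t * ((w t)⁻¹ * F t ^ 2)))
      (μ.prod μ) := by
    refine (hw.comp measurable_fst).aemeasurable.mul (hK.aemeasurable.mul
      ((hw.inv.comp measurable_snd).aemeasurable.mul ?_))
    exact (hF.comp_quasiMeasurePreserving Measure.quasiMeasurePreserving_snd).pow_const 2
  calc ∫⁻ x, (∫⁻ t, K x t * F t ∂μ) ^ 2 ∂μ
      ≤ ∫⁻ x, C * ∫⁻ t, w x * (K x t * ((w t)⁻¹ * F t ^ 2)) ∂μ ∂μ := lintegral_mono_ae step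
    _ = C * ∫⁻ x, ∫⁻ t, w x * (K x t * ((w t)⁻¹ * F t ^ 2)) ∂μ ∂μ :=
        lintegral_const_mul'' _ hmeas.lintegral_prod_right'
    _ = C * ∫⁻ t, ∫⁻ x, w x * (K x t * ((w t)⁻¹ * F t ^ 2)) ∂μ ∂μ := by
        rw [lintegral_lintegral_swap hmeas]
    _ ≤ C * ∫⁻ t, C * F t ^ 2 ∂μ := by
        gcongr 1
        refine lintegral_mono_ae ?_
        filter_upwards [h2, hw0, hwt] with t ht ht0 htt
        calc ∫⁻ x, w x * (K x t * ((w t)⁻¹ * F t ^ 2)) ∂μ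
            = ∫⁻ x, (K x t * w x) * ((w t)⁻¹ * F t ^ 2) ∂μ := by
              refine lintegral_congr fun x => ?_
              ring
          _ = (∫⁻ x, K x t * w x ∂μ) * ((w t)⁻¹ * F t ^ 2) :=
              lintegral_mul_const _ ((hKt t).mul hw)
          _ ≤ C * w t * ((w t)⁻¹ * F t ^ 2) := by gcongr
          _ = C * F t ^ 2 * (w t * (w t)⁻¹) := by ring
          _ = C * F t ^ 2 := by rw [ENNReal.mul_inv_cancel ht0 htt, mul_one]
    _ = C ^ 2 * ∫⁻ t, F t ^ 2 ∂μ := by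
        rw [lintegral_const_mul'' _ (hF.pow_const 2)]; ring

/-- The weight t^(-1/2) is the homogeneous one suited to a kernel of degree -1: the parts t ≤ x and
t > x each contribute 2 x^(-1/2). This is the row condition in Schur's test. -/
theorem lintegral_inv_max_mul_rpow_le {x : ℝ} (hx : 0 < x) :
    ∫⁻ t, ENNReal.ofReal (max x t)⁻¹ * ENNReal.ofReal (t ^ (-1 / 2 : ℝ)) ∂halfLine
      ≤ 4 * ENNReal.ofReal (x ^ (-1 / 2 : ℝ)) := by
  change ∫⁻ t in Ioi 0, _ ≤ _
  rw [← Ioc_union_Ioi_eq_Ioi hx.le, lintegral_union measurableSet_Ioi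
    (disjoint_left.2 fun t ht ht' => not_lt.2 ht.2 ht')]
  have h1 : ∫⁻ t in Ioc 0 x, ENNReal.ofReal (max x t)⁻¹ * ENNReal.ofReal (t ^ (-1 / 2 : ℝ))
      = ENNReal.ofReal (2 * x ^ (-1 / 2 : ℝ)) := by
    have hint : IntegrableOn (fun t : ℝ => x⁻¹ * t ^ (-1 / 2 : ℝ)) (Ioc 0 x) := by
      refine Integrable.const_mul ?_ _
      exact (intervalIntegrable_iff_integrableOn_Ioc_of_le hx.le).1
        (intervalIntegral.intervalIntegrable_rpow' (by norm_num))
    have e : ∫ t in Ioc 0 x, x⁻¹ * t ^ (-1 / 2 : ℝ) = 2 * x ^ (-1 / 2 : ℝ) := by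
      rw [← intervalIntegral.integral_of_le hx.le, intervalIntegral.integral_const_mul,
        integral_rpow (Or.inl (by norm_num)), Real.zero_rpow (by norm_num),
        show (-1 / 2 + 1 : ℝ) = -1 / 2 + 1 from rfl, Real.rpow_add_one hx.ne']
      field_simp
      norm_num
    rw [← e, ofReal_integral_eq_lintegral_ofReal hint ?_]
    · refine setLIntegral_congr_fun measurableSet_Ioc fun t ht => ?_
      rw [max_eq_left ht.2, ← ENNReal.ofReal_mul (by positivity)]
    · filter_upwards [ae_restrict_mem measurableSet_Ioc] with t ht
      have := ht.1
      simp only [Pi.zero_apply]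
      positivity
  have h2 : ∫⁻ t in Ioi x, ENNReal.ofReal (max x t)⁻¹ * ENNReal.ofReal (t ^ (-1 / 2 : ℝ))
      = ENNReal.ofReal (2 * x ^ (-1 / 2 : ℝ)) := by
    have hint : IntegrableOn (fun t : ℝ => t ^ (-3 / 2 : ℝ)) (Ioi x) :=
      integrableOn_Ioi_rpow_of_lt (by norm_num) hx
    have e : ∫ t in Ioi x, t ^ (-3 / 2 : ℝ) = 2 * x ^ (-1 / 2 : ℝ) := by
      rw [integral_Ioi_rpow_of_lt (by norm_num) hx, show (-3 / 2 + 1 : ℝ) = -1 / 2 by norm_num]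
      ring
    rw [← e, ofReal_integral_eq_lintegral_ofReal hint ?_]
    · refine setLIntegral_congr_fun measurableSet_Ioi fun t ht => ?_
      have ht : x < t := ht
      have h0 : 0 < t := hx.trans ht
      rw [max_eq_right ht.le, ← ENNReal.ofReal_mul (by positivity), ← Real.rpow_neg_one,
        ← Real.rpow_add h0]
      norm_num
    · filter_upwards [ae_restrict_mem measurableSet_Ioi] with t ht
      have : 0 < t := hx.trans ht
      simp only [Pi.zero_apply]
      positivity
  rw [h1, h2, ← ENNReal.ofReal_add (by positivity) (by positivity),
    show (4 : ℝ≥0∞) = ENNReal.ofReal 4 by simp, ← ENNReal.ofReal_mul (by norm_num)]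
  refine ENNReal.ofReal_le_ofReal (le_of_eq (by ring))

/-- The kernel `k` is dominated by `M / max x t`. -/
structure IsHardyKernel (M : ℝ) (k : ℝ → ℝ → ℂ) : Prop where
  measurable : Measurable (Function.uncurry k)
  nonneg : 0 ≤ M
  bound : ∀ x t, 0 < x → 0 < t → ‖k x t‖ ≤ M * (max x t)⁻¹

/-- The integral operator with kernel `k` on the half-line. -/
noncomputable def kernelOp (k : ℝ → ℝ → ℂ) (f : ℝ → ℂ) (x : ℝ) : ℂ :=
  ∫ t, k x t * f t ∂halfLine

theorem kernelOp_congr {k : ℝ → ℝ → ℂ} {f g : ℝ → ℂ} (h : f =ᵐ[halfLine] g) :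
    kernelOp k f = kernelOp k g := by
  funext x
  refine integral_congr_ae ?_
  filter_upwards [h] with t ht
  rw [ht]

/-- Rows of dominated kernels are therefore in L₂, so their integral operators converge absolutely
at every x > 0 and not merely almost everywhere. -/
theorem memLp_inv_max {x : ℝ} (hx : 0 < x) : MemLp (fun t : ℝ => (max x t)⁻¹) 2 halfLine := by
  have hm : AEStronglyMeasurable (fun t : ℝ => (max x t)⁻¹) halfLine := by
    exact ((measurable_const.max measurable_id).inv).aestronglyMeasurable
  rw [memLp_two_iff_integrable_sq hm]
  change IntegrableOn _ (Ioi (0 : ℝ))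
  rw [← Ioc_union_Ioi_eq_Ioi hx.le]
  refine IntegrableOn.union ?_ ?_
  · refine IntegrableOn.congr_fun (f := fun _ => x⁻¹ ^ 2) ?_ (fun t ht => ?_) measurableSet_Ioc
    · simp
    · simp only; rw [max_eq_left ht.2]
  · refine IntegrableOn.congr_fun (f := fun t : ℝ => t ^ (-2 : ℝ))
      (integrableOn_Ioi_rpow_of_lt (by norm_num) hx) (fun t ht => ?_) measurableSet_Ioi
    have ht : x < t := ht
    simp only
    rw [max_eq_right ht.le, Real.rpow_neg (hx.trans ht).le, inv_pow]
    norm_num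

namespace IsHardyKernel

variable {M : ℝ} {k : ℝ → ℝ → ℂ}

theorem measurable_right (hk : IsHardyKernel M k) (x : ℝ) : Measurable (k x) :=
  hk.measurable.comp (measurable_const.prodMk measurable_id)

theorem swap (hk : IsHardyKernel M k) : IsHardyKernel M (fun x t => k t x) :=
  ⟨hk.measurable.comp measurable_swap, hk.nonneg, fun x t hx ht => by
    rw [max_comm]; exact hk.bound t x ht hx⟩

theorem conj (hk : IsHardyKernel M k) : IsHardyKernel M (fun x t => (starRingEnd ℂ) (k x t)) :=
  ⟨(Complex.continuous_conj.measurable).comp hk.measurable, hk.nonneg, fun x t hx ht => by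
    rw [RCLike.norm_conj]; exact hk.bound x t hx ht⟩

theorem memLp_right (hk : IsHardyKernel M k) {x : ℝ} (hx : 0 < x) : MemLp (k x) 2 halfLine := by
  refine ((memLp_inv_max hx).const_mul M).of_le (hk.measurable_right x).aestronglyMeasurable ?_
  filter_upwards [ae_halfLine_pos] with t ht
  exact (hk.bound x t hx ht).trans (le_abs_self _)

theorem integrable_mul (hk : IsHardyKernel M k) {f : ℝ → ℂ} (hf : MemLp f 2 halfLine) {x : ℝ}
    (hx : 0 < x) : Integrable (fun t => k x t * f t) halfLine :=
  (hk.memLp_right hx).integrable_mul hf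

theorem aestronglyMeasurable_kernelOp (hk : IsHardyKernel M k) {f : ℝ → ℂ}
    (hf : AEStronglyMeasurable f halfLine) : AEStronglyMeasurable (kernelOp k f) halfLine := by
  have : AEStronglyMeasurable (fun q : ℝ × ℝ => k q.1 q.2 * f q.2) (halfLine.prod halfLine) :=
    hk.measurable.aestronglyMeasurable.mul
      (hf.comp_quasiMeasurePreserving Measure.quasiMeasurePreserving_snd)
  exact this.integral_prod_right'

theorem lintegral_sq_le (hk : IsHardyKernel M k) {f : ℝ → ℂ}
    (hf : AEStronglyMeasurable f halfLine) :
    ∫⁻ x, (∫⁻ t, ‖k x t * f t‖ₑ ∂halfLine) ^ 2 ∂halfLine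
      ≤ ENNReal.ofReal (4 * M) ^ 2 * ∫⁻ t, ‖f t‖ₑ ^ 2 ∂halfLine := by
  have hmax : Measurable (Function.uncurry fun x t : ℝ => ENNReal.ofReal (M * (max x t)⁻¹)) :=
    (measurable_const.mul ((measurable_fst.max measurable_snd).inv)).ennreal_ofReal
  have hw : Measurable (fun t : ℝ => ENNReal.ofReal (t ^ (-1 / 2 : ℝ))) :=
    (measurable_id.pow_const _).ennreal_ofReal
  have hrow : ∀ᵐ x ∂halfLine, ∫⁻ t, ENNReal.ofReal (M * (max x t)⁻¹) *
      ENNReal.ofReal (t ^ (-1 / 2 : ℝ)) ∂halfLine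
      ≤ ENNReal.ofReal (4 * M) * ENNReal.ofReal (x ^ (-1 / 2 : ℝ)) := by
    filter_upwards [ae_halfLine_pos] with x hx
    have hm : Measurable (fun t : ℝ => ENNReal.ofReal (max x t)⁻¹ *
        ENNReal.ofReal (t ^ (-1 / 2 : ℝ))) :=
      ((measurable_const.max measurable_id).inv).ennreal_ofReal.mul hw
    simp only [ENNReal.ofReal_mul hk.nonneg, mul_assoc]
    rw [lintegral_const_mul _ hm]
    calc _ ≤ ENNReal.ofReal M * (4 * ENNReal.ofReal (x ^ (-1 / 2 : ℝ))) := by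
          gcongr; exact lintegral_inv_max_mul_rpow_le hx
      _ = _ := by
        rw [ENNReal.ofReal_mul (by norm_num : (0 : ℝ) ≤ 4)]
        simp only [ENNReal.ofReal_ofNat]
        ring
  have := lintegral_sq_le_of_schur (μ := halfLine) (C := ENNReal.ofReal (4 * M)) hmax hw
    (by
      filter_upwards [ae_halfLine_pos] with t ht
      have : 0 < t ^ (-1 / 2 : ℝ) := by positivity
      simpa using this)
    (by simp) hrow (by simpa only [max_comm] using hrow) hf.enorm
  refine le_trans (lintegral_mono_ae ?_) this
  filter_upwards [ae_halfLine_pos] with x hx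
  gcongr 1
  refine lintegral_mono_ae ?_
  filter_upwards [ae_halfLine_pos] with t ht
  rw [enorm_mul]
  gcongr
  rw [← ofReal_norm]
  exact ENNReal.ofReal_le_ofReal (hk.bound x t hx ht)

theorem eLpNorm_kernelOp_le (hk : IsHardyKernel M k) {f : ℝ → ℂ}
    (hf : AEStronglyMeasurable f halfLine) :
    eLpNorm (kernelOp k f) 2 halfLine ≤ ENNReal.ofReal (4 * M) * eLpNorm f 2 halfLine := by
  have h2 : ∀ g : ℝ → ℂ, eLpNorm g 2 halfLine ^ 2 = ∫⁻ t, ‖g t‖ₑ ^ 2 ∂halfLine := by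
    intro g
    rw [eLpNorm_eq_lintegral_rpow_enorm_toReal (by norm_num) (by norm_num), ← ENNReal.rpow_natCast,
      ← ENNReal.rpow_mul]
    simp
  refine (ENNReal.pow_right_strictMono two_ne_zero).le_iff_le.1 ?_
  rw [mul_pow, h2, h2]
  refine le_trans (lintegral_mono fun x => ?_) (hk.lintegral_sq_le hf)
  gcongr
  exact enorm_integral_le_lintegral_enorm _

theorem memLp_kernelOp (hk : IsHardyKernel M k) {f : ℝ → ℂ} (hf : MemLp f 2 halfLine) :
    MemLp (kernelOp k f) 2 halfLine :=
  ⟨hk.aestronglyMeasurable_kernelOp hf.1, (hk.eLpNorm_kernelOp_le hf.1).trans_lt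
    (ENNReal.mul_lt_top ENNReal.ofReal_lt_top hf.2)⟩

/-- The operator of `L₂(0, ∞)` with kernel `k` as a linear map. -/
noncomputable def opLinear (hk : IsHardyKernel M k) : L2 →ₗ[ℂ] L2 where
  toFun f := (hk.memLp_kernelOp (Lp.memLp f)).toLp (kernelOp k f)
  map_add' f g := by
    rw [← MemLp.toLp_add]
    refine MemLp.toLp_congr _ _ ?_
    filter_upwards [ae_halfLine_pos] with x hx
    simp only [Pi.add_apply, kernelOp]
    rw [← integral_add (hk.integrable_mul (Lp.memLp f) hx) (hk.integrable_mul (Lp.memLp g) hx)]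
    refine integral_congr_ae ?_
    filter_upwards [Lp.coeFn_add f g] with t ht
    rw [ht, Pi.add_apply, mul_add]
  map_smul' c f := by
    rw [RingHom.id_apply, ← MemLp.toLp_const_smul]
    refine MemLp.toLp_congr _ _ ?_
    filter_upwards [ae_halfLine_pos] with x hx
    simp only [Pi.smul_apply, kernelOp, smul_eq_mul]
    rw [← integral_const_mul]
    refine integral_congr_ae ?_
    filter_upwards [Lp.coeFn_smul c f] with t ht
    rw [ht, Pi.smul_apply, smul_eq_mul]
    ring

theorem norm_opLinear_le (hk : IsHardyKernel M k) (f : L2) :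
    ‖hk.opLinear f‖ ≤ 4 * M * ‖f‖ := by
  have h : ‖hk.opLinear f‖ = (eLpNorm (kernelOp k f) 2 halfLine).toReal :=
    Lp.norm_toLp _ (hk.memLp_kernelOp (Lp.memLp f))
  rw [h, Lp.norm_def, ← ENNReal.toReal_ofReal (mul_nonneg zero_le_four hk.nonneg),
    ← ENNReal.toReal_mul]
  exact ENNReal.toReal_mono (ENNReal.mul_ne_top ENNReal.ofReal_ne_top (Lp.eLpNorm_ne_top f))
    (hk.eLpNorm_kernelOp_le (Lp.memLp f).1)

/-- The bounded operator of `L₂(0, ∞)` with kernel `k`. -/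
noncomputable def op (hk : IsHardyKernel M k) : L2 →L[ℂ] L2 :=
  hk.opLinear.mkContinuous (4 * M) hk.norm_opLinear_le

theorem op_ae (hk : IsHardyKernel M k) (f : L2) : hk.op f =ᵐ[halfLine] kernelOp k f :=
  MemLp.coeFn_toLp (hk.memLp_kernelOp (Lp.memLp f))

/-- The absolute value of a dominated kernel is again dominated, so it acts in L₂ and its pairing
with |g| is finite. This licenses the uses of Fubini for bounded kernels. -/
theorem integrable_prod (hk : IsHardyKernel M k) {f g : ℝ → ℂ} (hf : MemLp f 2 halfLine)
    (hg : MemLp g 2 halfLine) :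
    Integrable (fun q : ℝ × ℝ => g q.1 * (k q.1 q.2 * f q.2)) (halfLine.prod halfLine) := by
  have hm : AEStronglyMeasurable (fun q : ℝ × ℝ => g q.1 * (k q.1 q.2 * f q.2))
      (halfLine.prod halfLine) :=
    (hg.1.comp_quasiMeasurePreserving Measure.quasiMeasurePreserving_fst).mul
      (hk.measurable.aestronglyMeasurable.mul
        (hf.1.comp_quasiMeasurePreserving Measure.quasiMeasurePreserving_snd))
  rw [integrable_prod_iff hm]
  constructor
  · filter_upwards [ae_halfLine_pos] with x hx
    exact (hk.integrable_mul hf hx).const_mul _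
  · have habs : IsHardyKernel M (fun x t => (‖k x t‖ : ℂ)) :=
      ⟨Complex.measurable_ofReal.comp hk.measurable.norm, hk.nonneg, fun x t hx ht => by
        simpa using hk.bound x t hx ht⟩
    have hfn : MemLp (fun t => (‖f t‖ : ℂ)) 2 halfLine := hf.norm.ofReal
    have hi := (hg.norm.integrable_mul (habs.memLp_kernelOp hfn).norm)
    refine hi.congr (Eventually.of_forall fun x => ?_)
    simp only [Pi.mul_apply, norm_mul, integral_const_mul]
    congr 1
    simp only [kernelOp, ← Complex.ofReal_mul]
    rw [integral_complex_ofReal, Complex.norm_real, Real.norm_eq_abs, abs_of_nonneg]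
    exact integral_nonneg fun t => by positivity

open scoped InnerProductSpace in
theorem adjoint_op (hk : IsHardyKernel M k) :
    ContinuousLinearMap.adjoint hk.op = hk.swap.conj.op := by
  symm
  rw [ContinuousLinearMap.eq_adjoint_iff]
  intro f g
  rw [L2.inner_def, L2.inner_def]
  have e1 : ∫ x, ⟪hk.swap.conj.op f x, g x⟫_ℂ ∂halfLine
      = ∫ x, ∫ t, (starRingEnd ℂ) (f t) * (k t x * g x) ∂halfLine ∂halfLine := by
    refine integral_congr_ae ?_
    filter_upwards [hk.swap.conj.op_ae f] with x hx
    rw [hx, RCLike.inner_apply, kernelOp, ← integral_conj, ← integral_const_mul]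
    refine integral_congr_ae (Eventually.of_forall fun t => ?_)
    simp only [map_mul, Complex.conj_conj]
    ring
  have e2 : ∫ x, ⟪f x, hk.op g x⟫_ℂ ∂halfLine
      = ∫ x, ∫ t, (starRingEnd ℂ) (f x) * (k x t * g t) ∂halfLine ∂halfLine := by
    refine integral_congr_ae ?_
    filter_upwards [hk.op_ae g] with x hx
    rw [hx, RCLike.inner_apply, kernelOp, mul_comm, ← integral_const_mul]
  rw [e1, e2]
  have hf' : MemLp (fun t => (starRingEnd ℂ) (f t)) 2 halfLine := (Lp.memLp f).star
  exact (integral_integral_swap (hk.integrable_prod (Lp.memLp g) hf')).symm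

end IsHardyKernel

/-- Composition of integral operators under absolute convergence. -/
theorem kernelOp_kernelOp {k₁ k₂ : ℝ → ℝ → ℂ} {f : ℝ → ℂ} {x : ℝ}
    (h : Integrable (fun q : ℝ × ℝ => k₁ x q.1 * (k₂ q.1 q.2 * f q.2)) (halfLine.prod halfLine)) :
    kernelOp k₁ (kernelOp k₂ f) x
      = ∫ s, (∫ t, k₁ x t * k₂ t s ∂halfLine) * f s ∂halfLine := by
  simp only [kernelOp, ← integral_const_mul]
  rw [integral_integral_swap h]
  refine integral_congr_ae (Eventually.of_forall fun s => ?_)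
  simp only
  rw [← integral_mul_const]
  refine integral_congr_ae (Eventually.of_forall fun t => ?_)
  simp only
  ring

theorem IsHardyKernel.kernelOp_kernelOp {M₁ M₂ : ℝ} {k₁ k₂ : ℝ → ℝ → ℂ}
    (h₁ : IsHardyKernel M₁ k₁) (h₂ : IsHardyKernel M₂ k₂) {f : ℝ → ℂ} (hf : MemLp f 2 halfLine)
    {x : ℝ} (hx : 0 < x) :
    kernelOp k₁ (kernelOp k₂ f) x
      = ∫ s, (∫ t, k₁ x t * k₂ t s ∂halfLine) * f s ∂halfLine :=
  BuschmanErdelyi.kernelOp_kernelOp (h₂.integrable_prod hf (h₁.memLp_right hx))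

end BuschmanErdelyi

namespace BuschmanErdelyi
open Filter Topology ENNReal

/-! ### The kernels -/

/-- The kernel `p(t/x)/x` on `0 < t < x`, where `p` is the derivative of `P_ν`. -/
noncomputable def kerA (ν : ℂ) (x t : ℝ) : ℂ :=
  if 0 < t ∧ t < x then legendreP' ν (t / x) / x else 0

/-- The kernel `p(x/t)/t` on `0 < t < x`, where `p` is the derivative of `P_ν`. -/
noncomputable def kerC (ν : ℂ) (x t : ℝ) : ℂ :=
  if 0 < t ∧ t < x then legendreP' ν (x / t) / t else 0

theorem measurableSet_triangle : MeasurableSet {q : ℝ × ℝ | 0 < q.2 ∧ q.2 < q.1} :=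
  (measurableSet_lt measurable_const measurable_snd).inter
    (measurableSet_lt measurable_snd measurable_fst)

theorem measurable_triangle {F : ℝ × ℝ → ℂ}
    (hF : ContinuousOn F {q : ℝ × ℝ | 0 < q.2 ∧ q.2 < q.1}) :
    Measurable (fun q : ℝ × ℝ => if 0 < q.2 ∧ q.2 < q.1 then F q else 0) := by
  classical
  have := hF.measurable_piecewise (g := fun _ : ℝ × ℝ => (0 : ℂ)) continuousOn_const
    measurableSet_triangle
  exact this

theorem measurable_kerA (ν : ℂ) : Measurable (Function.uncurry (kerA ν)) := by
  refine measurable_triangle (F := fun q => legendreP' ν (q.2 / q.1) / q.1) ?_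
  have hne : ∀ q ∈ {q : ℝ × ℝ | 0 < q.2 ∧ q.2 < q.1}, q.1 ≠ 0 := fun q hq =>
    (hq.1.trans hq.2).ne'
  refine ContinuousOn.div ((continuousOn_legendreP' ν).comp
    (continuousOn_snd.div continuousOn_fst hne) fun q hq => div_pos hq.1 (hq.1.trans hq.2)) ?_ ?_
  · exact (Complex.continuous_ofReal.comp continuous_fst).continuousOn
  · intro q hq; exact_mod_cast hne q hq

theorem measurable_kerC (ν : ℂ) : Measurable (Function.uncurry (kerC ν)) := by
  refine measurable_triangle (F := fun q => legendreP' ν (q.1 / q.2) / q.2) ?_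
  have hne : ∀ q ∈ {q : ℝ × ℝ | 0 < q.2 ∧ q.2 < q.1}, q.2 ≠ 0 := fun q hq => hq.1.ne'
  refine ContinuousOn.div ((continuousOn_legendreP' ν).comp
    (continuousOn_fst.div continuousOn_snd hne) fun q hq => div_pos (hq.1.trans hq.2) hq.1) ?_ ?_
  · exact (Complex.continuous_ofReal.comp continuous_snd).continuousOn
  · intro q hq; exact_mod_cast hne q hq

/-- A bound for `p` on `(0, 1]`. -/
noncomputable def boundP' (ν : ℂ) : ℝ := (exists_bound_legendreP' ν).choose

theorem boundP'_nonneg (ν : ℂ) : 0 ≤ boundP' ν := (exists_bound_legendreP' ν).choose_spec.1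

theorem norm_legendreP'_le (ν : ℂ) {z : ℝ} (h0 : 0 < z) (h1 : z ≤ 1) :
    ‖legendreP' ν z‖ ≤ boundP' ν := (exists_bound_legendreP' ν).choose_spec.2 z ⟨h0, h1⟩

theorem norm_kerA_le (ν : ℂ) {x t : ℝ} (hx : 0 < x) : ‖kerA ν x t‖ ≤ boundP' ν / x := by
  unfold kerA
  split_ifs with h
  · rw [norm_div, Complex.norm_real, Real.norm_eq_abs, abs_of_pos hx]
    gcongr
    exact norm_legendreP'_le ν (div_pos h.1 hx) ((div_le_one hx).2 h.2.le)
  · rw [norm_zero]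
    exact div_nonneg (boundP'_nonneg ν) hx.le

theorem isHardyKernel_kerA (ν : ℂ) : IsHardyKernel (boundP' ν) (kerA ν) where
  measurable := measurable_kerA ν
  nonneg := boundP'_nonneg ν
  bound x t hx ht := by
    by_cases h : t < x
    · rw [max_eq_left h.le]
      exact norm_kerA_le ν hx
    · rw [kerA, if_neg (by tauto), norm_zero]
      exact mul_nonneg (boundP'_nonneg ν) (inv_nonneg.2 (le_max_of_le_left hx.le))

/-- The kernel `p(x/t)/t` on `0 < x < t` is dominated as well. -/
theorem isHardyKernel_kerB (ν : ℂ) : IsHardyKernel (boundP' ν) (fun x t => kerA ν t x) :=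
  (isHardyKernel_kerA ν).swap

theorem integral_halfLine_ite {x y : ℝ} (hx : 0 ≤ x) (hxy : x ≤ y) (F : ℝ → ℂ) :
    ∫ t, (if x < t ∧ t < y then F t else 0) ∂halfLine = ∫ t in x..y, F t := by
  have e : (fun t => if x < t ∧ t < y then F t else 0) = (Ioo x y).indicator F := by
    funext t
    simp [indicator, mem_Ioo]
  rw [e, integral_indicator measurableSet_Ioo, Measure.restrict_restrict measurableSet_Ioo,
    inter_eq_left.2 (show Ioo x y ⊆ Ioi 0 from fun t ht => lt_of_le_of_lt hx ht.1),
    intervalIntegral.integral_of_le hxy, integral_Ioc_eq_integral_Ioo]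

/-! ### Products of solutions of Legendre's equation -/

/-- An antiderivative of `t ↦ p(t/x) p(t/y)`. -/
noncomputable def prodAntideriv (P p : ℝ → ℂ) (x y t : ℝ) : ℂ :=
  x * y / ((y : ℂ) ^ 2 - (x : ℂ) ^ 2) *
    (x * ((((t / x : ℝ) : ℂ) ^ 2 - 1) * p (t / x)) * P (t / y)
      - y * P (t / x) * ((((t / y : ℝ) : ℂ) ^ 2 - 1) * p (t / y)))

theorem sq_sub_sq_ne_zero {x y : ℝ} (hx : 0 < x) (hxy : x < y) :
    (y : ℂ) ^ 2 - (x : ℂ) ^ 2 ≠ 0 := by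
  have h : y ^ 2 - x ^ 2 ≠ 0 := by nlinarith
  exact_mod_cast h

/-- Lagrange's identity for P(t/x) and P(t/y). With E(z) = (z² - 1) p(z), the terms Λ P(t/x) P(t/y)
cancel; in the rest the t² cancels as well, leaving p(t/x) p(t/y) times the constant (y² - x²)/(xy).
-/
theorem hasDerivAt_prodAntideriv {Λ : ℂ} {P p : ℝ → ℂ} {s : Set ℝ} (h : SolvesLegendre Λ P p s)
    {x y t : ℝ} (hx : 0 < x) (hxy : x < y) (h1 : t / x ∈ s) (h2 : t / y ∈ s) :
    HasDerivAt (prodAntideriv P p x y) (p (t / x) * p (t / y)) t := by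
  have hy : 0 < y := hx.trans hxy
  have hne := sq_sub_sq_ne_zero hx hxy
  have hxc : (x : ℂ) ≠ 0 := by exact_mod_cast hx.ne'
  have hyc : (y : ℂ) ≠ 0 := by exact_mod_cast hy.ne'
  have dx : HasDerivAt (fun t : ℝ => t / x) x⁻¹ t := by
    simpa using (hasDerivAt_id' t).div_const x
  have dy : HasDerivAt (fun t : ℝ => t / y) y⁻¹ t := by
    simpa using (hasDerivAt_id' t).div_const y
  have Px := (h _ h1).1.scomp t dx
  have Py := (h _ h2).1.scomp t dy
  have Ex := (h _ h1).2.scomp t dx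
  have Ey := (h _ h2).2.scomp t dy
  have := (((Ex.const_mul (x : ℂ)).mul Py).sub ((Px.const_mul (y : ℂ)).mul Ey)).const_mul
    (x * y / ((y : ℂ) ^ 2 - (x : ℂ) ^ 2))
  refine this.congr_deriv ?_
  simp only [Function.comp_apply, Complex.real_smul]
  push_cast
  field_simp
  ring

theorem prodAntideriv_left {P p : ℝ → ℂ} (hP : P 1 = 1) {x y : ℝ} (hx : 0 < x) (hxy : x < y) :
    prodAntideriv P p x y x = x * p (x / y) := by
  have hy : 0 < y := hx.trans hxy
  have hne := sq_sub_sq_ne_zero hx hxy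
  have hyc : (y : ℂ) ≠ 0 := by exact_mod_cast hy.ne'
  rw [prodAntideriv, div_self hx.ne', hP]
  push_cast
  field_simp
  ring

theorem prodAntideriv_right {P p : ℝ → ℂ} (hP : P 1 = 1) {x y : ℝ} (hx : 0 < x) (hxy : x < y) :
    prodAntideriv P p x y y = y * p (y / x) := by
  have hy : 0 < y := hx.trans hxy
  have hne := sq_sub_sq_ne_zero hx hxy
  have hxc : (x : ℂ) ≠ 0 := by exact_mod_cast hx.ne'
  rw [prodAntideriv, div_self hy.ne', hP]
  push_cast
  field_simp
  ring

/-- The inversion t ↦ xy/t exchanges t/x with y/t and t/y with x/t. It maps (x, y) onto itself and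
(y, ∞) onto (0, x), so one antiderivative serves both orders of composition. -/
theorem hasDerivAt_prodAntideriv_inv {Λ : ℂ} {P p : ℝ → ℂ} {s : Set ℝ}
    (h : SolvesLegendre Λ P p s) {x y t : ℝ} (hx : 0 < x) (hxy : x < y) (ht : 0 < t)
    (h1 : y / t ∈ s) (h2 : x / t ∈ s) :
    HasDerivAt (fun t => -(prodAntideriv P p x y (x * y / t) / (x * y)))
      (p (y / t) / t * (p (x / t) / t)) t := by
  have hy : 0 < y := hx.trans hxy
  have e1 : x * y / t / x = y / t := by field_simp
  have e2 : x * y / t / y = x / t := by field_simp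
  have hd : HasDerivAt (fun t : ℝ => x * y / t) (-(x * y) / t ^ 2) t := by
    have := (hasDerivAt_const t (x * y)).div (hasDerivAt_id' t) ht.ne'
    exact this.congr_deriv (by simp)
  have := (((hasDerivAt_prodAntideriv h hx hxy (t := x * y / t) (by rwa [e1])
    (by rwa [e2])).scomp t hd).div_const ((x : ℂ) * y)).neg
  refine this.congr_deriv ?_
  have hxc : (x : ℂ) ≠ 0 := by exact_mod_cast hx.ne'
  have hyc : (y : ℂ) ≠ 0 := by exact_mod_cast hy.ne'
  have htc : (t : ℂ) ≠ 0 := by exact_mod_cast ht.ne'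
  rw [e1, e2, Complex.real_smul]
  push_cast
  field_simp

theorem continuousOn_legendreP'_div_const (ν : ℂ) {x a b : ℝ} (hx : 0 < x) (ha : 0 < a) :
    ContinuousOn (fun t => legendreP' ν (t / x)) (Icc a b) :=
  (continuousOn_legendreP' ν).comp (continuousOn_id.div_const x)
    fun _ ht => div_pos (ha.trans_le ht.1) hx

theorem continuousOn_legendreP'_const_div (ν : ℂ) {x a b : ℝ} (hx : 0 < x) (ha : 0 < a) :
    ContinuousOn (fun t => legendreP' ν (x / t)) (Icc a b) :=
  (continuousOn_legendreP' ν).comp (continuousOn_const.div continuousOn_id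
    fun _ ht => (ha.trans_le ht.1).ne') fun _ ht => div_pos hx (ha.trans_le ht.1)

theorem integral_legendreP'_mul (ν : ℂ) {x y : ℝ} (hx : 0 < x) (hxy : x < y) :
    ∫ t in x..y, legendreP' ν (t / x) * legendreP' ν (t / y)
      = y * legendreP' ν (y / x) - x * legendreP' ν (x / y) := by
  have hy : 0 < y := hx.trans hxy
  rw [intervalIntegral.integral_eq_sub_of_hasDerivAt
    (f := prodAntideriv (legendreP ν) (legendreP' ν) x y)]
  · rw [prodAntideriv_left (legendreP_one ν) hx hxy, prodAntideriv_right (legendreP_one ν) hx hxy]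
  · intro t ht
    rw [uIcc_of_le hxy.le] at ht
    have ht0 : 0 < t := hx.trans_le ht.1
    exact hasDerivAt_prodAntideriv (solvesLegendre_legendreP ν) hx hxy (div_pos ht0 hx)
      (div_pos ht0 hy)
  · refine ContinuousOn.intervalIntegrable ?_
    rw [uIcc_of_le hxy.le]
    exact (continuousOn_legendreP'_div_const ν hx hx).mul
      (continuousOn_legendreP'_div_const ν hy hx)

theorem integral_legendreP'_mul_inv (ν : ℂ) {x y : ℝ} (hx : 0 < x) (hxy : x < y) :
    ∫ t in x..y, legendreP' ν (y / t) / t * (legendreP' ν (x / t) / t)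
      = legendreP' ν (y / x) / x - legendreP' ν (x / y) / y := by
  have hy : 0 < y := hx.trans hxy
  have hxc : (x : ℂ) ≠ 0 := by exact_mod_cast hx.ne'
  have hyc : (y : ℂ) ≠ 0 := by exact_mod_cast hy.ne'
  rw [intervalIntegral.integral_eq_sub_of_hasDerivAt
    (f := fun t => -(prodAntideriv (legendreP ν) (legendreP' ν) x y (x * y / t) / (x * y)))]
  · rw [mul_div_cancel_right₀ _ hy.ne', mul_div_cancel_left₀ _ hx.ne',
      prodAntideriv_left (legendreP_one ν) hx hxy, prodAntideriv_right (legendreP_one ν) hx hxy]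
    field_simp
    ring
  · intro t ht
    rw [uIcc_of_le hxy.le] at ht
    have ht0 : 0 < t := hx.trans_le ht.1
    exact hasDerivAt_prodAntideriv_inv (solvesLegendre_legendreP ν) hx hxy ht0 (div_pos hy ht0)
      (div_pos hx ht0)
  · refine ContinuousOn.intervalIntegrable ?_
    rw [uIcc_of_le hxy.le]
    have hc : ContinuousOn (fun t : ℝ => (t : ℂ)) (Icc x y) :=
      Complex.continuous_ofReal.continuousOn
    have h0 : ∀ t ∈ Icc x y, (t : ℂ) ≠ 0 := fun t ht => by exact_mod_cast (hx.trans_le ht.1).ne'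
    exact ((continuousOn_legendreP'_const_div ν hy hx).div hc h0).mul
      ((continuousOn_legendreP'_const_div ν hx hx).div hc h0)

/-- The kernels `A` and `C` satisfy `A C = C - A`. -/
theorem integral_kerA_mul_kerC (ν : ℂ) {x y : ℝ} (hx : 0 < x) (hy : 0 < y) :
    ∫ t, kerA ν x t * kerC ν t y ∂halfLine = kerC ν x y - kerA ν x y := by
  rcases lt_or_ge y x with h | h
  · have hxc : (x : ℂ) ≠ 0 := by exact_mod_cast hx.ne'
    have hyc : (y : ℂ) ≠ 0 := by exact_mod_cast hy.ne'
    have e : ∀ t, kerA ν x t * kerC ν t y = if y < t ∧ t < x then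
        (x * y : ℂ)⁻¹ * (legendreP' ν (t / y) * legendreP' ν (t / x)) else 0 := by
      intro t
      by_cases h1 : y < t <;> by_cases h2 : t < x
      · rw [kerA, kerC, if_pos ⟨hy.trans h1, h2⟩, if_pos ⟨hy, h1⟩, if_pos ⟨h1, h2⟩]
        field_simp
      all_goals simp [kerA, kerC, h1, h2]
    simp only [e]
    rw [integral_halfLine_ite hy.le h.le, intervalIntegral.integral_const_mul,
      integral_legendreP'_mul ν hy h, kerC, kerA, if_pos ⟨hy, h⟩, if_pos ⟨hy, h⟩]
    field_simp
  · have e : ∀ t, kerA ν x t * kerC ν t y = 0 := by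
      intro t
      by_cases h1 : t < x
      · simp [kerC, not_lt.2 (h1.le.trans h)]
      · simp [kerA, h1]
    simp only [e, integral_zero]
    simp [kerA, kerC, not_lt.2 h]

/-- The kernels `A` and `C` satisfy `C A = C - A`. -/
theorem integral_kerC_mul_kerA (ν : ℂ) {x y : ℝ} (hy : 0 < y) :
    ∫ t, kerC ν x t * kerA ν t y ∂halfLine = kerC ν x y - kerA ν x y := by
  rcases lt_or_ge y x with h | h
  · have e : ∀ t, kerC ν x t * kerA ν t y = if y < t ∧ t < x then
        legendreP' ν (x / t) / t * (legendreP' ν (y / t) / t) else 0 := by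
      intro t
      by_cases h1 : y < t <;> by_cases h2 : t < x
      · rw [kerA, kerC, if_pos ⟨hy.trans h1, h2⟩, if_pos ⟨hy, h1⟩, if_pos ⟨h1, h2⟩]
      all_goals simp [kerA, kerC, h1, h2]
    simp only [e]
    rw [integral_halfLine_ite hy.le h.le, integral_legendreP'_mul_inv ν hy h, kerC, kerA,
      if_pos ⟨hy, h⟩, if_pos ⟨hy, h⟩]
  · have e : ∀ t, kerC ν x t * kerA ν t y = 0 := by
      intro t
      by_cases h1 : t < x
      · simp [kerA, not_lt.2 (h1.le.trans h)]
      · simp [kerC, h1]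
    simp only [e, integral_zero]
    simp [kerA, kerC, not_lt.2 h]

/-! ### The kernels for integral degree -/

/-- For the polynomial the equation holds on the whole line, so the antiderivative can be evaluated
at t = 0. -/
theorem solvesLegendre_legendrePoly (n : ℕ) :
    SolvesLegendre (n * (n + 1)) (fun z => (legendrePoly n z : ℂ))
      (fun z => (legendrePoly' n z : ℂ)) univ := by
  refine fun z _ => ⟨(hasDerivAt_legendrePoly n z).ofReal_comp, ?_⟩
  have := (hasDerivAt_legendrePoly_equation n z).ofReal_comp
  convert! this using 1
  · funext y; push_cast; ring
  · push_cast; ring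

/-- At t = 0 the antiderivative is a multiple of (y - x) P(0) P'(0), which parity annihilates. This
is where integrality of the degree makes the operators unitary. -/
theorem prodAntideriv_legendrePoly_zero (n : ℕ) (x y : ℝ) :
    prodAntideriv (fun z => (legendrePoly n z : ℂ)) (fun z => (legendrePoly' n z : ℂ)) x y 0
      = 0 := by
  have h : (legendrePoly n 0 : ℂ) * legendrePoly' n 0 = 0 := by
    exact_mod_cast legendrePoly_zero_mul_legendrePoly'_zero n
  simp only [prodAntideriv, zero_div]
  push_cast
  linear_combination (x * y / ((y : ℂ) ^ 2 - (x : ℂ) ^ 2)) * (y - x) * h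

theorem integral_kerA_mul_kerB_of_lt {ν : ℂ} {n : ℕ} (hν : ν * (ν + 1) = n * (n + 1))
    {x y : ℝ} (hx : 0 < x) (hxy : x < y) :
    ∫ t, kerA ν x t * kerA ν y t ∂halfLine = kerA ν y x := by
  have hy : 0 < y := hx.trans hxy
  have hxc : (x : ℂ) ≠ 0 := by exact_mod_cast hx.ne'
  have hyc : (y : ℂ) ≠ 0 := by exact_mod_cast hy.ne'
  have e : ∀ t, kerA ν x t * kerA ν y t = if 0 < t ∧ t < x then
      (x * y : ℂ)⁻¹ * ((legendrePoly' n (t / x) : ℂ) * legendrePoly' n (t / y)) else 0 := by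
    intro t
    by_cases h : 0 < t ∧ t < x
    · rw [kerA, kerA, if_pos h, if_pos ⟨h.1, h.2.trans hxy⟩, if_pos h,
        legendreP'_eq_legendrePoly' hν (div_pos h.1 hx),
        legendreP'_eq_legendrePoly' hν (div_pos h.1 hy)]
      field_simp
    · rw [kerA, if_neg h, if_neg h, zero_mul]
  have hcont : ∀ a : ℝ, Continuous fun t : ℝ => (legendrePoly' n (t / a) : ℂ) := fun a =>
    Complex.continuous_ofReal.comp ((continuous_legendrePoly' n).comp (continuous_id.div_const a))
  simp only [e]
  rw [integral_halfLine_ite le_rfl hx.le, intervalIntegral.integral_const_mul,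
    intervalIntegral.integral_eq_sub_of_hasDerivAt (fun t _ => hasDerivAt_prodAntideriv
      (solvesLegendre_legendrePoly n) hx hxy (mem_univ _) (mem_univ _))
      (((hcont x).mul (hcont y)).intervalIntegrable _ _),
    prodAntideriv_legendrePoly_zero, prodAntideriv_left (by simp [legendrePoly_one]) hx hxy,
    kerA, if_pos ⟨hx, hxy⟩, legendreP'_eq_legendrePoly' hν (div_pos hx hy)]
  field_simp
  ring

theorem integral_kerB_mul_kerA_of_lt {ν : ℂ} {n : ℕ} (hν : ν * (ν + 1) = n * (n + 1))
    {x y : ℝ} (hx : 0 < x) (hxy : x < y) :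
    ∫ t, kerA ν t x * kerA ν t y ∂halfLine = kerA ν y x := by
  have hy : 0 < y := hx.trans hxy
  have hxc : (x : ℂ) ≠ 0 := by exact_mod_cast hx.ne'
  have hyc : (y : ℂ) ≠ 0 := by exact_mod_cast hy.ne'
  set G : ℝ → ℂ := fun t => (legendrePoly' n (y / t) : ℂ) / t * ((legendrePoly' n (x / t) : ℂ) / t)
    with hG
  have e : (fun t => kerA ν t x * kerA ν t y) = (Ioi y).indicator G := by
    funext t
    by_cases h : y < t
    · have ht : 0 < t := hy.trans h
      rw [indicator_of_mem (mem_Ioi.2 h), kerA, kerA, if_pos ⟨hx, hxy.trans h⟩, if_pos ⟨hy, h⟩,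
        legendreP'_eq_legendrePoly' hν (div_pos hx ht),
        legendreP'_eq_legendrePoly' hν (div_pos hy ht), mul_comm]
    · rw [indicator_of_notMem (by simpa using h)]
      simp [kerA, h]
  have hint : Integrable (fun t => kerA ν t x * kerA ν t y) halfLine :=
    ((isHardyKernel_kerB ν).memLp_right hx).integrable_mul ((isHardyKernel_kerB ν).memLp_right hy)
  have hsub : Ioi y ∩ Ioi 0 = Ioi y := inter_eq_left.2 fun t (ht : y < t) => hy.trans ht
  have hres : Measure.restrict halfLine (Ioi y) = volume.restrict (Ioi y) := by
    rw [Measure.restrict_restrict measurableSet_Ioi, hsub]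
  rw [e, integrable_indicator_iff measurableSet_Ioi, IntegrableOn, hres] at hint
  rw [e, integral_indicator measurableSet_Ioi, hres]
  have hder : ∀ t, 0 < t → HasDerivAt (fun t => -(prodAntideriv (fun z => (legendrePoly n z : ℂ))
      (fun z => (legendrePoly' n z : ℂ)) x y (x * y / t) / (x * y))) (G t) t := fun t ht =>
    hasDerivAt_prodAntideriv_inv (solvesLegendre_legendrePoly n) hx hxy ht (mem_univ _) (mem_univ _)
  -- As t tends to infinity the inverted variable xy/t tends to 0, so the boundary term at infinity
  -- is the vanishing one at 0.
  have hlim : Tendsto (fun t => -(prodAntideriv (fun z => (legendrePoly n z : ℂ))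
      (fun z => (legendrePoly' n z : ℂ)) x y (x * y / t) / (x * y))) atTop (𝓝 0) := by
    have hc : ContinuousAt (prodAntideriv (fun z => (legendrePoly n z : ℂ))
      (fun z => (legendrePoly' n z : ℂ)) x y) 0 := (hasDerivAt_prodAntideriv
        (solvesLegendre_legendrePoly n) hx hxy (mem_univ _) (mem_univ _)).continuousAt
    have h1 := (hc.tendsto.comp (tendsto_const_nhds.div_atTop tendsto_id :
      Tendsto (fun t : ℝ => x * y / t) atTop (𝓝 0))).div_const ((x : ℂ) * y)
    have := h1.neg
    rw [prodAntideriv_legendrePoly_zero] at this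
    simpa using this
  rw [integral_Ioi_of_hasDerivAt_of_tendsto (hder y hy).continuousAt.continuousWithinAt
    (fun t ht => hder t (hy.trans ht)) hint hlim, mul_div_cancel_right₀ _ hy.ne',
    prodAntideriv_left (by simp [legendrePoly_one]) hx hxy, kerA, if_pos ⟨hx, hxy⟩,
    legendreP'_eq_legendrePoly' hν (div_pos hx hy)]
  field_simp
  ring

/-- For integral degree, `A B = A + B` off the diagonal. -/
theorem integral_kerA_mul_kerB {ν : ℂ} {n : ℕ} (hν : ν * (ν + 1) = n * (n + 1))
    {x y : ℝ} (hx : 0 < x) (hy : 0 < y) (hxy : x ≠ y) :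
    ∫ t, kerA ν x t * kerA ν y t ∂halfLine = kerA ν x y + kerA ν y x := by
  rcases hxy.lt_or_gt with h | h
  · rw [integral_kerA_mul_kerB_of_lt hν hx h]
    simp [kerA, not_lt.2 h.le]
  · simp only [mul_comm (kerA ν x _)]
    rw [integral_kerA_mul_kerB_of_lt hν hy h]
    simp [kerA, not_lt.2 h.le]

/-- For integral degree, `B A = A + B` off the diagonal. -/
theorem integral_kerB_mul_kerA {ν : ℂ} {n : ℕ} (hν : ν * (ν + 1) = n * (n + 1))
    {x y : ℝ} (hx : 0 < x) (hy : 0 < y) (hxy : x ≠ y) :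
    ∫ t, kerA ν t x * kerA ν t y ∂halfLine = kerA ν x y + kerA ν y x := by
  rcases hxy.lt_or_gt with h | h
  · rw [integral_kerB_mul_kerA_of_lt hν hx h]
    simp [kerA, not_lt.2 h.le]
  · simp only [mul_comm (kerA ν _ x)]
    rw [integral_kerB_mul_kerA_of_lt hν hy h]
    simp [kerA, not_lt.2 h.le]

end BuschmanErdelyi

namespace BuschmanErdelyi
open Filter Topology ENNReal

/-! ### The bounded operators -/

theorem IsHardyKernel.op_congr {M M' : ℝ} {k k' : ℝ → ℝ → ℂ} (hk : IsHardyKernel M k)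
    (hk' : IsHardyKernel M' k') (h : k = k') : hk.op = hk'.op := by
  subst h
  ext1 f
  exact Lp.ext ((hk.op_ae f).trans (hk'.op_ae f).symm)

/-- The bounded operator with kernel `p(t/x)/x` on `t < x`. -/
noncomputable def opA (ν : ℂ) : L2 →L[ℂ] L2 := (isHardyKernel_kerA ν).op

/-- The bounded operator with kernel `p(x/t)/t` on `x < t`. -/
noncomputable def opB (ν : ℂ) : L2 →L[ℂ] L2 := (isHardyKernel_kerB ν).op

theorem opA_ae (ν : ℂ) (f : L2) : opA ν f =ᵐ[halfLine] kernelOp (kerA ν) f :=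
  (isHardyKernel_kerA ν).op_ae f

theorem opB_ae (ν : ℂ) (f : L2) : opB ν f =ᵐ[halfLine] kernelOp (fun x t => kerA ν t x) f :=
  (isHardyKernel_kerB ν).op_ae f

theorem ae_ne (x : ℝ) : ∀ᵐ s ∂halfLine, s ≠ x :=
  compl_mem_ae_iff.2 (measure_singleton x)

/-- Identities of kernels off the diagonal suffice, because for fixed x the diagonal is a single
point. -/
theorem IsHardyKernel.op_op_eq_add {M₁ M₂ : ℝ} {k₁ k₂ : ℝ → ℝ → ℂ}
    (h₁ : IsHardyKernel M₁ k₁) (h₂ : IsHardyKernel M₂ k₂)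
    (h : ∀ x y, 0 < x → 0 < y → x ≠ y → ∫ t, k₁ x t * k₂ t y ∂halfLine = k₁ x y + k₂ x y)
    (f : L2) : h₁.op (h₂.op f) = h₁.op f + h₂.op f := by
  refine Lp.ext ?_
  filter_upwards [h₁.op_ae (h₂.op f), Lp.coeFn_add (h₁.op f) (h₂.op f), h₁.op_ae f, h₂.op_ae f,
    ae_halfLine_pos] with x h1 h2 h3 h4 hx
  rw [h1, h2, Pi.add_apply, h3, h4, kernelOp_congr (h₂.op_ae f),
    h₁.kernelOp_kernelOp h₂ (Lp.memLp f) hx, kernelOp, kernelOp,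
    ← integral_add (h₁.integrable_mul (Lp.memLp f) hx) (h₂.integrable_mul (Lp.memLp f) hx)]
  refine integral_congr_ae ?_
  filter_upwards [ae_halfLine_pos, ae_ne x] with s hs hsx
  rw [h x s hx hs hsx.symm]
  ring

theorem opA_opB {ν : ℂ} {n : ℕ} (hν : ν * (ν + 1) = n * (n + 1)) (f : L2) :
    opA ν (opB ν f) = opA ν f + opB ν f :=
  (isHardyKernel_kerA ν).op_op_eq_add (isHardyKernel_kerB ν)
    (fun _ _ hx hy hxy => integral_kerA_mul_kerB hν hx hy hxy) f

theorem opB_opA {ν : ℂ} {n : ℕ} (hν : ν * (ν + 1) = n * (n + 1)) (f : L2) :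
    opB ν (opA ν f) = opB ν f + opA ν f :=
  (isHardyKernel_kerB ν).op_op_eq_add (isHardyKernel_kerA ν)
    (fun _ _ hx hy hxy => (integral_kerB_mul_kerA hν hx hy hxy).trans (add_comm _ _)) f

/-- For integral degree the kernel is real, so the conjugate transpose is the plain transpose. -/
theorem adjoint_opB {ν : ℂ} {n : ℕ} (hν : ν * (ν + 1) = n * (n + 1)) :
    ContinuousLinearMap.adjoint (opB ν) = opA ν := by
  rw [opB, IsHardyKernel.adjoint_op]
  refine IsHardyKernel.op_congr _ _ ?_
  funext x t
  simp only [kerA]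
  split_ifs with h
  · rw [legendreP'_eq_legendrePoly' hν (div_pos h.1 (h.1.trans h.2))]
    simp
  · simp

/-- For integral degree, `1 - B` is unitary with inverse `1 - A`. -/
theorem exists_linearIsometryEquiv {ν : ℂ} {n : ℕ} (hν : ν * (ν + 1) = n * (n + 1)) :
    ∃ U : L2 ≃ₗᵢ[ℂ] L2, (∀ f, U f = f - opB ν f) ∧ ∀ f, U.symm f = f - opA ν f := by
  have hstar : star (1 - opB ν) = 1 - opA ν := by
    rw [star_sub, star_one, ContinuousLinearMap.star_eq_adjoint, adjoint_opB hν]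
  have hmem : (1 - opB ν) ∈ unitary (L2 →L[ℂ] L2) := by
    rw [Unitary.mem_iff, hstar]
    constructor
    · ext1 f
      simp only [mul_apply_eq_comp, sub_apply,
        one_apply_eq_self, map_sub, opA_opB hν]
      abel
    · ext1 f
      simp only [mul_apply_eq_comp, sub_apply,
        one_apply_eq_self, map_sub, opB_opA hν]
      abel
  refine ⟨Unitary.linearIsometryEquiv ⟨1 - opB ν, hmem⟩, fun f => rfl, fun f => ?_⟩
  have : (Unitary.linearIsometryEquiv ⟨1 - opB ν, hmem⟩).symm f = star (1 - opB ν) f := rfl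
  rw [this, hstar]
  rfl

end BuschmanErdelyi

namespace BuschmanErdelyi
open Filter Topology ENNReal

/-! ### Locally absolutely continuous functions -/

theorem HasLocACDeriv.ae_hasDerivAt {F q : ℝ → ℂ} (h : HasLocACDeriv F q) :
    ∀ᵐ x ∂halfLine, HasDerivAt F (q x) x := by
  -- Lebesgue differentiation is applied on intervals exhausting the half-line, where F is a
  -- primitive of q up to a constant.
  have hn : ∀ n : ℕ, ∀ᵐ x, x ∈ Ioo (1 / ((n : ℝ) + 1)) (n + 1) → HasDerivAt F (q x) x := by
    intro n
    have h0 : 0 < 1 / ((n : ℝ) + 1) := by positivity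
    have h1 : 0 < (n : ℝ) + 1 := by positivity
    filter_upwards [(h _ _ h0 h1).1.ae_hasDerivAt_integral] with x hx hxn
    have hx' := hx (Icc_subset_uIcc (Ioo_subset_Icc_self hxn)) _ left_mem_uIcc
    refine (hx'.const_add (F (1 / ((n : ℝ) + 1)))).congr_of_eventuallyEq ?_
    refine eventuallyEq_of_mem (Ioo_mem_nhds hxn.1 hxn.2) fun y hy => ?_
    rw [← (h _ y h0 (h0.trans hy.1)).2]
    ring
  rw [ae_restrict_iff' measurableSet_Ioi]
  filter_upwards [ae_all_iff.2 hn] with x hx hx0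
  have hx0 : 0 < x := hx0
  obtain ⟨n, hn⟩ := exists_nat_gt (max x (1 / x))
  refine hx n ⟨?_, ?_⟩
  · rw [div_lt_comm₀ (by positivity) hx0]
    linarith [le_max_right x (1 / x)]
  · linarith [le_max_left x (1 / x)]

theorem HasLocACDeriv.continuousOn {F q : ℝ → ℂ} (h : HasLocACDeriv F q) :
    ContinuousOn F (Ioi 0) := by
  intro x hx
  have hx : 0 < x := hx
  have h2 : x / 2 < x := by linarith
  have hi := (h (x / 2) (2 * x) (by linarith) (by linarith)).1
  have hc := intervalIntegral.continuousOn_primitive_interval' hi left_mem_uIcc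
  have hmem : uIcc (x / 2) (2 * x) ∈ 𝓝 x := by
    rw [uIcc_of_le (by linarith)]; exact Icc_mem_nhds h2 (by linarith)
  refine ContinuousAt.continuousWithinAt (ContinuousAt.congr
    (continuousAt_const.add (hc.continuousAt hmem)) (f := fun y => F (x / 2) +
      ∫ t in (x / 2)..y, q t) ?_)
  refine eventuallyEq_of_mem (Ioi_mem_nhds hx) fun y hy => ?_
  rw [← (h (x / 2) y (by linarith) hy).2]
  ring

theorem integrableOn_interval_of_memLp {f : ℝ → ℂ} (hf : MemLp f 2 halfLine) (b : ℝ) :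
    IntegrableOn f (Ioo 0 b) := by
  have h1 : MemLp f 2 (volume.restrict (Ioo 0 b)) :=
    hf.mono_measure (Measure.restrict_mono Ioo_subset_Ioi_self le_rfl)
  exact h1.integrable one_le_two

theorem intervalIntegrable_of_memLp {f : ℝ → ℂ} (hf : MemLp f 2 halfLine) {a b : ℝ} (ha : 0 ≤ a)
    (hb : 0 ≤ b) : IntervalIntegrable f volume a b := by
  rw [intervalIntegrable_iff, uIoc, integrableOn_Ioc_iff_integrableOn_Ioo]
  exact (integrableOn_interval_of_memLp hf _).mono_set (Ioo_subset_Ioo_left (le_min ha hb))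

/-- Integration by parts against a primitive of an integrable function. -/
theorem integral_mul_eq_sub_of_primitive {a b : ℝ} (hab : a ≤ b) {u u' v h : ℝ → ℂ}
    (hu : ∀ t ∈ Icc a b, HasDerivAt u (u' t) t) (hu' : ContinuousOn u' (Icc a b))
    (hh : IntervalIntegrable h volume a b) (hv : ∀ t ∈ Icc a b, v t - v a = ∫ s in a..t, h s) :
    ∫ t in a..b, u t * h t = u b * v b - u a * v a - ∫ t in a..b, u' t * v t := by
  have hhI : IntegrableOn h (Ioc a b) := (intervalIntegrable_iff_integrableOn_Ioc_of_le hab).1 hh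
  have hu'I : IntervalIntegrable u' volume a b :=
    ContinuousOn.intervalIntegrable (by rwa [uIcc_of_le hab])
  have hu'O : IntegrableOn u' (Ioc a b) := (intervalIntegrable_iff_integrableOn_Ioc_of_le hab).1 hu'I
  have hftc : ∀ t ∈ Icc a b, ∫ s in t..b, u' s = u b - u t := by
    intro t ht
    refine intervalIntegral.integral_eq_sub_of_hasDerivAt (fun s hs => hu s ?_) ?_
    · rw [uIcc_of_le ht.2] at hs
      exact ⟨ht.1.trans hs.1, hs.2⟩
    · refine hu'I.mono_set ?_
      rw [uIcc_of_le ht.2, uIcc_of_le hab]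
      exact Icc_subset_Icc_left ht.1
  -- Since v is only a primitive, the formula is obtained by integrating u'(s) h(t) over the
  -- triangle t < s in both orders.
  have hfub : ∫ t in Ioc a b, ∫ s in Ioc a b, (if t < s then u' s * h t else 0)
      = ∫ s in Ioc a b, ∫ t in Ioc a b, (if t < s then u' s * h t else 0) := by
    refine integral_integral_swap ?_
    have h1 := hhI.integrable.mul_prod hu'O.integrable
    have h2 := h1.indicator (s := {q : ℝ × ℝ | q.1 < q.2})
      (measurableSet_lt measurable_fst measurable_snd)
    refine h2.congr (Eventually.of_forall fun q => ?_)
    simp only [indicator, mem_ofPred_eq, Function.uncurry]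
    split_ifs <;> ring
  have e1 : ∀ t ∈ Ioc a b, ∫ s in Ioc a b, (if t < s then u' s * h t else 0)
      = (u b - u t) * h t := by
    intro t ht
    have : (fun s => if t < s then u' s * h t else 0) = (Ioi t).indicator (fun s => u' s * h t) := by
      funext s; simp [indicator]
    rw [this, integral_indicator measurableSet_Ioi, Measure.restrict_restrict measurableSet_Ioi,
      inter_comm, Ioc_inter_Ioi, max_eq_right ht.1.le, integral_mul_const,
      ← intervalIntegral.integral_of_le ht.2, hftc t ⟨ht.1.le, ht.2⟩]
  have e2 : ∀ s ∈ Ioc a b, ∫ t in Ioc a b, (if t < s then u' s * h t else 0)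
      = u' s * (v s - v a) := by
    intro s hs
    have : (fun t => if t < s then u' s * h t else 0) = (Iio s).indicator (fun t => u' s * h t) := by
      funext t; simp [indicator]
    have hset : Iio s ∩ Ioc a b = Ioo a s := by
      ext t
      simp only [mem_inter_iff, mem_Iio, mem_Ioc, mem_Ioo]
      exact ⟨fun h => ⟨h.2.1, h.1⟩, fun h => ⟨h.2, h.1, h.2.le.trans hs.2⟩⟩
    rw [this, integral_indicator measurableSet_Iio, Measure.restrict_restrict measurableSet_Iio,
      hset, integral_const_mul, ← integral_Ioc_eq_integral_Ioo,
      ← intervalIntegral.integral_of_le hs.1.le, hv s ⟨hs.1.le, hs.2⟩]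
  rw [setIntegral_congr_fun measurableSet_Ioc e1, setIntegral_congr_fun measurableSet_Ioc e2,
    ← intervalIntegral.integral_of_le hab, ← intervalIntegral.integral_of_le hab] at hfub
  have hvc : ContinuousOn v (Icc a b) := by
    have := intervalIntegral.continuousOn_primitive_interval' hh left_mem_uIcc
    rw [uIcc_of_le hab] at this
    refine ((continuousOn_const (c := v a)).add this).congr fun t ht => ?_
    change v t = v a + ∫ s in a..t, h s
    rw [← hv t ht]; ring
  have huc : ContinuousOn u (Icc a b) := fun t ht => (hu t ht).continuousAt.continuousWithinAt
  have i1 : IntervalIntegrable (fun t => u t * h t) volume a b :=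
    hh.continuousOn_mul (by rwa [uIcc_of_le hab])
  have i2 : IntervalIntegrable (fun t => u' t * v t) volume a b :=
    ContinuousOn.intervalIntegrable (by rw [uIcc_of_le hab]; exact hu'.mul hvc)
  have e3 : ∫ t in a..b, (u b - u t) * h t
      = u b * (v b - v a) - ∫ t in a..b, u t * h t := by
    simp only [sub_mul]
    rw [intervalIntegral.integral_sub (hh.const_mul _) i1, intervalIntegral.integral_const_mul,
      hv b (right_mem_Icc.2 hab)]
  have e4 : ∫ s in a..b, u' s * (v s - v a)
      = (∫ t in a..b, u' t * v t) - (u b - u a) * v a := by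
    simp only [mul_sub]
    rw [intervalIntegral.integral_sub i2 (hu'I.mul_const _), intervalIntegral.integral_mul_const,
      hftc a (left_mem_Icc.2 hab)]
  rw [e3, e4] at hfub
  linear_combination -hfub

/-! ### Primitives of the kernels -/

theorem hasDerivAt_legendreP_div (ν : ℂ) {s t : ℝ} (hs : 0 < s) (ht : 0 < t) :
    HasDerivAt (fun s => legendreP ν (s / t)) (legendreP' ν (s / t) / t) s := by
  have d : HasDerivAt (fun s : ℝ => s / t) t⁻¹ s := by
    simpa using (hasDerivAt_id' s).div_const t
  have := (solvesLegendre_legendreP ν _ (div_pos hs ht)).1.scomp s d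
  refine this.congr_deriv ?_
  rw [Complex.real_smul]
  push_cast
  ring

theorem continuousOn_legendreP'_div (ν : ℂ) {t a b : ℝ} (ht : 0 < t) (ha : 0 < a) :
    ContinuousOn (fun s => legendreP' ν (s / t) / t) (Icc a b) :=
  (continuousOn_legendreP'_div_const ν ht ha).div_const _

theorem integral_legendreP'_div (ν : ℂ) {t a b : ℝ} (ht : 0 < t) (ha : 0 < a) (hab : a ≤ b) :
    ∫ s in a..b, legendreP' ν (s / t) / t = legendreP ν (b / t) - legendreP ν (a / t) := by
  refine intervalIntegral.integral_eq_sub_of_hasDerivAt (f := fun s => legendreP ν (s / t))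
    (fun s hs => ?_) ?_
  · rw [uIcc_of_le hab] at hs
    exact hasDerivAt_legendreP_div ν (ha.trans_le hs.1) ht
  · refine ContinuousOn.intervalIntegrable ?_
    rw [uIcc_of_le hab]
    exact continuousOn_legendreP'_div ν ht ha

theorem integral_indicator_mul_kerA (ν : ℂ) {a b t : ℝ} (ha : 0 < a) (hab : a ≤ b) (hat : a < t) :
    ∫ s, (Ioo a b).indicator 1 s * kerA ν t s ∂halfLine
      = legendreP ν (min b t / t) - legendreP ν (a / t) := by
  have e : ∀ s, (Ioo a b).indicator 1 s * kerA ν t s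
      = if a < s ∧ s < min b t then legendreP' ν (s / t) / t else 0 := by
    intro s
    by_cases h1 : a < s <;> by_cases h2 : s < b <;> by_cases h3 : s < t <;>
      simp [kerA, indicator, h1, h2, h3]
    intro h
    exact absurd (ha.trans h1) (not_lt.2 h)
  simp only [e]
  rw [integral_halfLine_ite ha.le (le_min hab hat.le),
    integral_legendreP'_div ν (ha.trans hat) ha (le_min hab hat.le)]

theorem memLp_indicator_Ioo (a b : ℝ) :
    MemLp ((Ioo a b).indicator (1 : ℝ → ℂ)) 2 halfLine := by
  have h : MemLp ((Ioo a b).indicator (1 : ℝ → ℂ)) 2 volume := by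
    refine (memLp_indicator_const 2 (measurableSet_Ioo (a := a) (b := b)) (1 : ℂ) (Or.inr ?_))
    simp
  exact h.mono_measure Measure.restrict_le_self

/-! ### The operator with an external derivative on `(x, ∞)` -/

/-- The candidate f - Bf is integrated over (a, b) instead of differentiating under the integral. By
Fubini the kernel integrates to P(min(b, t)/t) - P(a/t), and P(1) = 1 makes the part t ≤ b cancel ∫
f. -/
theorem hasLocACDeriv_sMinus (ν : ℂ) {f : ℝ → ℂ} (hf : MemLp f 2 halfLine)
    (hint : ∀ x : ℝ, 0 < x → IntegrableOn (fun t : ℝ => legendreP ν (x / t) * f t) (Ioi x)) :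
    HasLocACDeriv (fun y : ℝ => ∫ t in Ioi y, legendreP ν (y / t) * f t)
      (fun x => -(f x - kernelOp (fun x t => kerA ν t x) f x)) := by
  set q : ℝ → ℂ := fun x => f x - kernelOp (fun x t => kerA ν t x) f x with hq
  have hB : MemLp (kernelOp (fun x t => kerA ν t x) f) 2 halfLine :=
    (isHardyKernel_kerB ν).memLp_kernelOp hf
  have hqL : MemLp q 2 halfLine := hf.sub hB
  have hqi : ∀ a b : ℝ, 0 < a → 0 < b → IntervalIntegrable q volume a b := fun a b ha hb =>
    intervalIntegrable_of_memLp hqL ha.le hb.le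
  have key : ∀ a b : ℝ, 0 < a → a ≤ b → ∫ t in a..b, q t =
      (∫ t in Ioi a, legendreP ν (a / t) * f t) - ∫ t in Ioi b, legendreP ν (b / t) * f t := by
    intro a b ha hab
    have hb : 0 < b := ha.trans_le hab
    have s1 : ∫ t in a..b, kernelOp (fun x t => kerA ν t x) f t
        = ∫ t, (∫ s, (Ioo a b).indicator 1 s * kerA ν t s ∂halfLine) * f t ∂halfLine := by
      -- The outer kernel is the indicator of (a, b) and ignores its first variable, so the
      -- evaluation point 0 is a dummy.
      rw [← kernelOp_kernelOp (k₁ := fun _ s => (Ioo a b).indicator 1 s)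
        (k₂ := fun x t => kerA ν t x) (x := 0)
        ((isHardyKernel_kerB ν).integrable_prod hf (memLp_indicator_Ioo a b)),
        ← integral_halfLine_ite ha.le hab (kernelOp (fun x t => kerA ν t x) f)]
      refine integral_congr_ae (Eventually.of_forall fun s => ?_)
      by_cases h : a < s ∧ s < b
      · simp [h]
      · simp [h]
    have s2 : ∫ t, (∫ s, (Ioo a b).indicator 1 s * kerA ν t s ∂halfLine) * f t ∂halfLine
        = ∫ t in Ioi a, (legendreP ν (min b t / t) * f t - legendreP ν (a / t) * f t) := by
      have hres : Measure.restrict halfLine (Ioi a) = volume.restrict (Ioi a) := by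
        rw [Measure.restrict_restrict measurableSet_Ioi,
          inter_eq_left.2 (show Ioi a ⊆ Ioi 0 from Ioi_subset_Ioi ha.le)]
      rw [← hres, ← integral_indicator (measurableSet_Ioi (a := a))]
      refine integral_congr_ae (Eventually.of_forall fun t => ?_)
      by_cases h : a < t
      · simp only
        rw [indicator_of_mem (mem_Ioi.2 h), integral_indicator_mul_kerA ν ha hab h]
        ring
      · simp only
        rw [indicator_of_notMem (by simpa using h)]
        have : ∀ s, (Ioo a b).indicator 1 s * kerA ν t s = 0 := by
          intro s
          by_cases hs : s < t
          · simp [indicator, not_lt.2 (hs.le.trans (not_lt.1 h))]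
          · simp [kerA, hs]
        simp [this]
    have hmin : ∀ t ∈ Ioc a b, legendreP ν (min b t / t) * f t = f t := by
      intro t ht
      rw [min_eq_right ht.2, div_self (ha.trans ht.1).ne', legendreP_one, one_mul]
    have hmin' : ∀ t ∈ Ioi b, legendreP ν (min b t / t) * f t = legendreP ν (b / t) * f t := by
      intro t ht
      rw [min_eq_left (le_of_lt ht)]
    have i1 : IntegrableOn (fun t => legendreP ν (min b t / t) * f t) (Ioc a b) := by
      refine IntegrableOn.congr_fun ?_ (fun t ht => (hmin t ht).symm) measurableSet_Ioc
      exact (intervalIntegrable_iff_integrableOn_Ioc_of_le hab).1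
        (intervalIntegrable_of_memLp hf ha.le hb.le)
    have i2 : IntegrableOn (fun t => legendreP ν (min b t / t) * f t) (Ioi b) :=
      (hint b hb).congr_fun (fun t ht => (hmin' t ht).symm) measurableSet_Ioi
    have s3 : ∫ t in Ioi a, legendreP ν (min b t / t) * f t
        = (∫ t in a..b, f t) + ∫ t in Ioi b, legendreP ν (b / t) * f t := by
      rw [← Ioc_union_Ioi_eq_Ioi hab, setIntegral_union (Ioc_disjoint_Ioi le_rfl)
        measurableSet_Ioi i1 i2, setIntegral_congr_fun measurableSet_Ioc hmin,
        setIntegral_congr_fun measurableSet_Ioi hmin', intervalIntegral.integral_of_le hab]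
    have i12 : IntegrableOn (fun t => legendreP ν (min b t / t) * f t) (Ioi a) := by
      rw [← Ioc_union_Ioi_eq_Ioi hab]; exact i1.union i2
    rw [intervalIntegral.integral_sub (intervalIntegrable_of_memLp hf ha.le hb.le)
      (intervalIntegrable_of_memLp hB ha.le hb.le), s1, s2, integral_sub i12 (hint a ha), s3]
    ring
  intro a b ha hb
  refine ⟨(hqi a b ha hb).neg, ?_⟩
  rw [intervalIntegral.integral_neg]
  rcases le_total a b with h | h
  · rw [key a b ha h]; ring
  · rw [intervalIntegral.integral_symm, key b a hb h]; ring

/-- For every degree S_- is a restriction of the bounded operator 1 - B; absolute convergence is the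
only domain condition. -/
theorem sMinus_iff (ν : ℂ) (f g : L2) : SMinus ν f g ↔
    (∀ x : ℝ, 0 < x → IntegrableOn (fun t : ℝ => legendreP ν (x / t) * f t) (Ioi x)) ∧
      g = f - opB ν f := by
  refine and_congr_right fun hint => ?_
  have hd := (hasLocACDeriv_sMinus ν (Lp.memLp f) hint).ae_hasDerivAt
  have hB : ⇑(f - opB ν f) =ᵐ[halfLine] fun x => f x - kernelOp (fun x t => kerA ν t x) f x := by
    filter_upwards [Lp.coeFn_sub f (opB ν f), opB_ae ν f] with x h1 h2
    rw [h1, Pi.sub_apply, h2]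
  constructor
  · intro h
    refine Lp.ext ?_
    filter_upwards [h, hd, hB] with x h1 h2 h3
    rw [h3]
    exact neg_injective (h1.unique h2)
  · rintro rfl
    filter_upwards [hd, hB] with x h2 h3
    rwa [h3]

end BuschmanErdelyi

namespace BuschmanErdelyi
open Filter Topology ENNReal
open scoped ContDiff

/-! ### Test functions -/

/-- Smooth functions with compact support in `(0, ∞)`. -/
structure IsTest (φ : ℝ → ℂ) : Prop where
  smooth : ContDiff ℝ ∞ φ
  compact : HasCompactSupport φ
  subset : tsupport φ ⊆ Ioi 0

namespace IsTest

variable {φ ψ : ℝ → ℂ}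

theorem exists_Ioo (h : IsTest φ) : ∃ a b : ℝ, 0 < a ∧ a < b ∧ tsupport φ ⊆ Ioo a b := by
  have hc : IsCompact (tsupport φ) := h.compact
  rcases (tsupport φ).eq_empty_or_nonempty with he | hne
  · exact ⟨1, 2, one_pos, one_lt_two, by simp [he]⟩
  · obtain ⟨m, hm, hmin⟩ := hc.exists_isLeast hne
    obtain ⟨M, hM, hmax⟩ := hc.exists_isGreatest hne
    have hm0 : 0 < m := h.subset hm
    refine ⟨m / 2, M + 1, by linarith, by linarith [hmin hM], fun t ht => ⟨?_, ?_⟩⟩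
    · linarith [hmin ht]
    · linarith [hmax ht]

theorem memLp (h : IsTest φ) : MemLp φ 2 halfLine :=
  (h.smooth.continuous.memLp_of_hasCompactSupport h.compact).mono_measure Measure.restrict_le_self

theorem hasDerivAt (h : IsTest φ) (t : ℝ) : HasDerivAt φ (deriv φ t) t :=
  (h.smooth.differentiable (by simp) t).hasDerivAt

theorem deriv (h : IsTest φ) : IsTest (deriv φ) where
  smooth := (contDiff_infty_iff_deriv.1 h.smooth).2
  compact := h.compact.deriv
  subset := (tsupport_deriv_subset (𝕜 := ℝ) (f := φ)).trans h.subset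

theorem ofReal_mul (h : IsTest φ) : IsTest (fun t => (t : ℂ) * φ t) where
  smooth := Complex.ofRealCLM.contDiff.mul h.smooth
  compact := h.compact.mul_left
  subset := (tsupport_mul_subset_right (f := fun t : ℝ => (t : ℂ)) (g := φ)).trans h.subset

theorem add (h : IsTest φ) (h' : IsTest ψ) : IsTest (fun t => φ t + ψ t) where
  smooth := h.smooth.add h'.smooth
  compact := h.compact.add h'.compact
  subset := (tsupport_add φ ψ).trans (union_subset h.subset h'.subset)

theorem const_mul (h : IsTest φ) (c : ℂ) : IsTest (fun t => c * φ t) where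
  smooth := contDiff_const.mul h.smooth
  compact := h.compact.mul_left
  subset := (tsupport_mul_subset_right (f := fun _ : ℝ => c) (g := φ)).trans h.subset

end IsTest

/-- The classes of test functions. -/
def testSubmodule : Submodule ℂ L2 where
  carrier := {f | ∃ φ, IsTest φ ∧ f =ᵐ[halfLine] φ}
  zero_mem' := ⟨fun _ => 0, ⟨contDiff_const, HasCompactSupport.zero, by simp [tsupport]⟩,
    Lp.coeFn_zero _ _ _⟩
  add_mem' := by
    rintro f g ⟨φ, hφ, hf⟩ ⟨ψ, hψ, hg⟩
    refine ⟨_, hφ.add hψ, ?_⟩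
    filter_upwards [Lp.coeFn_add f g, hf, hg] with t h1 h2 h3
    rw [h1, Pi.add_apply, h2, h3]
  smul_mem' := by
    rintro c f ⟨φ, hφ, hf⟩
    refine ⟨_, hφ.const_mul c, ?_⟩
    filter_upwards [Lp.coeFn_smul c f, hf] with t h1 h2
    rw [h1, Pi.smul_apply, h2, smul_eq_mul]

open scoped InnerProductSpace in
-- An element orthogonal to all test functions is locally integrable on (0, ∞) and has zero integral
-- against them, hence vanishes almost everywhere.
theorem dense_testSubmodule : Dense (testSubmodule : Set L2) := by
  rw [Submodule.dense_iff_topologicalClosure_eq_top, Submodule.topologicalClosure_eq_top_iff,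
    Submodule.eq_bot_iff]
  intro f hf
  rw [Submodule.mem_orthogonal] at hf
  have hloc : LocallyIntegrableOn f (Ioi 0) volume := by
    rw [locallyIntegrableOn_iff isOpen_Ioi.isLocallyClosed]
    intro K hK hKc
    have h1 : MemLp f 2 (volume.restrict K) :=
      (Lp.memLp f).mono_measure (Measure.restrict_mono hK le_rfl)
    have : IsFiniteMeasure (volume.restrict K) := ⟨by simpa using hKc.measure_lt_top⟩
    exact h1.integrable one_le_two
  have hz := isOpen_Ioi.ae_eq_zero_of_integral_contDiff_smul_eq_zero (μ := volume) hloc (by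
    intro g hg hgc hgs
    have ht : IsTest (fun t => (g t : ℂ)) := by
      refine ⟨Complex.ofRealCLM.contDiff.comp hg, ?_, ?_⟩
      · exact hgc.comp_left (g := fun r : ℝ => (r : ℂ)) rfl
      · refine (closure_mono fun t ht => ?_).trans hgs
        simpa using ht
    have hin := hf (ht.memLp.toLp _) ⟨_, ht, ht.memLp.coeFn_toLp⟩
    rw [L2.inner_def] at hin
    have e : ∫ t, g t • f t = ∫ t in Ioi 0, g t • f t := by
      refine (setIntegral_eq_integral_of_forall_compl_eq_zero fun t ht => ?_).symm
      rw [image_eq_zero_of_notMem_tsupport fun h => ht (hgs h), zero_smul]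
    rw [e, ← hin]
    refine integral_congr_ae ?_
    filter_upwards [ht.memLp.coeFn_toLp] with t h1
    rw [h1, RCLike.inner_apply, Complex.conj_ofReal, Complex.real_smul, mul_comm])
  refine Lp.ext ?_
  have h2 : ∀ᵐ t ∂halfLine, f t = 0 := (ae_restrict_iff' measurableSet_Ioi).2 hz
  filter_upwards [h2, Lp.coeFn_zero ℂ 2 halfLine] with t h3 h4
  rw [h3, h4]; rfl

/-! ### Rows and columns of the kernel `C` -/

theorem memLp_of_bound_Ioo {F : ℝ → ℂ} (hF : Measurable F) {a b K : ℝ}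
    (hb : ∀ t ∈ Ioo a b, ‖F t‖ ≤ K) (h0 : ∀ t ∉ Ioo a b, F t = 0) : MemLp F 2 halfLine := by
  refine ((memLp_indicator_Ioo a b).const_mul (K : ℂ)).of_le hF.aestronglyMeasurable
    (Eventually.of_forall fun t => ?_)
  by_cases h : t ∈ Ioo a b
  · rw [indicator_of_mem h]
    simpa using (hb t h).trans (le_abs_self K)
  · rw [h0 t h, norm_zero]
    positivity

theorem measurable_kerC_left (ν : ℂ) (x : ℝ) : Measurable (kerC ν x) :=
  (measurable_kerC ν).comp (measurable_const.prodMk measurable_id)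

theorem measurable_kerC_right (ν : ℂ) (x : ℝ) : Measurable (fun t => kerC ν t x) :=
  (measurable_kerC ν).comp (measurable_id.prodMk measurable_const)

/-- The row p(x/t)/t may be large only as t tends to 0, so cutting it off below a makes it bounded
with bounded support. Functions vanishing near 0 can then be fed to C. -/
theorem memLp_kerC_row (ν : ℂ) {a : ℝ} (ha : 0 < a) (x : ℝ) :
    MemLp ((Ioi a).indicator (kerC ν x)) 2 halfLine := by
  rcases le_or_gt x 0 with hx | hx
  · refine memLp_of_bound_Ioo (a := a) (b := a) (K := 0)
      ((measurable_kerC_left ν x).indicator measurableSet_Ioi) (by simp) fun t _ => ?_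
    by_cases h : a < t
    · rw [indicator_of_mem (mem_Ioi.2 h), kerC, if_neg]
      exact fun h' => not_lt.2 hx (h'.1.trans h'.2)
    · exact indicator_of_notMem (by simpa using h) _
  obtain ⟨K, hK⟩ := isCompact_Icc.exists_bound_of_continuousOn
    (((continuousOn_legendreP'_const_div ν hx ha (b := x)).div
      Complex.continuous_ofReal.continuousOn
      fun t ht => by exact_mod_cast (ha.trans_le ht.1).ne'))
  refine memLp_of_bound_Ioo (a := a) (b := x) (K := K)
    ((measurable_kerC_left ν x).indicator measurableSet_Ioi) (fun t ht => ?_) fun t ht => ?_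
  · rw [indicator_of_mem (mem_Ioi.2 ht.1), kerC, if_pos ⟨ha.trans ht.1, ht.2⟩]
    exact hK t (Ioo_subset_Icc_self ht)
  · by_cases h : a < t
    · rw [indicator_of_mem (mem_Ioi.2 h), kerC, if_neg]
      exact fun h' => ht ⟨h, h'.2⟩
    · exact indicator_of_notMem (by simpa using h) _

/-- The column p(t/x)/x may grow only at infinity; truncated, it pairs with functions vanishing for
large t. -/
theorem memLp_kerC_col (ν : ℂ) {x : ℝ} (hx : 0 < x) (b : ℝ) :
    MemLp ((Iio b).indicator (fun t => kerC ν t x)) 2 halfLine := by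
  obtain ⟨K, hK⟩ := isCompact_Icc.exists_bound_of_continuousOn
    (continuousOn_legendreP'_div ν hx hx (b := b))
  refine memLp_of_bound_Ioo (a := x) (b := b) (K := K)
    ((measurable_kerC_right ν x).indicator measurableSet_Iio) (fun t ht => ?_) fun t ht => ?_
  · rw [indicator_of_mem (mem_Iio.2 ht.2), kerC, if_pos ⟨hx, ht.1⟩]
    exact hK t (Ioo_subset_Icc_self ht)
  · by_cases h : t < b
    · rw [indicator_of_mem (mem_Iio.2 h), kerC, if_neg]
      exact fun h' => ht ⟨h'.2, h⟩
    · exact indicator_of_notMem (by simpa using h) _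

/-! ### The operator with an external derivative on `(0, x)` -/

theorem integral_indicator_mul_kerC (ν : ℂ) {y t : ℝ} (ht : 0 < t) (hty : t < y) :
    ∫ s, (Ioo 0 y).indicator 1 s * kerC ν s t ∂halfLine = legendreP ν (y / t) - 1 := by
  have e : ∀ s, (Ioo 0 y).indicator 1 s * kerC ν s t
      = if t < s ∧ s < y then legendreP' ν (s / t) / t else 0 := by
    intro s
    by_cases h1 : t < s <;> by_cases h2 : s < y <;> simp [kerC, indicator, h1, h2, ht]
    intro h
    exact absurd (ht.trans h1) (not_lt.2 h)
  simp only [e]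
  rw [integral_halfLine_ite ht.le hty.le, integral_legendreP'_div ν ht ht hty.le,
    div_self ht.ne', legendreP_one]

/-- As for S_-, the candidate f + Cf is integrated and the order exchanged. The kernel C is not
dominated, so the integrability needed for Fubini is a hypothesis, to be supplied by the support of
f or by positivity of p. -/
theorem hasLocACDeriv_sZeroPlus (ν : ℂ) {f : ℝ → ℂ} (hf : MemLp f 2 halfLine)
    (hint : ∀ x : ℝ, 0 < x → IntegrableOn (fun t : ℝ => legendreP ν (x / t) * f t) (Ioo 0 x))
    (hprod : ∀ y : ℝ, 0 < y → Integrable (fun q : ℝ × ℝ =>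
      (Ioo 0 y).indicator 1 q.1 * (kerC ν q.1 q.2 * f q.2)) (halfLine.prod halfLine)) :
    HasLocACDeriv (fun y : ℝ => ∫ t in Ioo 0 y, legendreP ν (y / t) * f t)
      (fun x => f x + kernelOp (kerC ν) f x) := by
  have hres : ∀ y : ℝ, Measure.restrict halfLine (Ioo 0 y) = volume.restrict (Ioo 0 y) := fun y => by
    rw [Measure.restrict_restrict measurableSet_Ioo,
      inter_eq_left.2 (show Ioo 0 y ⊆ Ioi 0 from Ioo_subset_Ioi_self)]
  have hfi : ∀ y : ℝ, 0 < y → IntervalIntegrable f volume 0 y := fun y hy =>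
    intervalIntegrable_of_memLp hf le_rfl hy.le
  have hind : ∀ y : ℝ, (fun s => ∫ t, (Ioo 0 y).indicator 1 s * (kerC ν s t * f t) ∂halfLine)
      = (Ioo 0 y).indicator (kernelOp (kerC ν) f) := by
    intro y
    funext s
    by_cases h : s ∈ Ioo 0 y
    · simp only [indicator_of_mem h, Pi.one_apply, one_mul]; rfl
    · simp only [indicator_of_notMem h, zero_mul, integral_zero]
  have hCi : ∀ y : ℝ, 0 < y → IntervalIntegrable (kernelOp (kerC ν) f) volume 0 y := by
    intro y hy
    have := (hprod y hy).integral_prod_left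
    simp only at this
    rw [hind y, integrable_indicator_iff measurableSet_Ioo, IntegrableOn, hres] at this
    rwa [intervalIntegrable_iff_integrableOn_Ioo_of_le hy.le]
  have key : ∀ y : ℝ, 0 < y → ∫ t in (0 : ℝ)..y, (f t + kernelOp (kerC ν) f t)
      = ∫ t in Ioo 0 y, legendreP ν (y / t) * f t := by
    intro y hy
    have s1 : ∫ t in (0 : ℝ)..y, kernelOp (kerC ν) f t
        = ∫ t, (∫ s, (Ioo 0 y).indicator 1 s * kerC ν s t ∂halfLine) * f t ∂halfLine := by
      rw [← kernelOp_kernelOp (k₁ := fun _ s => (Ioo 0 y).indicator 1 s)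
        (k₂ := kerC ν) (x := 0) (hprod y hy),
        ← integral_halfLine_ite le_rfl hy.le (kernelOp (kerC ν) f)]
      refine integral_congr_ae (Eventually.of_forall fun s => ?_)
      by_cases h : 0 < s ∧ s < y
      · simp [h]
      · simp [h]
    have s2 : ∫ t, (∫ s, (Ioo 0 y).indicator 1 s * kerC ν s t ∂halfLine) * f t ∂halfLine
        = ∫ t in Ioo 0 y, (legendreP ν (y / t) * f t - f t) := by
      rw [← hres, ← integral_indicator (measurableSet_Ioo (a := (0 : ℝ)) (b := y))]
      refine integral_congr_ae ?_
      filter_upwards [ae_halfLine_pos] with t ht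
      by_cases h : t < y
      · rw [indicator_of_mem (show t ∈ Ioo 0 y from ⟨ht, h⟩), integral_indicator_mul_kerC ν ht h]
        ring
      · rw [indicator_of_notMem (fun h' => h h'.2)]
        have : ∀ s, (Ioo 0 y).indicator 1 s * kerC ν s t = 0 := by
          intro s
          by_cases hs : s < y
          · simp [kerC, not_lt.2 (hs.le.trans (not_lt.1 h))]
          · simp [indicator, hs]
        simp [this]
    have hfo := (intervalIntegrable_iff_integrableOn_Ioo_of_le hy.le).1 (hfi y hy)
    rw [intervalIntegral.integral_add (hfi y hy) (hCi y hy), s1, s2, integral_sub (hint y hy) hfo,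
      intervalIntegral.integral_of_le hy.le, integral_Ioc_eq_integral_Ioo]
    ring
  intro a b ha hb
  have hq : ∀ y : ℝ, 0 < y →
      IntervalIntegrable (fun x => f x + kernelOp (kerC ν) f x) volume 0 y := fun y hy =>
    (hfi y hy).add (hCi y hy)
  refine ⟨(hq a ha).symm.trans (hq b hb), ?_⟩
  beta_reduce
  rw [← key a ha, ← key b hb, intervalIntegral.integral_interval_sub_left (hq b hb) (hq a ha)]

/-- A majorant w(t) independent of s is enough, because s ranges over a bounded interval. -/
theorem integrable_indicator_mul_kerC (ν : ℂ) {f : ℝ → ℂ} (hf : AEStronglyMeasurable f halfLine)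
    {y : ℝ} {w : ℝ → ℝ} (hw : IntegrableOn w (Ioo 0 y)) (hw0 : ∀ t, 0 ≤ w t)
    (hb : ∀ t s, 0 < t → t < s → s < y → ‖kerC ν s t * f t‖ ≤ w t) :
    Integrable (fun q : ℝ × ℝ => (Ioo 0 y).indicator 1 q.1 * (kerC ν q.1 q.2 * f q.2))
      (halfLine.prod halfLine) := by
  have h1 : Integrable ((Ioo 0 y).indicator (1 : ℝ → ℝ)) halfLine := by
    refine (IntegrableOn.integrable_indicator ?_ measurableSet_Ioo).mono_measure
      Measure.restrict_le_self
    simp [Pi.one_def]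
  have h2 : Integrable ((Ioo 0 y).indicator w) halfLine :=
    (hw.integrable_indicator measurableSet_Ioo).mono_measure Measure.restrict_le_self
  refine (h1.mul_prod h2).mono' ?_ ?_
  · refine AEStronglyMeasurable.mul ?_ ((measurable_kerC ν).aestronglyMeasurable.mul
      (hf.comp_quasiMeasurePreserving Measure.quasiMeasurePreserving_snd))
    exact ((measurable_one.indicator measurableSet_Ioo).comp measurable_fst).aestronglyMeasurable
  · have hpos : ∀ᵐ q : ℝ × ℝ ∂(halfLine.prod halfLine), 0 < q.2 :=
      Measure.quasiMeasurePreserving_snd.ae ae_halfLine_pos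
    filter_upwards [hpos] with q hq
    by_cases h : q.1 ∈ Ioo 0 y
    · rw [indicator_of_mem h, indicator_of_mem h, Pi.one_apply, Pi.one_apply, one_mul, one_mul]
      by_cases h' : q.2 < q.1
      · rw [indicator_of_mem (show q.2 ∈ Ioo 0 y from ⟨hq, h'.trans h.2⟩)]
        exact hb _ _ hq h' h.2
      · have : kerC ν q.1 q.2 = 0 := by simp [kerC, h']
        rw [this, zero_mul, norm_zero]
        exact indicator_nonneg (fun t _ => hw0 t) _
    · rw [indicator_of_notMem h, indicator_of_notMem h, zero_mul, zero_mul, norm_zero]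

end BuschmanErdelyi

/-! ### Inversion of 1 - A and 1 - B on test functions -/

namespace BuschmanErdelyi
open Filter Topology ENNReal
open scoped ContDiff

theorem ae_Ioo_of_ae_halfLine {p : ℝ → Prop} (h : ∀ᵐ x ∂halfLine, p x) (y : ℝ) :
    ∀ᵐ x ∂(volume.restrict (Ioo 0 y)), p x :=
  ae_mono (Measure.restrict_mono Ioo_subset_Ioi_self le_rfl) h

/-- The graph in terms of a representative. -/
theorem sZeroPlus_of_ae {ν : ℂ} {f g : L2} {f₀ : ℝ → ℂ} (h : f =ᵐ[halfLine] f₀)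
    (hint : ∀ x : ℝ, 0 < x → IntegrableOn (fun t : ℝ => legendreP ν (x / t) * f₀ t) (Ioo 0 x))
    (hd : ∀ᵐ x ∂halfLine,
      HasDerivAt (fun y : ℝ => ∫ t in Ioo 0 y, legendreP ν (y / t) * f₀ t) (g x) x) :
    SZeroPlus ν f g := by
  have hc : ∀ y : ℝ, (fun t : ℝ => legendreP ν (y / t) * f₀ t)
      =ᵐ[volume.restrict (Ioo 0 y)] fun t : ℝ => legendreP ν (y / t) * f t := by
    intro y
    filter_upwards [ae_Ioo_of_ae_halfLine h y] with t ht
    rw [ht]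
  refine ⟨fun x hx => (hint x hx).congr (hc x), ?_⟩
  have e : (fun y : ℝ => ∫ t in Ioo 0 y, legendreP ν (y / t) * f t)
      = fun y : ℝ => ∫ t in Ioo 0 y, legendreP ν (y / t) * f₀ t :=
    funext fun y => (integral_congr_ae (hc y)).symm
  rw [e]
  exact hd

theorem kernelOp_sub {k : ℝ → ℝ → ℂ} {f g : ℝ → ℂ} {x : ℝ}
    (hf : Integrable (fun t => k x t * f t) halfLine)
    (hg : Integrable (fun t => k x t * g t) halfLine) :
    kernelOp k (fun t => f t - g t) x = kernelOp k f x - kernelOp k g x := by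
  simp only [kernelOp, mul_sub]
  exact integral_sub hf hg

theorem memLp_indicator_of_continuousOn {F : ℝ → ℂ} {a b : ℝ} (hF : ContinuousOn F (Icc a b)) :
    MemLp ((Ioo a b).indicator F) 2 halfLine := by
  classical
  obtain ⟨K, hK⟩ := isCompact_Icc.exists_bound_of_continuousOn hF
  refine memLp_of_bound_Ioo (a := a) (b := b) (K := K) ?_ (fun t ht => ?_)
    fun t ht => indicator_of_notMem ht _
  · rw [← piecewise_eq_indicator]
    exact (hF.mono Ioo_subset_Icc_self).measurable_piecewise continuousOn_const measurableSet_Ioo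
  · rw [indicator_of_mem ht]
    exact hK t (Ioo_subset_Icc_self ht)

/-- A function in `L₂(0, ∞)` vanishing near `0` is integrable on `(0, x)` against continuous
functions on `(0, x]`. -/
theorem integrableOn_mul_of_eq_zero {F f : ℝ → ℂ} {a x : ℝ} (hF : ContinuousOn F (Icc a x))
    (hf : MemLp f 2 halfLine) (h0 : ∀ t ≤ a, f t = 0) :
    IntegrableOn (fun t => F t * f t) (Ioo 0 x) := by
  have h := ((memLp_indicator_of_continuousOn hF).integrable_mul hf).mono_measure
    (Measure.restrict_mono (show Ioo 0 x ⊆ Ioi 0 from Ioo_subset_Ioi_self) le_rfl)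
  refine h.congr ?_
  filter_upwards [ae_restrict_mem measurableSet_Ioo] with t ht
  by_cases hat : a < t
  · simp [indicator, hat, ht.2]
  · simp [h0 t (not_lt.1 hat)]

section Test

variable {φ : ℝ → ℂ} {a b : ℝ}

theorem eq_zero_of_notMem_Ioo (hab : tsupport φ ⊆ Ioo a b) {t : ℝ} (ht : t ∉ Ioo a b) :
    φ t = 0 :=
  image_eq_zero_of_notMem_tsupport fun h => ht (hab h)

theorem kernelOp_kerA_eq_zero (ν : ℂ) (hab : tsupport φ ⊆ Ioo a b) {x : ℝ} (hx : x ≤ a) :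
    kernelOp (kerA ν) φ x = 0 := by
  rw [kernelOp]
  refine integral_eq_zero_of_ae (Eventually.of_forall fun t => ?_)
  by_cases h : t < x
  · simp [eq_zero_of_notMem_Ioo hab fun h' => not_lt.2 hx (h'.1.trans h)]
  · simp [kerA, h]

theorem kernelOp_kerB_eq_zero (ν : ℂ) (hab : tsupport φ ⊆ Ioo a b) {x : ℝ} (hx : b ≤ x) :
    kernelOp (fun x t => kerA ν t x) φ x = 0 := by
  rw [kernelOp]
  refine integral_eq_zero_of_ae (Eventually.of_forall fun t => ?_)
  by_cases h : x < t
  · simp [eq_zero_of_notMem_Ioo hab fun h' => not_lt.2 hx (h.trans h'.2)]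
  · simp [kerA, h]

theorem integrable_kerC_mul (ν : ℂ) (ha : 0 < a) {f : ℝ → ℂ} (hf : MemLp f 2 halfLine)
    (h0 : ∀ t ≤ a, f t = 0) (x : ℝ) : Integrable (fun t => kerC ν x t * f t) halfLine := by
  refine ((memLp_kerC_row ν ha x).integrable_mul hf).congr (Eventually.of_forall fun t => ?_)
  by_cases h : a < t
  · simp [indicator, h]
  · simp [h0 t (not_lt.1 h)]

theorem integrable_kerD_mul (ν : ℂ) {f : ℝ → ℂ} (hf : MemLp f 2 halfLine)
    (h0 : ∀ t, b ≤ t → f t = 0) {x : ℝ} (hx : 0 < x) :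
    Integrable (fun t => kerC ν t x * f t) halfLine := by
  refine ((memLp_kerC_col ν hx b).integrable_mul hf).congr (Eventually.of_forall fun t => ?_)
  by_cases h : t < b
  · simp [indicator, h]
  · simp [h0 t (not_lt.1 h)]

/-- `(1 + C)(1 - A) φ = φ`. -/
theorem one_add_kerC_one_sub_kerA (ν : ℂ) (hφ : IsTest φ) (ha : 0 < a) (hab : tsupport φ ⊆ Ioo a b)
    {x : ℝ} (hx : 0 < x) :
    (φ x - kernelOp (kerA ν) φ x) + kernelOp (kerC ν) (fun t => φ t - kernelOp (kerA ν) φ t) x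
      = φ x := by
  have h1 : ∀ t ≤ a, φ t = 0 := fun t ht => eq_zero_of_notMem_Ioo hab fun h => not_lt.2 ht h.1
  have hA := (isHardyKernel_kerA ν).memLp_kernelOp hφ.memLp
  have i1 := integrable_kerC_mul ν ha hφ.memLp h1 x
  have i2 := integrable_kerC_mul ν ha hA (fun t ht => kernelOp_kerA_eq_zero ν hab ht) x
  have hcomp : kernelOp (kerC ν) (kernelOp (kerA ν) φ) x
      = kernelOp (kerC ν) φ x - kernelOp (kerA ν) φ x := by
    rw [kernelOp_kernelOp]
    · rw [kernelOp, kernelOp, ← integral_sub i1 ((isHardyKernel_kerA ν).integrable_mul hφ.memLp hx)]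
      refine integral_congr_ae ?_
      filter_upwards [ae_halfLine_pos] with s hs
      rw [integral_kerC_mul_kerA ν hs, sub_mul]
    -- The operator A moves supports only to the right, so the row of C may be truncated at a
    -- without changing the integrand.
    · refine ((isHardyKernel_kerA ν).integrable_prod hφ.memLp (memLp_kerC_row ν ha x)).congr
        (Eventually.of_forall fun q => ?_)
      by_cases h : a < q.1
      · simp only [indicator_of_mem (mem_Ioi.2 h)]
      · have : kerA ν q.1 q.2 * φ q.2 = 0 := by
          by_cases h2 : q.2 < q.1
          · rw [h1 _ (h2.le.trans (not_lt.1 h)), mul_zero]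
          · simp [kerA, h2]
        simp only [this, mul_zero]
  rw [kernelOp_sub i1 i2, hcomp]
  ring

/-- `(1 + D)(1 - B) φ = φ`. -/
theorem one_add_kerD_one_sub_kerB (ν : ℂ) (hφ : IsTest φ) (hab : tsupport φ ⊆ Ioo a b)
    {x : ℝ} (hx : 0 < x) :
    (φ x - kernelOp (fun x t => kerA ν t x) φ x)
      + kernelOp (fun x t => kerC ν t x) (fun t => φ t - kernelOp (fun x t => kerA ν t x) φ t) x
      = φ x := by
  have h1 : ∀ t, b ≤ t → φ t = 0 := fun t ht => eq_zero_of_notMem_Ioo hab fun h => not_lt.2 ht h.2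
  have hB := (isHardyKernel_kerB ν).memLp_kernelOp hφ.memLp
  have i1 := integrable_kerD_mul ν hφ.memLp h1 hx
  have i2 := integrable_kerD_mul ν hB (fun t ht => kernelOp_kerB_eq_zero ν hab ht) hx
  have hcomp : kernelOp (fun x t => kerC ν t x) (kernelOp (fun x t => kerA ν t x) φ) x
      = kernelOp (fun x t => kerC ν t x) φ x - kernelOp (fun x t => kerA ν t x) φ x := by
    rw [kernelOp_kernelOp]
    · rw [kernelOp, kernelOp, ← integral_sub i1 ((isHardyKernel_kerB ν).integrable_mul hφ.memLp hx)]
      refine integral_congr_ae ?_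
      filter_upwards [ae_halfLine_pos] with s hs
      simp only [mul_comm (kerC ν _ x)]
      rw [integral_kerA_mul_kerC ν hs hx]
      ring
    · refine ((isHardyKernel_kerB ν).integrable_prod hφ.memLp (memLp_kerC_col ν hx b)).congr
        (Eventually.of_forall fun q => ?_)
      by_cases h : q.1 < b
      · simp only [indicator_of_mem (mem_Iio.2 h)]
      · have : kerA ν q.2 q.1 * φ q.2 = 0 := by
          by_cases h2 : q.1 < q.2
          · rw [h1 _ ((not_lt.1 h).trans h2.le), mul_zero]
          · simp [kerA, h2]
        simp only [this, mul_zero]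
  rw [kernelOp_sub i1 i2, hcomp]
  ring

end Test

theorem coe_sub_opA (ν : ℂ) {f : L2} {φ : ℝ → ℂ} (hf : f =ᵐ[halfLine] φ) :
    ⇑(f - opA ν f) =ᵐ[halfLine] fun t => φ t - kernelOp (kerA ν) φ t := by
  filter_upwards [Lp.coeFn_sub f (opA ν f), opA_ae ν f, hf] with t h1 h2 h3
  rw [h1, Pi.sub_apply, h2, h3, kernelOp_congr hf]

theorem coe_sub_opB (ν : ℂ) {f : L2} {φ : ℝ → ℂ} (hf : f =ᵐ[halfLine] φ) :
    ⇑(f - opB ν f) =ᵐ[halfLine] fun t => φ t - kernelOp (fun x t => kerA ν t x) φ t := by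
  filter_upwards [Lp.coeFn_sub f (opB ν f), opB_ae ν f, hf] with t h1 h2 h3
  rw [h1, Pi.sub_apply, h2, h3, kernelOp_congr hf]

/-- Because 1 + C inverts 1 - A, the images (1 - A)φ, rather than the test functions themselves, are
the convenient elements of the domain. They still vanish near 0, which secures all convergence. -/
theorem sZeroPlus_of_mem_testSubmodule (ν : ℂ) {f : L2} (hf : f ∈ testSubmodule) :
    SZeroPlus ν (f - opA ν f) f := by
  obtain ⟨φ, hφ, hfφ⟩ := hf
  obtain ⟨a, b, ha, -, hab⟩ := hφ.exists_Ioo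
  set f₀ : ℝ → ℂ := fun t => φ t - kernelOp (kerA ν) φ t with hf₀
  have hf₀L : MemLp f₀ 2 halfLine := hφ.memLp.sub ((isHardyKernel_kerA ν).memLp_kernelOp hφ.memLp)
  have h0 : ∀ t ≤ a, f₀ t = 0 := fun t ht => by
    simp only [hf₀]
    rw [eq_zero_of_notMem_Ioo hab fun h => not_lt.2 ht h.1, kernelOp_kerA_eq_zero ν hab ht, sub_zero]
  have hint : ∀ x : ℝ, 0 < x →
      IntegrableOn (fun t : ℝ => legendreP ν (x / t) * f₀ t) (Ioo 0 x) :=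
    fun x hx => integrableOn_mul_of_eq_zero ((continuousOn_legendreP ν).comp
      (continuousOn_const.div continuousOn_id fun t ht => (ha.trans_le ht.1).ne')
      fun t ht => div_pos hx (ha.trans_le ht.1)) hf₀L h0
  have hprod : ∀ y : ℝ, 0 < y → Integrable (fun q : ℝ × ℝ =>
      (Ioo 0 y).indicator 1 q.1 * (kerC ν q.1 q.2 * f₀ q.2)) (halfLine.prod halfLine) := by
    intro y hy
    have hcont : ContinuousOn (legendreP' ν) (Icc 1 (y / a)) :=
      (continuousOn_legendreP' ν).mono fun z hz => lt_of_lt_of_le one_pos hz.1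
    obtain ⟨K, hK⟩ := isCompact_Icc.exists_bound_of_continuousOn hcont
    -- Where f₀ is nonzero, t > a: there 1/t is at most 1/a, and the ratio s/t stays in [1, y/a], on
    -- which p is bounded by K.
    refine integrable_indicator_mul_kerC ν hf₀L.1 (w := fun t => |K| / a * ‖f₀ t‖)
      ((integrableOn_interval_of_memLp hf₀L y).norm.const_mul _) (fun t => by positivity) ?_
    intro t s ht hts hsy
    by_cases hta : a < t
    · rw [norm_mul]
      gcongr
      rw [kerC, if_pos ⟨ht, hts⟩, norm_div, Complex.norm_real, Real.norm_eq_abs, abs_of_pos ht]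
      have : ‖legendreP' ν (s / t)‖ ≤ |K| := by
        refine (hK _ ⟨(one_le_div ht).2 hts.le, ?_⟩).trans (le_abs_self K)
        gcongr
      gcongr
    · rw [h0 t (not_lt.1 hta)]
      simp
  refine sZeroPlus_of_ae (coe_sub_opA ν hfφ) hint ?_
  filter_upwards [(hasLocACDeriv_sZeroPlus ν hf₀L hint hprod).ae_hasDerivAt, hfφ, ae_halfLine_pos]
    with x h1 h2 hx
  rw [h2, ← one_add_kerC_one_sub_kerA ν hφ ha hab hx]
  exact h1

end BuschmanErdelyi

namespace BuschmanErdelyi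
open Filter Topology ENNReal
open scoped ContDiff

/-! ### The operators with an internal derivative -/

theorem continuousOn_legendreP_div (ν : ℂ) {x a b : ℝ} (hx : 0 < x) (ha : 0 < a) :
    ContinuousOn (fun t => legendreP ν (t / x)) (Icc a b) :=
  (continuousOn_legendreP ν).comp (continuousOn_id.div_const x)
    fun _ ht => div_pos (ha.trans_le ht.1) hx

theorem HasLocACDeriv.integral_legendreP_mul {f h : ℝ → ℂ} (hfh : HasLocACDeriv f h) (ν : ℂ)
    {x a b : ℝ} (hx : 0 < x) (ha : 0 < a) (hab : a ≤ b) :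
    ∫ t in a..b, legendreP ν (t / x) * h t = legendreP ν (b / x) * f b - legendreP ν (a / x) * f a
      - ∫ t in a..b, legendreP' ν (t / x) / x * f t :=
  integral_mul_eq_sub_of_primitive hab
    (fun _ ht => hasDerivAt_legendreP_div ν (ha.trans_le ht.1) hx)
    (continuousOn_legendreP'_div ν hx ha) (hfh a b ha (ha.trans_le hab)).1
    fun t ht => (hfh a t ha (ha.trans_le ht.1)).2

theorem kernelOp_kerA_eq (ν : ℂ) {x : ℝ} (hx : 0 < x) (f : ℝ → ℂ) :
    kernelOp (kerA ν) f x = ∫ t in (0 : ℝ)..x, legendreP' ν (t / x) / x * f t := by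
  rw [← integral_halfLine_ite le_rfl hx.le, kernelOp]
  refine integral_congr_ae (Eventually.of_forall fun t => ?_)
  simp only [kerA]
  split_ifs <;> simp

theorem hasLocACDeriv_of_hasDerivAt {F q : ℝ → ℂ} (h : ∀ x, 0 < x → HasDerivAt F (q x) x)
    (hq : ContinuousOn q (Ioi 0)) : HasLocACDeriv F q := by
  intro a b ha hb
  have hsub : uIcc a b ⊆ Ioi 0 := fun t ht => lt_of_lt_of_le (lt_min ha hb) ht.1
  have hi : IntervalIntegrable q volume a b := (hq.mono hsub).intervalIntegrable
  exact ⟨hi, (intervalIntegral.integral_eq_sub_of_hasDerivAt (fun t ht => h t (hsub ht)) hi).symm⟩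

theorem pZeroPlus_of_mem_testSubmodule (ν : ℂ) {f : L2} (hf : f ∈ testSubmodule) :
    PZeroPlus ν f (f - opA ν f) := by
  obtain ⟨φ, hφ, hfφ⟩ := hf
  obtain ⟨a, b, ha, -, hab⟩ := hφ.exists_Ioo
  have hab' : tsupport (deriv φ) ⊆ Ioo a b := (tsupport_deriv_subset (𝕜 := ℝ) (f := φ)).trans hab
  have h0 : ∀ t ≤ a, φ t = 0 := fun t ht => eq_zero_of_notMem_Ioo hab fun h => not_lt.2 ht h.1
  have h0' : ∀ t ≤ a, deriv φ t = 0 := fun t ht =>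
    eq_zero_of_notMem_Ioo hab' fun h => not_lt.2 ht h.1
  have hac : HasLocACDeriv φ (deriv φ) := hasLocACDeriv_of_hasDerivAt (fun x _ => hφ.hasDerivAt x)
    hφ.deriv.smooth.continuous.continuousOn
  have hint : ∀ x : ℝ, 0 < x →
      IntegrableOn (fun t : ℝ => legendreP ν (t / x) * deriv φ t) (Ioo 0 x) := fun x hx =>
    integrableOn_mul_of_eq_zero (continuousOn_legendreP_div ν hx ha) hφ.deriv.memLp h0'
  refine ⟨φ, deriv φ, hfφ, hac, hint, ?_⟩
  filter_upwards [coe_sub_opA ν hfφ, ae_halfLine_pos] with x h1 hx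
  rw [h1]
  -- Integration by parts starts at min(a, x), where φ vanishes, so the origin is never touched and
  -- the case x < a is included.
  have hε : 0 < min a x := lt_min ha hx
  have hεx : min a x ≤ x := min_le_right _ _
  have hεa : min a x ≤ a := min_le_left _ _
  have hsplit : ∀ F : ℝ → ℂ, IntegrableOn F (Ioo 0 x) → (∀ t ≤ a, F t = 0) →
      ∫ t in Ioo 0 x, F t = ∫ t in (min a x)..x, F t := by
    intro F hF hF0
    have hi : IntervalIntegrable F volume 0 x :=
      (intervalIntegrable_iff_integrableOn_Ioo_of_le hx.le).2 hF
    rw [← integral_Ioc_eq_integral_Ioo, ← intervalIntegral.integral_of_le hx.le,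
      ← intervalIntegral.integral_add_adjacent_intervals (b := min a x)
        (hi.mono_set (by rw [uIcc_of_le hε.le, uIcc_of_le hx.le]; exact Icc_subset_Icc_right hεx))
        (hi.mono_set (by rw [uIcc_of_le hεx, uIcc_of_le hx.le]; exact Icc_subset_Icc_left hε.le))]
    have : ∫ t in (0 : ℝ)..(min a x), F t = 0 := by
      refine intervalIntegral.integral_zero_ae (Eventually.of_forall fun t ht => hF0 t ?_)
      rw [uIoc_of_le hε.le] at ht
      exact ht.2.trans hεa
    rw [this, zero_add]
  have hA : IntegrableOn (fun t => legendreP' ν (t / x) / x * φ t) (Ioo 0 x) :=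
    integrableOn_mul_of_eq_zero (continuousOn_legendreP'_div ν hx ha) hφ.memLp h0
  rw [hsplit _ (hint x hx) (fun t ht => by rw [h0' t ht, mul_zero]),
    hac.integral_legendreP_mul ν hx hε hεx, kernelOp_kerA_eq ν hx,
    intervalIntegral.integral_of_le hx.le, integral_Ioc_eq_integral_Ioo,
    hsplit _ hA (fun t ht => by rw [h0 t ht, mul_zero]), div_self hx.ne', legendreP_one,
    h0 _ hεa]
  ring

/-- The substitution t = xτ moves x into the argument of f alone, so that Bf can be differentiated
under the integral. -/
theorem kernelOp_kerB_eq (ν : ℂ) {x : ℝ} (hx : 0 < x) (f : ℝ → ℂ) :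
    kernelOp (fun x t => kerA ν t x) f x
      = ∫ τ in Ioi (1 : ℝ), legendreP' ν (1 / τ) / τ * f (x * τ) := by
  have hxc : (x : ℂ) ≠ 0 := by exact_mod_cast hx.ne'
  have h1 : kernelOp (fun x t => kerA ν t x) f x
      = ∫ t in Ioi x, legendreP' ν (x / t) / t * f t := by
    have hres : Measure.restrict halfLine (Ioi x) = volume.restrict (Ioi x) := by
      rw [Measure.restrict_restrict measurableSet_Ioi,
        inter_eq_left.2 (show Ioi x ⊆ Ioi 0 from Ioi_subset_Ioi hx.le)]
    rw [← hres, ← integral_indicator (measurableSet_Ioi (a := x)), kernelOp]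
    refine integral_congr_ae (Eventually.of_forall fun t => ?_)
    by_cases h : x < t <;> simp [kerA, indicator, h, hx]
  have h2 := integral_comp_mul_left_Ioi (fun t => legendreP' ν (x / t) / t * f t) 1 hx
  rw [mul_one] at h2
  rw [h1]
  have h3 : ∫ t in Ioi x, legendreP' ν (x / t) / t * f t
      = (x : ℂ) * ∫ τ in Ioi (1 : ℝ), legendreP' ν (x / (x * τ)) / ((x * τ : ℝ) : ℂ) * f (x * τ) := by
    rw [h2, Complex.real_smul]
    push_cast
    field_simp
  rw [h3, ← integral_const_mul]
  refine setIntegral_congr_fun measurableSet_Ioi fun τ hτ => ?_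
  have hτ0 : (0 : ℝ) < τ := one_pos.trans hτ
  have hτc : (τ : ℂ) ≠ 0 := by exact_mod_cast hτ0.ne'
  have e : x / (x * τ) = 1 / τ := by field_simp
  rw [e]
  push_cast
  field_simp

/-- The kernel is homogeneous of degree -1, so B commutes with the Euler operator t d/dt; division
by x gives the derivative. -/
theorem hasDerivAt_kernelOp_kerB (ν : ℂ) {φ : ℝ → ℂ} (hφ : IsTest φ) {x : ℝ} (hx : 0 < x) :
    HasDerivAt (kernelOp (fun x t => kerA ν t x) φ)
      (kernelOp (fun x t => kerA ν t x) (fun t => (t : ℂ) * deriv φ t) x / x) x := by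
  obtain ⟨a, b, ha, hab0, hab⟩ := hφ.exists_Ioo
  have hab' : tsupport (deriv φ) ⊆ Ioo a b := (tsupport_deriv_subset (𝕜 := ℝ) (f := φ)).trans hab
  obtain ⟨S, hS⟩ := hφ.compact.exists_bound_of_continuous hφ.smooth.continuous
  obtain ⟨S', hS'⟩ := hφ.deriv.compact.exists_bound_of_continuous hφ.deriv.smooth.continuous
  have hS0 : 0 ≤ S := (norm_nonneg _).trans (hS 0)
  have hS'0 : 0 ≤ S' := (norm_nonneg _).trans (hS' 0)
  have hxc : (x : ℂ) ≠ 0 := by exact_mod_cast hx.ne'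
  -- For y > x/2 and τ ≥ T one has yτ ≥ b, so all integrands near x vanish beyond T.
  set T : ℝ := 2 * b / x with hT
  have hM := boundP'_nonneg ν
  have hpc : ContinuousOn (fun τ : ℝ => legendreP' ν (1 / τ)) (Ioi 1) :=
    (continuousOn_legendreP' ν).comp (continuousOn_const.div continuousOn_id
      fun τ hτ => (one_pos.trans hτ).ne') fun τ hτ => mem_Ioi.2 (div_pos one_pos (one_pos.trans hτ))
  have hpb : ∀ τ ∈ Ioi (1 : ℝ), ‖legendreP' ν (1 / τ)‖ ≤ boundP' ν := fun τ hτ =>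
    norm_legendreP'_le ν (div_pos one_pos (one_pos.trans hτ))
      ((div_le_one (one_pos.trans hτ)).2 (le_of_lt hτ))
  have hvan : ∀ {ψ : ℝ → ℂ}, tsupport ψ ⊆ Ioo a b → ∀ y ∈ Ioo (x / 2) (2 * x), ∀ τ, T ≤ τ →
      ψ (y * τ) = 0 := by
    intro ψ hψ y hy τ hτ
    refine eq_zero_of_notMem_Ioo hψ fun h => not_lt.2 ?_ h.2
    have h1 : b = x / 2 * T := by rw [hT]; field_simp
    have hT0 : 0 < T := by rw [hT]; have := ha.trans hab0; positivity
    rw [h1]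
    exact mul_le_mul hy.1.le hτ hT0.le (by linarith [hy.1])
  have hmem : Ioo (x / 2) (2 * x) ∈ 𝓝 x := Ioo_mem_nhds (by linarith) (by linarith)
  have hxmem : x ∈ Ioo (x / 2) (2 * x) := ⟨by linarith, by linarith⟩
  have hdom : ∀ c : ℝ, Integrable ((Ioo 1 T).indicator fun _ => c) (volume.restrict (Ioi (1 : ℝ))) := by
    intro c
    refine (IntegrableOn.integrable_indicator ?_ measurableSet_Ioo).mono_measure
      Measure.restrict_le_self
    simp
  have hFm : ∀ y : ℝ, AEStronglyMeasurable (fun τ : ℝ => legendreP' ν (1 / τ) / τ * φ (y * τ))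
      (volume.restrict (Ioi (1 : ℝ))) := fun y =>
    ContinuousOn.aestronglyMeasurable ((hpc.div Complex.continuous_ofReal.continuousOn
      fun τ hτ => by exact_mod_cast (one_pos.trans hτ).ne').mul
      (hφ.smooth.continuous.comp (continuous_const.mul continuous_id)).continuousOn)
      measurableSet_Ioi
  have hF'm : AEStronglyMeasurable (fun τ : ℝ => legendreP' ν (1 / τ) * deriv φ (x * τ))
      (volume.restrict (Ioi (1 : ℝ))) :=
    ContinuousOn.aestronglyMeasurable (hpc.mul
      (hφ.deriv.smooth.continuous.comp (continuous_const.mul continuous_id)).continuousOn)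
      measurableSet_Ioi
  have main := hasDerivAt_integral_of_dominated_loc_of_deriv_le (μ := volume.restrict (Ioi (1 : ℝ)))
    (F := fun y τ => legendreP' ν (1 / τ) / τ * φ (y * τ))
    (F' := fun y τ => legendreP' ν (1 / τ) * deriv φ (y * τ))
    (bound := (Ioo 1 T).indicator fun _ => boundP' ν * S') hmem
    (Eventually.of_forall hFm) ?_ hF'm ?_ (hdom _) ?_
  · have heq : kernelOp (fun x t => kerA ν t x) φ =ᶠ[𝓝 x]
        fun y => ∫ τ in Ioi (1 : ℝ), legendreP' ν (1 / τ) / τ * φ (y * τ) :=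
      eventuallyEq_of_mem (Ioi_mem_nhds hx) fun y hy => kernelOp_kerB_eq ν hy φ
    refine (main.2.congr_of_eventuallyEq heq).congr_deriv ?_
    rw [kernelOp_kerB_eq ν hx, eq_div_iff hxc, ← integral_mul_const]
    refine setIntegral_congr_fun measurableSet_Ioi fun τ hτ => ?_
    have hτ0 : (0 : ℝ) < τ := one_pos.trans hτ
    have hτc : (τ : ℂ) ≠ 0 := by exact_mod_cast hτ0.ne'
    push_cast
    field_simp
  · refine (hdom (boundP' ν * S)).mono' (hFm x) ?_
    filter_upwards [ae_restrict_mem measurableSet_Ioi] with τ hτ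
    by_cases h : τ < T
    · have hτ1 : (1 : ℝ) < τ := hτ
      rw [indicator_of_mem (show τ ∈ Ioo 1 T from ⟨hτ, h⟩), norm_mul, norm_div, Complex.norm_real,
        Real.norm_eq_abs, abs_of_pos (one_pos.trans hτ1)]
      have : ‖legendreP' ν (1 / τ)‖ / τ ≤ boundP' ν :=
        (div_le_self (norm_nonneg _) hτ1.le).trans (hpb τ hτ)
      gcongr
      exact hS _
    · rw [hvan hab x hxmem τ (not_lt.1 h), mul_zero, norm_zero]
      exact indicator_nonneg (fun _ _ => by positivity) _
  · filter_upwards [ae_restrict_mem measurableSet_Ioi] with τ hτ y hy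
    by_cases h : τ < T
    · rw [indicator_of_mem (show τ ∈ Ioo 1 T from ⟨hτ, h⟩), norm_mul]
      gcongr
      · exact hpb τ hτ
      · exact hS' _
    · rw [hvan hab' y hy τ (not_lt.1 h), mul_zero, norm_zero]
      exact indicator_nonneg (fun _ _ => by positivity) _
  · filter_upwards [ae_restrict_mem measurableSet_Ioi] with τ hτ y hy
    have hτ0 : (0 : ℝ) < τ := one_pos.trans hτ
    have hτc : (τ : ℂ) ≠ 0 := by exact_mod_cast hτ0.ne'
    have hd : HasDerivAt (fun y : ℝ => y * τ) τ y := by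
      simpa using (hasDerivAt_id' y).mul_const τ
    have := ((hφ.hasDerivAt (y * τ)).scomp y hd).const_mul (legendreP' ν (1 / τ) / τ)
    refine this.congr_deriv ?_
    rw [Complex.real_smul]
    field_simp

/-- The derivative of `(1 - B) φ`. -/
theorem hasLocACDeriv_one_sub_kerB (ν : ℂ) {φ : ℝ → ℂ} (hφ : IsTest φ) :
    HasLocACDeriv (fun x => φ x - kernelOp (fun x t => kerA ν t x) φ x)
      (fun x => deriv φ x
        - kernelOp (fun x t => kerA ν t x) (fun t => (t : ℂ) * deriv φ t) x / x) := by
  refine hasLocACDeriv_of_hasDerivAt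
    (fun x hx => (hφ.hasDerivAt x).sub (hasDerivAt_kernelOp_kerB ν hφ hx)) ?_
  refine hφ.deriv.smooth.continuous.continuousOn.sub (ContinuousOn.div (fun x hx => ?_)
    Complex.continuous_ofReal.continuousOn fun x hx => by exact_mod_cast (ne_of_gt hx))
  exact (hasDerivAt_kernelOp_kerB ν hφ.deriv.ofReal_mul hx).continuousAt.continuousWithinAt

/-- The function (1 - B)φ vanishes beyond b, so integration by parts has no boundary term at
infinity and yields (1 + D)(1 - B)φ = φ. -/
theorem pMinus_of_mem_testSubmodule (ν : ℂ) {f : L2} (hf : f ∈ testSubmodule) :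
    PMinus ν (f - opB ν f) f := by
  obtain ⟨φ, hφ, hfφ⟩ := hf
  obtain ⟨a, b, ha, hab0, hab⟩ := hφ.exists_Ioo
  set f₀ : ℝ → ℂ := fun x => φ x - kernelOp (fun x t => kerA ν t x) φ x with hf₀
  set h : ℝ → ℂ := fun x => deriv φ x
        - kernelOp (fun x t => kerA ν t x) (fun t => (t : ℂ) * deriv φ t) x / x with hh
  have hab' : tsupport (deriv φ) ⊆ Ioo a b := (tsupport_deriv_subset (𝕜 := ℝ) (f := φ)).trans hab
  have hθ : tsupport (fun t : ℝ => (t : ℂ) * deriv φ t) ⊆ Ioo a b :=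
    (tsupport_mul_subset_right (f := fun t : ℝ => (t : ℂ)) (g := deriv φ)).trans hab'
  have hac : HasLocACDeriv f₀ h := hasLocACDeriv_one_sub_kerB ν hφ
  have hf0 : ∀ t, b ≤ t → f₀ t = 0 := fun t ht => by
    simp only [hf₀]
    rw [eq_zero_of_notMem_Ioo hab fun h => not_lt.2 ht h.2, kernelOp_kerB_eq_zero ν hab ht, sub_zero]
  have hh0 : ∀ t, b ≤ t → h t = 0 := fun t ht => by
    simp only [hh]
    rw [eq_zero_of_notMem_Ioo hab' fun h => not_lt.2 ht h.2, kernelOp_kerB_eq_zero ν hθ ht, zero_div,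
      sub_zero]
  -- The upper limit max(x, b) treats x < b and x ≥ b together; in the second case both sides are
  -- zero.
  have hsplit : ∀ F : ℝ → ℂ, (∀ t, b ≤ t → F t = 0) → ∀ x : ℝ,
      ∫ t in Ioi x, F t = ∫ t in x..(max x b), F t := by
    intro F hF x
    rw [intervalIntegral.integral_of_le (le_max_left _ _)]
    refine (setIntegral_eq_of_subset_of_forall_sdiff_eq_zero measurableSet_Ioi
      Ioc_subset_Ioi_self fun t ht => hF t ?_)
    exact (le_max_right x b).trans (le_of_lt (not_le.1 fun h => ht.2 ⟨ht.1, h⟩))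
  have hint : ∀ x : ℝ, 0 < x →
      IntegrableOn (fun t : ℝ => legendreP ν (t / x) * -h t) (Ioi x) := by
    intro x hx
    have hxm := le_max_left x b
    rw [← Ioc_union_Ioi_eq_Ioi hxm]
    refine IntegrableOn.union ?_ ?_
    · refine (intervalIntegrable_iff_integrableOn_Ioc_of_le hxm).1 ?_
      refine (hac x (max x b) hx (hx.trans_le hxm)).1.neg.continuousOn_mul ?_
      rw [uIcc_of_le hxm]
      exact continuousOn_legendreP_div ν hx hx
    · refine IntegrableOn.congr_fun (f := fun _ => 0) integrableOn_zero (fun t ht => ?_)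
        measurableSet_Ioi
      simp [hh0 t ((le_max_right x b).trans (le_of_lt ht))]
  refine ⟨f₀, h, coe_sub_opB ν hfφ, hac, hint, ?_⟩
  filter_upwards [hfφ, ae_halfLine_pos] with x h1 hx
  have hxm := le_max_left x b
  have hD : kernelOp (fun x t => kerC ν t x) f₀ x
      = ∫ t in x..(max x b), legendreP' ν (t / x) / x * f₀ t := by
    rw [← integral_halfLine_ite hx.le hxm, kernelOp]
    refine integral_congr_ae ?_
    filter_upwards [ae_ne (max x b)] with t ht
    by_cases h1 : x < t <;> by_cases h2 : t < max x b
    · simp only [kerC]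
      rw [if_pos ⟨hx, h1⟩, if_pos ⟨h1, h2⟩]
    · rw [hf0 t ((le_max_right x b).trans (not_lt.1 h2)), if_neg (fun h => h2 h.2), mul_zero]
    all_goals simp [kerC, h1]
  have hval := hac.integral_legendreP_mul ν hx hx hxm
  rw [div_self hx.ne', legendreP_one, hf0 _ (le_max_right x b)] at hval
  rw [hsplit _ (fun t ht => by rw [hh0 t ht, neg_zero, mul_zero]) x]
  simp only [mul_neg]
  rw [intervalIntegral.integral_neg, hval, ← hD, h1, ← one_add_kerD_one_sub_kerB ν hφ hab hx]
  ring

end BuschmanErdelyi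

namespace BuschmanErdelyi
open Filter Topology ENNReal

/-! ### Integral degree: the operators on `(0, x)` -/

theorem monotoneOn_legendrePoly' (n : ℕ) : MonotoneOn (legendrePoly' n) (Ici 1) := by
  intro z hz w hw hzw
  have hz : 1 ≤ z := hz
  rw [legendrePoly'_eq_sum, legendrePoly'_eq_sum]
  have h0 : 0 ≤ (z - 1) / 2 := by linarith
  gcongr with k
  exact mul_nonneg (legendreCoeff_nonneg _ _) (by positivity)

/-- On [z, 2z] the derivative is at least its value at z, and P(z) ≥ 1. The growth of p is thus
controlled by P at twice the argument, which the domain condition of S_{0+} can absorb. -/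
theorem mul_legendrePoly'_le (n : ℕ) {z : ℝ} (hz : 1 ≤ z) :
    z * legendrePoly' n z ≤ legendrePoly n (2 * z) := by
  have h := (convex_Ici z).mul_sub_le_image_sub_of_le_deriv
    (continuous_legendrePoly n).continuousOn
    (fun w _ => (hasDerivAt_legendrePoly n w).differentiableAt.differentiableWithinAt)
    (C := legendrePoly' n z) (fun w hw => by
      rw [interior_Ici] at hw
      rw [(hasDerivAt_legendrePoly n w).deriv]
      exact monotoneOn_legendrePoly' n hz (hz.trans (le_of_lt hw)) (le_of_lt hw))
    z self_mem_Ici (2 * z) (mem_Ici.2 (by linarith)) (by linarith)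
  have := one_le_legendrePoly n hz
  linarith

section Integral

variable {ν : ℂ} {n : ℕ}

theorem norm_legendreP_eq (hν : ν * (ν + 1) = n * (n + 1)) {z : ℝ} (hz : 1 ≤ z) :
    ‖legendreP ν z‖ = legendrePoly n z := by
  rw [legendreP_eq_legendrePoly hν (one_pos.trans_le hz), Complex.norm_real, Real.norm_eq_abs,
    abs_of_nonneg (zero_le_one.trans (one_le_legendrePoly n hz))]

theorem norm_legendreP'_eq (hν : ν * (ν + 1) = n * (n + 1)) {z : ℝ} (hz : 1 ≤ z) :
    ‖legendreP' ν z‖ = legendrePoly' n z := by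
  rw [legendreP'_eq_legendrePoly' hν (one_pos.trans_le hz), Complex.norm_real, Real.norm_eq_abs,
    abs_of_nonneg (legendrePoly'_nonneg n hz)]

theorem norm_kerC_le (hν : ν * (ν + 1) = n * (n + 1)) {t s y : ℝ} (ht : 0 < t) (hts : t < s)
    (hsy : s ≤ y) : ‖kerC ν s t‖ ≤ y⁻¹ * ‖legendreP ν (2 * y / t)‖ := by
  have hy : 0 < y := ht.trans (hts.trans_le hsy)
  have h1 : 1 ≤ s / t := (one_le_div ht).2 hts.le
  have h2 : s / t ≤ y / t := by gcongr
  have h3 : (1 : ℝ) ≤ y / t := h1.trans h2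
  rw [kerC, if_pos ⟨ht, hts⟩, norm_div, norm_legendreP'_eq hν h1, Complex.norm_real,
    Real.norm_eq_abs, abs_of_pos ht, mul_div_assoc 2 y t, norm_legendreP_eq hν (by linarith)]
  calc legendrePoly' n (s / t) / t ≤ legendrePoly' n (y / t) / t := by
        gcongr
        exact monotoneOn_legendrePoly' n h1 h3 h2
    _ = y⁻¹ * (y / t * legendrePoly' n (y / t)) := by field_simp
    _ ≤ y⁻¹ * legendrePoly n (2 * (y / t)) := by
        gcongr
        exact mul_legendrePoly'_le n h3

/-- The domain condition dominates C applied to f, so g = f + Cf. Applying A and using AC = C - A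
gives Ag = g - f. -/
theorem sZeroPlus_imp (hν : ν * (ν + 1) = n * (n + 1)) {f g : L2} (h : SZeroPlus ν f g) :
    f = g - opA ν g := by
  obtain ⟨hint, hd⟩ := h
  -- Absolute convergence is used at 2y, to match the doubled argument in `norm_kerC_le`.
  have hw : ∀ y : ℝ, 0 < y →
      IntegrableOn (fun t => y⁻¹ * ‖legendreP ν (2 * y / t) * f t‖) (Ioo 0 y) := fun y hy =>
    IntegrableOn.mono_set (((hint (2 * y) (by linarith)).norm.const_mul _))
      (Ioo_subset_Ioo_right (by linarith))
  have hle : ∀ t s y : ℝ, 0 < t → t < s → s ≤ y →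
      ‖kerC ν s t * f t‖ ≤ y⁻¹ * ‖legendreP ν (2 * y / t) * f t‖ := fun t s y ht hts hsy => by
    rw [norm_mul, norm_mul, ← mul_assoc]
    gcongr
    exact norm_kerC_le hν ht hts hsy
  have hprod : ∀ y : ℝ, 0 < y → Integrable (fun q : ℝ × ℝ =>
      (Ioo 0 y).indicator 1 q.1 * (kerC ν q.1 q.2 * f q.2)) (halfLine.prod halfLine) :=
    fun y hy => integrable_indicator_mul_kerC ν (Lp.memLp f).1 (hw y hy)
      (fun t => mul_nonneg (inv_nonneg.2 hy.le) (norm_nonneg _))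
      fun t s ht hts hsy => hle t s y ht hts hsy.le
  have hC : (g - f : L2) =ᵐ[halfLine] kernelOp (kerC ν) f := by
    filter_upwards [(hasLocACDeriv_sZeroPlus ν (Lp.memLp f) hint hprod).ae_hasDerivAt, hd,
      Lp.coeFn_sub g f] with x h1 h2 h3
    rw [h3, Pi.sub_apply, h2.unique h1]
    ring
  have hA : opA ν (g - f) = (g - f) - opA ν f := by
    refine Lp.ext ?_
    filter_upwards [opA_ae ν (g - f), opA_ae ν f, Lp.coeFn_sub (g - f) (opA ν f), hC,
      ae_halfLine_pos] with x h1 h2 h3 h4 hx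
    rw [h1, h3, Pi.sub_apply, h2, h4, kernelOp_congr hC]
    have hi : Integrable (fun t => kerC ν x t * f t) halfLine := by
      refine Integrable.mono' (((hw x hx).integrable_indicator measurableSet_Ioo).mono_measure
        Measure.restrict_le_self)
        (((measurable_kerC_left ν x).aestronglyMeasurable).mul (Lp.memLp f).1) ?_
      filter_upwards [ae_halfLine_pos] with t ht
      by_cases htx : t < x
      · rw [indicator_of_mem (show t ∈ Ioo 0 x from ⟨ht, htx⟩)]
        exact hle t x x ht htx le_rfl
      · rw [kerC, if_neg (by tauto), zero_mul, norm_zero]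
        exact indicator_nonneg (fun t _ => mul_nonneg (inv_nonneg.2 hx.le) (norm_nonneg _)) _
    rw [kernelOp_kernelOp, kernelOp, kernelOp,
      ← integral_sub hi ((isHardyKernel_kerA ν).integrable_mul (Lp.memLp f) hx)]
    · refine integral_congr_ae ?_
      filter_upwards [ae_halfLine_pos] with s hs
      rw [integral_kerA_mul_kerC ν hx hs, sub_mul]
    -- The row of A at x is bounded by `boundP' ν / x` and supported in (0, x), so it may multiply
    -- an integrand already known to be integrable there.
    · refine ((hprod x hx).bdd_mul (f := fun q : ℝ × ℝ => kerA ν x q.1) (c := boundP' ν / x)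
        ?_ (Eventually.of_forall fun q => norm_kerA_le ν hx)).congr
        (Eventually.of_forall fun q => ?_)
      · exact (((measurable_kerA ν).comp (measurable_const.prodMk measurable_id)).comp
          measurable_fst).aestronglyMeasurable
      · by_cases hq : q.1 ∈ Ioo 0 x
        · simp only [indicator_of_mem hq, Pi.one_apply, one_mul]
        · have : kerA ν x q.1 = 0 := if_neg hq
          simp only [this, zero_mul]
  have e : opA ν g = g - f := by
    have h1 := hA
    rw [map_sub] at h1
    exact sub_left_injective h1
  rw [e, _root_.sub_sub_cancel]

theorem tendsto_integral_left {F : ℝ → ℂ} {x : ℝ} (hx : 0 < x) (hF : IntegrableOn F (Ioo 0 x)) :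
    Tendsto (fun ε => ∫ t in ε..x, F t) (𝓝[>] 0) (𝓝 (∫ t in Ioo 0 x, F t)) := by
  have hi : IntervalIntegrable F volume 0 x :=
    (intervalIntegrable_iff_integrableOn_Ioo_of_le hx.le).2 hF
  have hc := (intervalIntegral.continuousOn_primitive_interval' hi right_mem_uIcc).neg
    0 left_mem_uIcc
  rw [← integral_Ioc_eq_integral_Ioo, ← intervalIntegral.integral_of_le hx.le]
  have h1 : 𝓝[>] (0 : ℝ) ≤ 𝓝[uIcc 0 x] 0 := nhdsWithin_le_of_mem (by
    rw [uIcc_of_le hx.le]; exact Icc_mem_nhdsGT hx)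
  have := (hc.tendsto).mono_left h1
  rw [Pi.neg_apply, ← intervalIntegral.integral_symm] at this
  refine this.congr fun ε => ?_
  rw [Pi.neg_apply, intervalIntegral.integral_symm x ε]

theorem exists_legendrePoly_eq_pow_mul (n : ℕ) : ∃ (j : ℕ) (R : ℝ → ℝ), Continuous R ∧ R 0 ≠ 0 ∧
    ∀ z, legendrePoly n z = z ^ j * R z := by
  set Q : Polynomial ℝ := (shiftedPoly n).comp (Polynomial.C (1 / 2) * (Polynomial.X - 1)) with hQ
  have hQe : ∀ z, legendrePoly n z = Q.eval z := fun z => by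
    rw [legendrePoly, hQ, Polynomial.eval_comp]
    congr 1
    simp
    ring
  have hQ0 : Q ≠ 0 := fun h => by
    have := hQe 1
    rw [legendrePoly_one, h, Polynomial.eval_zero] at this
    exact one_ne_zero this
  obtain ⟨R, hR, hR0⟩ := Q.exists_eq_pow_rootMultiplicity_mul_and_not_dvd hQ0 0
  refine ⟨Q.rootMultiplicity 0, fun z => R.eval z, R.continuous, fun h => hR0 ?_, fun z => ?_⟩
  · exact Polynomial.dvd_iff_isRoot.2 h
  · rw [hQe]
    conv_lhs => rw [hR]
    simp

/-- Integration by parts from ε to x leaves the boundary term P(ε/x) f(ε). Its limit ℓ(x) exists,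
scales like a power of x because P does near 0, and lies in L₂; together these force it to vanish.
-/
theorem pZeroPlus_imp (hν : ν * (ν + 1) = n * (n + 1)) {f g : L2} (h : PZeroPlus ν f g) :
    g = f - opA ν f := by
  obtain ⟨f₀, h, hff, hac, hint, hg⟩ := h
  have hf₀ : MemLp f₀ 2 halfLine := (memLp_congr_ae hff).1 (Lp.memLp f)
  set ℓ : ℝ → ℂ := fun x => f₀ x - kernelOp (kerA ν) f₀ x
    - ∫ t in Ioo 0 x, legendreP ν (t / x) * h t with hℓ
  have hℓg : (f - opA ν f - g : L2) =ᵐ[halfLine] ℓ := by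
    filter_upwards [Lp.coeFn_sub (f - opA ν f) g, coe_sub_opA ν hff, hg] with x h1 h2 h3
    rw [h1, Pi.sub_apply, h2, h3]
  have hlim : ∀ x : ℝ, 0 < x →
      Tendsto (fun ε => legendreP ν (ε / x) * f₀ ε) (𝓝[>] 0) (𝓝 (ℓ x)) := by
    intro x hx
    have hAi : IntegrableOn (fun t => legendreP' ν (t / x) / x * f₀ t) (Ioo 0 x) := by
      have := ((isHardyKernel_kerA ν).integrable_mul hf₀ hx).mono_measure
        (Measure.restrict_mono (show Ioo 0 x ⊆ Ioi 0 from Ioo_subset_Ioi_self) le_rfl)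
      refine this.congr ?_
      filter_upwards [ae_restrict_mem measurableSet_Ioo] with t ht
      rw [kerA, if_pos ⟨ht.1, ht.2⟩]
    have h1 := (tendsto_const_nhds (x := f₀ x)).sub
      ((tendsto_integral_left hx hAi).add (tendsto_integral_left hx (hint x hx)))
    have h2 : f₀ x - ((∫ t in Ioo 0 x, legendreP' ν (t / x) / x * f₀ t)
        + ∫ t in Ioo 0 x, legendreP ν (t / x) * h t) = ℓ x := by
      rw [hℓ]
      simp only
      rw [kernelOp_kerA_eq ν hx, intervalIntegral.integral_of_le hx.le,
        integral_Ioc_eq_integral_Ioo]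
      ring
    rw [h2] at h1
    refine h1.congr' ?_
    filter_upwards [Ioc_mem_nhdsGT hx] with ε hε
    rw [hac.integral_legendreP_mul ν hx hε.1 hε.2, div_self hx.ne', legendreP_one]
    ring
  obtain ⟨j, R, hRc, hR0, hR⟩ := exists_legendrePoly_eq_pow_mul n
  -- Near 0, P(z) behaves like R(0) z^j, so the boundary terms at x and at 1 differ asymptotically
  -- by the factor x^j.
  have hpow : ∀ x : ℝ, 0 < x → (x : ℂ) ^ j * ℓ x = ℓ 1 := by
    intro x hx
    have hxc : (x : ℂ) ≠ 0 := by exact_mod_cast hx.ne'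
    have hR0c : (R 0 : ℂ) ≠ 0 := by exact_mod_cast hR0
    have hRx : Tendsto (fun ε : ℝ => (R (ε / x) : ℂ)) (𝓝[>] 0) (𝓝 (R 0)) := by
      have : Continuous fun ε : ℝ => (R (ε / x) : ℂ) := by fun_prop
      simpa using (this.tendsto 0).mono_left nhdsWithin_le_nhds
    have hR1 : Tendsto (fun ε : ℝ => (R ε : ℂ)) (𝓝[>] 0) (𝓝 (R 0)) :=
      ((Complex.continuous_ofReal.comp hRc).tendsto 0).mono_left nhdsWithin_le_nhds
    have h1 := (hR1.mul (hlim x hx)).const_mul ((x : ℂ) ^ j)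
    have h2 := hRx.mul (hlim 1 one_pos)
    have h3 : (x : ℂ) ^ j * (R 0 * ℓ x) = R 0 * ℓ 1 := by
      refine tendsto_nhds_unique_of_eventuallyEq h1 h2 ?_
      filter_upwards [self_mem_nhdsWithin] with ε hε
      have hε : 0 < ε := hε
      rw [legendreP_eq_legendrePoly hν (div_pos hε hx), div_one,
        legendreP_eq_legendrePoly hν hε, hR, hR]
      push_cast
      rw [div_pow]
      field_simp
    exact mul_left_cancel₀ hR0c (by rw [← h3]; ring)
  have hℓ1 : ℓ 1 = 0 := by
    by_contra hne
    have hLp : MemLp ℓ 2 halfLine := (memLp_congr_ae hℓg).1 (Lp.memLp _)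
    have hsq := (memLp_two_iff_integrable_sq_norm hLp.1).1 hLp
    -- If ℓ 1 were nonzero, x^(-2j) would be a multiple of |ℓ|²; no power is integrable on the whole
    -- half-line.
    refine not_integrableOn_Ioi_rpow (-(2 * j : ℝ)) ((hsq.const_mul (‖ℓ 1‖ ^ 2)⁻¹).congr ?_)
    filter_upwards [ae_halfLine_pos] with x hx
    have hn : ‖ℓ 1‖ ≠ 0 := norm_ne_zero_iff.2 hne
    have : ‖ℓ 1‖ = x ^ j * ‖ℓ x‖ := by
      rw [← hpow x hx, norm_mul, norm_pow, Complex.norm_real, Real.norm_eq_abs, abs_of_pos hx]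
    have hn' : ‖ℓ x‖ ≠ 0 := fun h0 => hn (by rw [this, h0, mul_zero])
    rw [this, Real.rpow_neg hx.le, show (2 * j : ℝ) = ((j * 2 : ℕ) : ℝ) by push_cast; ring,
      Real.rpow_natCast, pow_mul]
    field_simp
  have h0 : f - opA ν f - g = 0 := by
    refine Lp.ext ?_
    filter_upwards [hℓg, ae_halfLine_pos, Lp.coeFn_zero ℂ 2 halfLine] with x h1 hx h2
    have hxc : (x : ℂ) ^ j ≠ 0 := pow_ne_zero _ (by exact_mod_cast hx.ne')
    rw [h1, h2, Pi.zero_apply]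
    exact (mul_eq_zero.1 ((hpow x hx).trans hℓ1)).resolve_left hxc
  exact (sub_eq_zero.1 h0).symm

end Integral

end BuschmanErdelyi

namespace BuschmanErdelyi
open Filter Topology ENNReal

/-! ### Integral degree: the operator with an internal derivative on `(x, ∞)` -/

theorem HasLocACDeriv.aestronglyMeasurable {F q : ℝ → ℂ} (h : HasLocACDeriv F q) :
    AEStronglyMeasurable q halfLine := by
  refine (aestronglyMeasurable_deriv F halfLine).congr ?_
  filter_upwards [h.ae_hasDerivAt] with x hx
  exact hx.deriv

/-- Integrability of q gives F a limit at infinity, and a square-integrable function can only have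
the limit 0. -/
theorem HasLocACDeriv.eq_neg_integral_Ioi {F q : ℝ → ℂ} (h : HasLocACDeriv F q)
    (hF : MemLp F 2 halfLine) {x : ℝ} (hx : 0 < x) (hq : IntegrableOn q (Ioi x)) :
    F x = -∫ t in Ioi x, q t := by
  have h1 : Tendsto F atTop (𝓝 (F x + ∫ t in Ioi x, q t)) := by
    refine ((intervalIntegral_tendsto_integral_Ioi x hq tendsto_id).const_add (F x)).congr' ?_
    filter_upwards [eventually_gt_atTop 0] with b hb
    rw [id, ← (h x b hx hb).2]
    ring
  have h2 : ‖F x + ∫ t in Ioi x, q t‖ ^ 2 = 0 :=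
    IntegrableAtFilter.eq_zero_of_tendsto (μ := volume)
      ⟨Ioi 0, Ioi_mem_atTop 0, (memLp_two_iff_integrable_sq_norm hF.1).1 hF⟩
      (fun s hs => by
        obtain ⟨a, ha⟩ := mem_atTop_sets.1 hs
        exact measure_mono_top (show Ici a ⊆ s from ha) Real.volume_Ici) (h1.norm.pow 2)
  exact eq_neg_of_add_eq_zero_left (norm_eq_zero.1 (pow_eq_zero_iff two_ne_zero |>.1 h2))

section Integral

variable {ν : ℂ} {n : ℕ} {F q : ℝ → ℂ} {x : ℝ}

/-- On [1, ∞) the Legendre polynomial is at least 1, so dividing by it preserves integrability. -/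
theorem integrableOn_of_legendreP_mul (hν : ν * (ν + 1) = n * (n + 1)) (hx : 0 < x)
    (hi : IntegrableOn (fun t => legendreP ν (t / x) * q t) (Ioi x)) : IntegrableOn q (Ioi x) := by
  have h1 : ∀ t ∈ Ioi x, 1 ≤ t / x := fun t ht => (one_le_div hx).2 (le_of_lt ht)
  have h2 : ∀ t ∈ Ioi x, 1 ≤ ‖legendreP ν (t / x)‖ := fun t ht => by
    rw [norm_legendreP_eq hν (h1 t ht)]
    exact one_le_legendrePoly n (h1 t ht)
  have h3 : ∀ t ∈ Ioi x, legendreP ν (t / x) ≠ 0 := fun t ht =>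
    norm_pos_iff.1 (one_pos.trans_le (h2 t ht))
  have hc : ContinuousOn (fun t => (legendreP ν (t / x))⁻¹) (Ioi x) :=
    ContinuousOn.inv₀ ((continuousOn_legendreP ν).comp (continuousOn_id.div_const x)
      fun t ht => mem_Ioi.2 (div_pos (hx.trans ht) hx)) h3
  refine ((Integrable.bdd_mul (c := 1) hi (hc.aestronglyMeasurable measurableSet_Ioi) ?_).congr ?_)
  · filter_upwards [ae_restrict_mem measurableSet_Ioi] with t ht
    rw [norm_inv]
    exact inv_le_one_of_one_le₀ (h2 t ht)
  · filter_upwards [ae_restrict_mem measurableSet_Ioi] with t ht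
    rw [inv_mul_cancel_left₀ (h3 t ht)]

theorem integral_kerC_mul_ite (ν : ℂ) (hx : 0 < x) {s : ℝ} (hs : x ≤ s) (c : ℂ) :
    ∫ t, kerC ν t x * (if t < s then c else 0) ∂halfLine = (legendreP ν (s / x) - 1) * c := by
  have e : ∀ t, kerC ν t x * (if t < s then c else 0)
      = if x < t ∧ t < s then legendreP' ν (t / x) / x * c else 0 := by
    intro t
    by_cases h1 : x < t <;> by_cases h2 : t < s <;> simp [kerC, h1, h2, hx]
  simp only [e]
  rw [integral_halfLine_ite hx.le hs, intervalIntegral.integral_mul_const,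
    integral_legendreP'_div ν hx hx hs, div_self hx.ne', legendreP_one]

theorem kerC_mul_ite_of_le (ν : ℂ) {s t : ℝ} (hs : s ≤ x) (c : ℂ) :
    kerC ν t x * (if t < s then c else 0) = 0 := by
  by_cases h : t < s
  · rw [kerC, if_neg fun h' => not_lt.2 (h.le.trans hs) h'.2, zero_mul]
  · rw [if_neg h, mul_zero]

/-- Since p ≥ 0 on [1, ∞), the inner integral of absolute values is computed exactly: it is (P(s/x)
- 1)|q(s)|, which the domain condition makes integrable. -/
theorem integrable_kerC_mul_ite (hν : ν * (ν + 1) = n * (n + 1)) (hx : 0 < x)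
    (hq : AEStronglyMeasurable q halfLine)
    (hi : IntegrableOn (fun t => legendreP ν (t / x) * q t) (Ioi x)) :
    Integrable (fun r : ℝ × ℝ => kerC ν r.1 x * ((if r.1 < r.2 then -1 else 0) * q r.2))
      (halfLine.prod halfLine) := by
  have hlt : MeasurableSet {r : ℝ × ℝ | r.1 < r.2} := measurableSet_lt measurable_fst measurable_snd
  have hm : AEStronglyMeasurable
      (fun r : ℝ × ℝ => kerC ν r.1 x * ((if r.1 < r.2 then -1 else 0) * q r.2))
      (halfLine.prod halfLine) :=
    (((measurable_kerC_right ν x).comp measurable_fst).aestronglyMeasurable).mul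
      ((Measurable.ite hlt measurable_const measurable_const).aestronglyMeasurable.mul
        (hq.comp_quasiMeasurePreserving Measure.quasiMeasurePreserving_snd))
  have e1 : ∀ t s, kerC ν t x * ((if t < s then -1 else 0) * q s)
      = kerC ν t x * (if t < s then -q s else 0) := fun t s => by split_ifs <;> ring
  rw [integrable_prod_iff' hm]
  constructor
  · refine Eventually.of_forall fun s => ?_
    simp only [e1]
    rcases le_or_gt s x with hs | hs
    · simp only [kerC_mul_ite_of_le ν hs]
      exact integrable_zero _ _ _
    · have hc : IntegrableOn (fun t => legendreP' ν (t / x) / x * -q s) (Ioo x s) :=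
        (((continuousOn_legendreP'_div ν hx hx).mul continuousOn_const).integrableOn_Icc).mono_set
          Ioo_subset_Icc_self
      refine ((hc.integrable_indicator measurableSet_Ioo).mono_measure
        Measure.restrict_le_self).congr (Eventually.of_forall fun t => ?_)
      by_cases h1 : x < t <;> by_cases h2 : t < s <;> simp [kerC, h1, h2, hx]
  · have e2 : ∀ s, (fun t => ((‖kerC ν t x * ((if t < s then -1 else 0) * q s)‖ : ℝ) : ℂ))
        = fun t => kerC ν t x * (if t < s then (‖q s‖ : ℂ) else 0) := by
      intro s
      funext t
      by_cases h1 : x < t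
      · have h1' : 1 ≤ t / x := (one_le_div hx).2 h1.le
        have : (‖kerC ν t x‖ : ℂ) = kerC ν t x := by
          rw [kerC, if_pos ⟨hx, h1⟩, norm_div, norm_legendreP'_eq hν h1', Complex.norm_real,
            Real.norm_eq_abs, abs_of_pos hx, legendreP'_eq_legendrePoly' hν (one_pos.trans_le h1')]
          push_cast
          ring
        rw [norm_mul, Complex.ofReal_mul, this]
        split_ifs <;> simp
      · simp [kerC, h1]
    have e3 : ∀ s, ∫ t, ‖kerC ν t x * ((if t < s then -1 else 0) * q s)‖ ∂halfLine
        = (Ioi x).indicator (fun s => ‖legendreP ν (s / x) * q s‖ - ‖q s‖) s := by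
      intro s
      apply Complex.ofReal_injective
      rw [← integral_complex_ofReal, e2 s]
      rcases le_or_gt s x with hs | hs
      · simp only [kerC_mul_ite_of_le ν hs]
        rw [indicator_of_notMem (by simpa using hs)]
        simp
      · have h1 : 1 ≤ s / x := (one_le_div hx).2 hs.le
        rw [integral_kerC_mul_ite ν hx hs.le, indicator_of_mem (mem_Ioi.2 hs), norm_mul,
          norm_legendreP_eq hν h1, legendreP_eq_legendrePoly hν (one_pos.trans_le h1)]
        push_cast
        ring
    simp only [e3]
    exact (IntegrableOn.integrable_indicator (hi.norm.sub
      (integrableOn_of_legendreP_mul hν hx hi).norm) measurableSet_Ioi).mono_measure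
      Measure.restrict_le_self

/-- Writing F(t) as -∫_t^∞ q and exchanging the order of integration replaces integration by parts,
so no growth estimate for the boundary term at infinity is needed. -/
theorem integrable_kerD_and_eq (hν : ν * (ν + 1) = n * (n + 1)) (hFq : HasLocACDeriv F q)
    (hF : MemLp F 2 halfLine)
    (hi : ∀ x : ℝ, 0 < x → IntegrableOn (fun t => legendreP ν (t / x) * q t) (Ioi x))
    (hx : 0 < x) :
    Integrable (fun t => kerC ν t x * F t) halfLine ∧
      kernelOp (fun x t => kerC ν t x) F x
        = (∫ t in Ioi x, legendreP ν (t / x) * -q t) - F x := by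
  have hprod := integrable_kerC_mul_ite hν hx hFq.aestronglyMeasurable (hi x hx)
  have hres : ∀ {y : ℝ}, 0 < y → Measure.restrict halfLine (Ioi y) = volume.restrict (Ioi y) := by
    intro y hy
    rw [Measure.restrict_restrict measurableSet_Ioi,
      inter_eq_left.2 (show Ioi y ⊆ Ioi 0 from Ioi_subset_Ioi hy.le)]
  have hk : ∀ t : ℝ, 0 < t → kernelOp (fun t s => if t < s then -1 else 0) q t = F t := by
    intro t ht
    rw [hFq.eq_neg_integral_Ioi hF ht (integrableOn_of_legendreP_mul hν ht (hi t ht)), ← hres ht,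
      ← integral_indicator (measurableSet_Ioi (a := t)), ← integral_neg, kernelOp]
    refine integral_congr_ae (Eventually.of_forall fun s => ?_)
    by_cases h : t < s <;> simp [h, indicator]
  have hkF : kernelOp (fun t s => if t < s then -1 else 0) q =ᵐ[halfLine] F := by
    filter_upwards [ae_halfLine_pos] with t ht using hk t ht
  constructor
  · refine hprod.integral_prod_left.congr ?_
    filter_upwards [hkF] with t ht
    rw [← ht, kernelOp, ← integral_const_mul]
  · have h1 := kernelOp_kernelOp (k₁ := fun x t => kerC ν t x)
      (k₂ := fun t s => if t < s then -1 else 0) (f := q) (x := x) hprod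
    rw [kernelOp_congr hkF] at h1
    have h2 : IntegrableOn q (Ioi x) := integrableOn_of_legendreP_mul hν hx (hi x hx)
    have h3 : ∫ t in Ioi x, legendreP ν (t / x) * -q t = -∫ t in Ioi x, legendreP ν (t / x) * q t := by
      rw [← integral_neg]
      simp only [mul_neg]
    rw [h1, h3, hFq.eq_neg_integral_Ioi hF hx h2, ← sub_eq_zero]
    have h4 : ∫ s, (∫ t, kerC ν t x * (if t < s then -1 else 0) ∂halfLine) * q s ∂halfLine
        = -∫ s in Ioi x, (legendreP ν (s / x) * q s - q s) := by
      rw [← hres hx, ← integral_indicator (measurableSet_Ioi (a := x)), ← integral_neg]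
      refine integral_congr_ae (Eventually.of_forall fun s => ?_)
      rcases le_or_gt s x with hs | hs
      · simp only [kerC_mul_ite_of_le ν hs]
        rw [indicator_of_notMem (by simpa using hs)]
        simp
      · simp only
        rw [integral_kerC_mul_ite ν hx hs.le, indicator_of_mem (mem_Ioi.2 hs)]
        ring
    rw [h4, integral_sub (hi x hx) h2]
    ring

/-- For x < t < s, monotonicity of p gives p(s/t)/t ≤ (x/t) p(s/x)/x. With the bound M/t for the
kernel of B, the integrand is dominated by M x t^(-2) on (x, ∞) times the integrable function of s
defining DF at x. -/
theorem integrable_kerB_mul_kerD (hν : ν * (ν + 1) = n * (n + 1)) (hF : MemLp F 2 halfLine)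
    (hx : 0 < x) (hi : Integrable (fun t => kerC ν t x * F t) halfLine) :
    Integrable (fun r : ℝ × ℝ => kerA ν r.1 x * (kerC ν r.2 r.1 * F r.2))
      (halfLine.prod halfLine) := by
  have h1 : Integrable ((Ioi x).indicator fun t : ℝ => boundP' ν * x * t ^ (-2 : ℝ)) halfLine :=
    (IntegrableOn.integrable_indicator
      ((integrableOn_Ioi_rpow_of_lt (a := -2) (by norm_num) hx).const_mul _)
      measurableSet_Ioi).mono_measure Measure.restrict_le_self
  have hm : Measurable fun r : ℝ × ℝ => kerA ν r.1 x :=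
    (measurable_kerA ν).comp (measurable_fst.prodMk measurable_const)
  refine (h1.mul_prod hi.norm).mono' (hm.aestronglyMeasurable.mul
    (((measurable_kerC ν).comp measurable_swap).aestronglyMeasurable.mul
      (hF.1.comp_quasiMeasurePreserving Measure.quasiMeasurePreserving_snd))) ?_
  refine Eventually.of_forall fun r => ?_
  obtain ⟨t, s⟩ := r
  simp only
  by_cases hxt : x < t
  · have ht : 0 < t := hx.trans hxt
    rw [indicator_of_mem (mem_Ioi.2 hxt), norm_mul, norm_mul, norm_mul]
    by_cases hts : t < s
    · have e1 : (1 : ℝ) ≤ s / t := (one_le_div ht).2 hts.le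
      have e2 : s / t ≤ s / x := by have := ht.trans hts; gcongr
      have e3 : ‖kerC ν s t‖ ≤ x / t * ‖kerC ν s x‖ := by
        rw [kerC, if_pos ⟨ht, hts⟩, kerC, if_pos ⟨hx, hxt.trans hts⟩, norm_div, norm_div,
          norm_legendreP'_eq hν e1, norm_legendreP'_eq hν (e1.trans e2), Complex.norm_real,
          Complex.norm_real, Real.norm_eq_abs, Real.norm_eq_abs, abs_of_pos ht, abs_of_pos hx]
        have e4 := monotoneOn_legendrePoly' n (mem_Ici.2 e1) (mem_Ici.2 (e1.trans e2)) e2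
        calc legendrePoly' n (s / t) / t ≤ legendrePoly' n (s / x) / t := by gcongr
          _ = x / t * (legendrePoly' n (s / x) / x) := by field_simp
      calc ‖kerA ν t x‖ * (‖kerC ν s t‖ * ‖F s‖)
          ≤ boundP' ν / t * (x / t * ‖kerC ν s x‖ * ‖F s‖) := by
            gcongr
            · exact div_nonneg (boundP'_nonneg ν) ht.le
            · exact norm_kerA_le ν ht
        _ = boundP' ν * x * t ^ (-2 : ℝ) * (‖kerC ν s x‖ * ‖F s‖) := by
            rw [Real.rpow_neg ht.le, Real.rpow_two]
            field_simp
    · rw [kerC, if_neg (by tauto), norm_zero, zero_mul, mul_zero]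
      have := boundP'_nonneg ν
      positivity
  · rw [kerA, if_neg (by tauto), zero_mul, norm_zero, indicator_of_notMem (by simpa using hxt),
      zero_mul]

/-- Here g = f + Df; applying B and using BD = D - B, the transpose of CA = C - A, gives Bg = g - f.
-/
theorem pMinus_imp (hν : ν * (ν + 1) = n * (n + 1)) {f g : L2} (h : PMinus ν f g) :
    f = g - opB ν g := by
  obtain ⟨F, q, hfF, hFq, hi, hg⟩ := h
  have hF : MemLp F 2 halfLine := (memLp_congr_ae hfF).1 (Lp.memLp f)
  have hi' : ∀ x : ℝ, 0 < x → IntegrableOn (fun t => legendreP ν (t / x) * q t) (Ioi x) :=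
    fun x hx => by simpa using (hi x hx).neg
  have hD : (g - f : L2) =ᵐ[halfLine] kernelOp (fun x t => kerC ν t x) F := by
    filter_upwards [Lp.coeFn_sub g f, hg, hfF, ae_halfLine_pos] with x h1 h2 h3 hx
    rw [h1, Pi.sub_apply, h2, h3, (integrable_kerD_and_eq hν hFq hF hi' hx).2]
  have hB : opB ν (g - f) = (g - f) - opB ν f := by
    refine Lp.ext ?_
    filter_upwards [opB_ae ν (g - f), opB_ae ν f, Lp.coeFn_sub (g - f) (opB ν f), hD,
      ae_halfLine_pos] with x h1 h2 h3 h4 hx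
    have hDi := (integrable_kerD_and_eq hν hFq hF hi' hx).1
    have hcomp := kernelOp_kernelOp (k₁ := fun x t => kerA ν t x) (k₂ := fun x t => kerC ν t x)
      (f := F) (x := x) (integrable_kerB_mul_kerD hν hF hx hDi)
    rw [h1, h3, Pi.sub_apply, h2, h4, kernelOp_congr hD, kernelOp_congr hfF, hcomp, kernelOp,
      kernelOp,
      ← integral_sub hDi ((isHardyKernel_kerB ν).integrable_mul hF hx)]
    refine integral_congr_ae ?_
    filter_upwards [ae_halfLine_pos] with s hs
    simp only [mul_comm (kerA ν _ x)]
    rw [integral_kerC_mul_kerA ν hx]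
    ring
  have e : opB ν g = g - f := by
    rw [map_sub] at hB
    exact sub_left_injective hB
  rw [e, _root_.sub_sub_cancel]

end Integral

end BuschmanErdelyi

namespace BuschmanErdelyi
open Filter Topology ENNReal

/-! ### Non-integral degree -/

/-- The bound forces a zero at 0, so a factor X splits off and lowers both the degree and the
exponent by one. -/
theorem polynomial_eq_zero_of_norm_le (N : ℕ) : ∀ (Q : Polynomial ℂ) (C : ℝ), Q.degree < N →
    (∀ x ∈ Ioo (0 : ℝ) 1, ‖Q.eval (x : ℂ)‖ ≤ C * x ^ N) → Q = 0 := by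
  induction N with
  | zero => intro Q C hQ _; simpa using hQ
  | succ N ih =>
    intro Q C hQ hb
    have hmem : Ioo (0 : ℝ) 1 ∈ 𝓝[>] 0 := Ioo_mem_nhdsGT one_pos
    have h1 : Tendsto (fun x : ℝ => Q.eval (x : ℂ)) (𝓝[>] 0) (𝓝 (Q.eval 0)) := by
      have : Continuous fun x : ℝ => Q.eval (x : ℂ) := Q.continuous.comp Complex.continuous_ofReal
      simpa using (this.tendsto 0).mono_left nhdsWithin_le_nhds
    have h2 : Tendsto (fun x : ℝ => C * x ^ (N + 1)) (𝓝[>] 0) (𝓝 0) := by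
      have : Continuous fun x : ℝ => C * x ^ (N + 1) := by fun_prop
      simpa using (this.tendsto 0).mono_left nhdsWithin_le_nhds
    have h3 : Q.eval 0 = 0 := tendsto_nhds_unique h1
      (squeeze_zero_norm' (eventually_of_mem hmem hb) h2)
    obtain ⟨Q', rfl⟩ : Polynomial.X ∣ Q := Polynomial.X_dvd_iff.2
      (by rw [Polynomial.coeff_zero_eq_eval_zero, h3])
    rw [ih Q' C ?_ fun x hx => ?_, mul_zero]
    · by_contra h
      have hQ' : Q' ≠ 0 := fun h0 => h (by rw [h0, Polynomial.degree_zero]; exact WithBot.bot_lt_coe _)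
      rw [Polynomial.degree_mul, Polynomial.degree_X, Polynomial.degree_eq_natDegree hQ'] at hQ
      rw [Polynomial.degree_eq_natDegree hQ'] at h
      have hlt : 1 + Q'.natDegree < N + 1 := by exact_mod_cast hQ
      exact h (by exact_mod_cast (by omega : Q'.natDegree < N))
    · have := hb x hx
      rw [Polynomial.eval_mul, Polynomial.eval_X, norm_mul, Complex.norm_real, Real.norm_eq_abs,
        abs_of_pos hx.1, pow_succ] at this
      have hx0 := hx.1
      exact le_of_mul_le_mul_left (by linarith) hx0

/-- A function with Taylor expansions of all orders at `0` which is fixed by a multiplicative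
convolution operator with a bounded kernel is a polynomial. -/
theorem exists_polynomial_of_fixed {w b : ℝ → ℂ} {M : ℝ} (hM : 0 ≤ M)
    (hw : IntervalIntegrable w volume 0 1) (hwM : ∀ r ∈ Ioc (0 : ℝ) 1, ‖w r‖ ≤ M)
    (hb : ContinuousOn b (Ioc 0 1))
    (hT : ∀ N : ℕ, ∃ (Q : Polynomial ℂ) (C : ℝ), 0 ≤ C ∧ Q.degree < N ∧
      ∀ x ∈ Ioc (0 : ℝ) 1, ‖b x - Q.eval (x : ℂ)‖ ≤ C * x ^ N)
    (hfix : ∀ x ∈ Ioo (0 : ℝ) 1, b x = ∫ r in (0 : ℝ)..1, w r * b (x * r)) :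
    ∃ Q : Polynomial ℂ, ∀ x ∈ Ioo (0 : ℝ) 1, b x = Q.eval (x : ℂ) := by
  -- On functions of size x^N the convolution has norm at most M ∫_0^1 r^N dr = M/(N + 1), which is
  -- below 1 for this N.
  obtain ⟨N, hN⟩ := exists_nat_gt M
  obtain ⟨Q, C, hC, hQN, hQ⟩ := hT N
  set R : ℝ → ℂ := fun x => b x - Q.eval (x : ℂ) with hR
  have hmem : ∀ x ∈ Ioo (0 : ℝ) 1, ∀ r ∈ Ioc (0 : ℝ) 1, x * r ∈ Ioo (0 : ℝ) 1 := fun x hx r hr =>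
    ⟨mul_pos hx.1 hr.1, (mul_le_of_le_one_right hx.1.le hr.2).trans_lt hx.2⟩
  have hbound : ∀ (K : ℝ), 0 ≤ K → (∀ x ∈ Ioo (0 : ℝ) 1, ‖R x‖ ≤ K * x ^ N) →
      ∀ x ∈ Ioo (0 : ℝ) 1, ‖∫ r in (0 : ℝ)..1, w r * R (x * r)‖ ≤ K * (M / (N + 1)) * x ^ N := by
    intro K hK h x hx
    have h1 : ‖∫ r in (0 : ℝ)..1, w r * R (x * r)‖ ≤ ∫ r in (0 : ℝ)..1, M * K * x ^ N * r ^ N := by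
      refine intervalIntegral.norm_integral_le_of_norm_le zero_le_one
        (Eventually.of_forall fun r hr => ?_) ?_
      · rw [norm_mul]
        calc ‖w r‖ * ‖R (x * r)‖ ≤ M * (K * (x * r) ^ N) := by
              gcongr
              · exact hwM r hr
              · exact h _ (hmem x hx r hr)
          _ = M * K * x ^ N * r ^ N := by rw [mul_pow]; ring
      · exact (Continuous.intervalIntegrable (by fun_prop) _ _)
    rw [intervalIntegral.integral_const_mul, integral_pow] at h1
    refine h1.trans_eq ?_
    simp
    ring
  have hRi : ∀ x ∈ Ioo (0 : ℝ) 1, IntervalIntegrable (fun r => w r * R (x * r)) volume 0 1 := by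
    intro x hx
    rw [intervalIntegrable_iff_integrableOn_Ioc_of_le zero_le_one] at hw ⊢
    have hc : ContinuousOn (fun r => R (x * r)) (Ioc 0 1) :=
      (hb.sub (Q.continuous.comp Complex.continuous_ofReal).continuousOn).comp
        (continuous_const.mul continuous_id).continuousOn
        fun r hr => Ioo_subset_Ioc_self (hmem x hx r hr)
    refine (Integrable.bdd_mul (c := C) hw (hc.aestronglyMeasurable measurableSet_Ioc) ?_).congr
      (Eventually.of_forall fun r => mul_comm _ _)
    filter_upwards [ae_restrict_mem measurableSet_Ioc] with r hr
    have h1 := hmem x hx r hr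
    refine (hQ _ (Ioo_subset_Ioc_self h1)).trans ?_
    exact mul_le_of_le_one_right hC (pow_le_one₀ h1.1.le h1.2.le)
  have hpi : ∀ k : ℕ, IntervalIntegrable (fun r : ℝ => w r * (r : ℂ) ^ k) volume 0 1 := fun k =>
    hw.mul_continuousOn (by fun_prop)
  -- The convolution multiplies x^k by the k-th moment of w; Q₂ is the image of the Taylor
  -- polynomial Q.
  set Q₂ : Polynomial ℂ := ∑ k ∈ Finset.range N,
    Polynomial.C (Q.coeff k * ∫ r in (0 : ℝ)..1, w r * (r : ℂ) ^ k) * Polynomial.X ^ k with hQ₂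
  have hQe : ∀ z : ℂ, Q.eval z = ∑ k ∈ Finset.range N, Q.coeff k * z ^ k := fun z => by
    rcases eq_or_ne Q 0 with h | h
    · simp [h]
    · exact Polynomial.eval_eq_sum_range' ((Polynomial.natDegree_lt_iff_degree_lt h).2 hQN) z
  have hterm : ∀ (x : ℝ) (k : ℕ), (fun r : ℝ => Q.coeff k * (x : ℂ) ^ k * (w r * (r : ℂ) ^ k))
      = fun r : ℝ => w r * (Q.coeff k * ((x * r : ℝ) : ℂ) ^ k) := fun x k => by
    funext r; push_cast; rw [mul_pow]; ring
  have hQint : ∀ x : ℝ, IntervalIntegrable (fun r : ℝ => w r * Q.eval ((x * r : ℝ) : ℂ)) volume 0 1 :=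
    fun x => hw.mul_continuousOn (Continuous.continuousOn
      (Q.continuous.comp (Complex.continuous_ofReal.comp (continuous_const.mul continuous_id))))
  have hQ₂e : ∀ x : ℝ, ∫ r in (0 : ℝ)..1, w r * Q.eval ((x * r : ℝ) : ℂ) = Q₂.eval (x : ℂ) := by
    intro x
    simp only [hQe, Finset.mul_sum]
    rw [intervalIntegral.integral_finsetSum fun k _ => by
      rw [← hterm]; exact (hpi k).const_mul _, hQ₂, Polynomial.eval_finsetSum]
    refine Finset.sum_congr rfl fun k _ => ?_
    rw [← hterm, intervalIntegral.integral_const_mul]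
    simp
    ring
  have hfix' : ∀ x ∈ Ioo (0 : ℝ) 1,
      R x + (Q - Q₂).eval (x : ℂ) = ∫ r in (0 : ℝ)..1, w r * R (x * r) := by
    intro x hx
    have e : ∫ r in (0 : ℝ)..1, w r * b (x * r)
        = (∫ r in (0 : ℝ)..1, w r * R (x * r)) + Q₂.eval (x : ℂ) := by
      rw [← hQ₂e, ← intervalIntegral.integral_add (hRi x hx) (hQint x)]
      refine intervalIntegral.integral_congr fun r _ => ?_
      simp only [hR]
      ring
    have h1 := hfix x hx
    rw [e] at h1
    rw [Polynomial.eval_sub, ← sub_eq_zero]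
    simp only [hR] at h1 ⊢
    rw [h1]
    ring
  have hRC : ∀ x ∈ Ioo (0 : ℝ) 1, ‖R x‖ ≤ C * x ^ N := fun x hx => hQ x (Ioo_subset_Ioc_self hx)
  -- By the fixed-point equation Q - Q₂ is a difference of two functions of size x^N, yet its degree
  -- is below N.
  have hQQ : Q - Q₂ = 0 := by
    refine polynomial_eq_zero_of_norm_le N _ (C * (M / (N + 1)) + C) ?_ fun x hx => ?_
    · refine (Polynomial.degree_sub_le _ _).trans_lt (max_lt hQN ?_)
      rw [hQ₂]
      refine (Polynomial.degree_sum_le _ _).trans_lt ((Finset.sup_lt_iff (WithBot.bot_lt_coe _)).2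
        fun k hk => (Polynomial.degree_C_mul_X_pow_le _ _).trans_lt ?_)
      exact_mod_cast Finset.mem_range.1 hk
    · rw [eq_sub_of_add_eq' (hfix' x hx), add_mul]
      exact (norm_sub_le _ _).trans (add_le_add (hbound C hC hRC x hx) (hRC x hx))
  -- The remainder is now itself fixed by a contraction, so iterating its bound sends it to 0.
  have hR0 : ∀ j : ℕ, ∀ x ∈ Ioo (0 : ℝ) 1, ‖R x‖ ≤ C * (M / (N + 1)) ^ j * x ^ N := by
    intro j
    induction j with
    | zero => simpa using hRC
    | succ j ih =>
      intro x hx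
      have h1 := hfix' x hx
      rw [hQQ, Polynomial.eval_zero, add_zero] at h1
      rw [h1, pow_succ, ← mul_assoc]
      exact hbound _ (by positivity) ih x hx
  refine ⟨Q, fun x hx => ?_⟩
  have hθ : Tendsto (fun j : ℕ => C * (M / (N + 1)) ^ j * x ^ N) atTop (𝓝 (C * 0 * x ^ N)) :=
    ((_root_.tendsto_pow_atTop_nhds_zero_of_lt_one (by positivity)
      ((div_lt_one (by positivity)).2 (by linarith))).const_mul C).mul_const _
  have h1 : ‖R x‖ ≤ 0 := by
    have := ge_of_tendsto' hθ fun j => hR0 j x hx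
    simpa using this
  exact sub_eq_zero.1 (norm_le_zero_iff.1 h1)

/-- The difference quotient at `0` of the Legendre function. -/
noncomputable def legendreQuot (ν : ℂ) (x : ℝ) : ℂ := (legendreSeries ν x - legendreSeries ν 0) / x

theorem continuousOn_legendreQuot (ν : ℂ) : ContinuousOn (legendreQuot ν) (Ioc 0 1) :=
  ((((contDiffOn_legendreSeries ν 0).continuousOn).mono Ioc_subset_Icc_self).sub
    continuousOn_const).div Complex.continuous_ofReal.continuousOn
    fun x hx => by exact_mod_cast hx.1.ne'

theorem exists_taylor_legendreQuot (ν : ℂ) (N : ℕ) : ∃ (Q : Polynomial ℂ) (C : ℝ), 0 ≤ C ∧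
    Q.degree < N ∧ ∀ x ∈ Ioc (0 : ℝ) 1, ‖legendreQuot ν x - Q.eval (x : ℂ)‖ ≤ C * x ^ N := by
  -- Order N for P gives a remainder of size x^(N + 1); the division by x costs one power.
  obtain ⟨C, hC⟩ := exists_taylor_mean_remainder_bound (n := N) (zero_le_one' ℝ)
    (contDiffOn_legendreSeries ν (N + 1))
  set c : ℕ → ℂ := fun k => ((k.factorial : ℝ)⁻¹ : ℝ) •
    iteratedDerivWithin k (legendreSeries ν) (Icc 0 1) 0 with hc
  have ht : ∀ x : ℝ, taylorWithinEval (legendreSeries ν) N (Icc 0 1) 0 x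
      = legendreSeries ν 0 + x * ∑ k ∈ Finset.range N, c (k + 1) * (x : ℂ) ^ k := by
    intro x
    rw [taylor_within_apply, Finset.sum_range_succ', Finset.mul_sum]
    rw [add_comm]
    congr 1
    · simp
    · refine Finset.sum_congr rfl fun k _ => ?_
      simp only [hc, Complex.real_smul]
      push_cast
      ring
  refine ⟨∑ k ∈ Finset.range N, Polynomial.C (c (k + 1)) * Polynomial.X ^ k, |C|, abs_nonneg _, ?_,
    fun x hx => ?_⟩
  · refine (Polynomial.degree_sum_le _ _).trans_lt ((Finset.sup_lt_iff (WithBot.bot_lt_coe _)).2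
      fun k hk => (Polynomial.degree_C_mul_X_pow_le _ _).trans_lt ?_)
    exact_mod_cast Finset.mem_range.1 hk
  · have hxc : (x : ℂ) ≠ 0 := by exact_mod_cast hx.1.ne'
    have h1 := hC x ⟨hx.1.le, hx.2⟩
    rw [ht] at h1
    have e : legendreQuot ν x - (∑ k ∈ Finset.range N, Polynomial.C (c (k + 1))
        * Polynomial.X ^ k : Polynomial ℂ).eval (x : ℂ)
        = (legendreSeries ν x - (legendreSeries ν 0
          + x * ∑ k ∈ Finset.range N, c (k + 1) * (x : ℂ) ^ k)) / x := by
      rw [legendreQuot, Polynomial.eval_finsetSum]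
      simp only [Polynomial.eval_mul, Polynomial.eval_C, Polynomial.eval_pow, Polynomial.eval_X]
      field_simp
      ring
    rw [e, norm_div, Complex.norm_real, Real.norm_eq_abs, abs_of_pos hx.1, div_le_iff₀ hx.1]
    refine h1.trans ?_
    rw [sub_zero, pow_succ, ← mul_assoc]
    have := hx.1
    gcongr
    exact le_abs_self C

/-- If the difference quotient b is a polynomial, so is P(z) = P(0) + z b(z), and Legendre's
equation determines the degree. -/
theorem exists_int_of_legendreQuot_fixed {ν : ℂ}
    (h : ∀ x ∈ Ioo (0 : ℝ) 1, legendreQuot ν x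
      = ∫ r in (0 : ℝ)..1, (starRingEnd ℂ) (legendreP' ν r) * legendreQuot ν (x * r)) :
    ∃ n : ℤ, ν = n := by
  have hM : ∀ r ∈ Ioc (0 : ℝ) 1, ‖(starRingEnd ℂ) (legendreP' ν r)‖ ≤ boundP' ν := fun r hr => by
    rw [RCLike.norm_conj]
    exact norm_legendreP'_le ν hr.1 hr.2
  have hi : IntervalIntegrable (fun r => (starRingEnd ℂ) (legendreP' ν r)) volume 0 1 := by
    rw [intervalIntegrable_iff_integrableOn_Ioc_of_le zero_le_one]
    refine Integrable.of_bound (C := boundP' ν) ?_ ((ae_restrict_mem measurableSet_Ioc).mono hM)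
    exact (Complex.continuous_conj.comp_continuousOn ((continuousOn_legendreP' ν).mono
      Ioc_subset_Ioi_self)).aestronglyMeasurable measurableSet_Ioc
  obtain ⟨Q, hQ⟩ := exists_polynomial_of_fixed (boundP'_nonneg ν) hi hM
    (continuousOn_legendreQuot ν) (exists_taylor_legendreQuot ν) h
  refine exists_int_of_legendreP_eq_polynomial
    (Polynomial.C (legendreSeries ν 0) + Polynomial.X * Q) fun z hz => ?_
  have hzc : (z : ℂ) ≠ 0 := by exact_mod_cast hz.1.ne'
  rw [legendreP_eq_legendreSeries ν ⟨hz.1, by linarith [hz.2]⟩, Polynomial.eval_add,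
    Polynomial.eval_C, Polynomial.eval_mul, Polynomial.eval_X, ← hQ z hz, legendreQuot]
  field_simp
  ring

end BuschmanErdelyi

/-! ### Isometry tested on the function 1/t on (1, ∞) -/

namespace BuschmanErdelyi
open Filter Topology ENNReal
open scoped InnerProductSpace

/-- The function `1/t` on `(1, ∞)`. -/
noncomputable def invTail (t : ℝ) : ℂ := (Ioi 1).indicator (fun t : ℝ => (t : ℂ)⁻¹) t

theorem memLp_invTail : MemLp invTail 2 halfLine := by
  refine (memLp_inv_max one_pos).of_le ?_ ?_
  · exact (Measurable.indicator (by fun_prop) measurableSet_Ioi).aestronglyMeasurable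
  · filter_upwards [ae_halfLine_pos] with t ht
    by_cases h : 1 < t
    · rw [invTail, indicator_of_mem (mem_Ioi.2 h), max_eq_right h.le, norm_inv, norm_inv,
        Complex.norm_real]
    · rw [invTail, indicator_of_notMem (by simpa using h), norm_zero]
      exact norm_nonneg _

theorem conj_invTail (t : ℝ) : (starRingEnd ℂ) (invTail t) = invTail t := by
  by_cases h : 1 < t
  · rw [invTail, indicator_of_mem (mem_Ioi.2 h), map_inv₀, Complex.conj_ofReal]
  · rw [invTail, indicator_of_notMem (by simpa using h), map_zero]

theorem kernelOp_conj (k : ℝ → ℝ → ℂ) (f : ℝ → ℂ) (x : ℝ) :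
    kernelOp (fun x t => (starRingEnd ℂ) (k x t)) (fun t => (starRingEnd ℂ) (f t)) x
      = (starRingEnd ℂ) (kernelOp k f x) := by
  simp only [kernelOp, ← map_mul]
  exact integral_conj

theorem kernelOp_kerA_invTail (ν : ℂ) {x : ℝ} (hx : x ≤ 1) : kernelOp (kerA ν) invTail x = 0 := by
  rw [kernelOp]
  refine integral_eq_zero_of_ae (Eventually.of_forall fun t => ?_)
  change kerA ν x t * invTail t = 0
  by_cases h : 0 < t ∧ t < x
  · rw [invTail, indicator_of_notMem (by simpa using (h.2.le.trans hx)), mul_zero]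
  · rw [kerA, if_neg h, zero_mul]

/-- For x < 1 the integrand p(x/t)/t² on (1, ∞) is the derivative of -P(x/t)/x, and x/t runs from x
down to 0. The tail 1/t is chosen to produce this exact quotient. -/
theorem kernelOp_kerB_invTail (ν : ℂ) {x : ℝ} (hx : x ∈ Ioo (0 : ℝ) 1) :
    kernelOp (fun x t => kerA ν t x) invTail x = legendreQuot ν x := by
  have hx0 := hx.1
  have hxc : (x : ℂ) ≠ 0 := by exact_mod_cast hx0.ne'
  have hres : Measure.restrict halfLine (Ioi (1 : ℝ)) = volume.restrict (Ioi 1) := by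
    rw [Measure.restrict_restrict measurableSet_Ioi,
      inter_eq_left.2 (show Ioi (1 : ℝ) ⊆ Ioi 0 from Ioi_subset_Ioi zero_le_one)]
  have hmem : ∀ t ∈ Ici (1 : ℝ), x / t ∈ Ioo (0 : ℝ) 1 := fun t ht => by
    have ht : 1 ≤ t := ht
    exact ⟨div_pos hx0 (by linarith), (div_lt_one (by linarith)).2 (hx.2.trans_le ht)⟩
  have e : (fun t => kerA ν t x * invTail t)
      = (Ioi 1).indicator fun t : ℝ => legendreP' ν (x / t) / t * (t : ℂ)⁻¹ := by
    funext t
    by_cases h : 1 < t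
    · rw [invTail, indicator_of_mem (mem_Ioi.2 h), indicator_of_mem (mem_Ioi.2 h), kerA,
        if_pos ⟨hx0, hx.2.trans h⟩]
    · rw [invTail, indicator_of_notMem (by simpa using h), indicator_of_notMem (by simpa using h),
        mul_zero]
  have hi := (isHardyKernel_kerB ν).integrable_mul memLp_invTail hx0
  rw [e, integrable_indicator_iff measurableSet_Ioi, IntegrableOn, hres] at hi
  have hd : ∀ t ∈ Ici (1 : ℝ), HasDerivAt (fun t : ℝ => -(legendreSeries ν (x / t) / x))
      (legendreP' ν (x / t) / t * (t : ℂ)⁻¹) t := by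
    intro t ht
    have ht0 : t ≠ 0 := (one_pos.trans_le (mem_Ici.1 ht)).ne'
    have htc : (t : ℂ) ≠ 0 := by exact_mod_cast ht0
    have hm := hmem t ht
    have d : HasDerivAt (fun t : ℝ => x / t) (-x / t ^ 2) t := by
      exact ((hasDerivAt_const t x).div (hasDerivAt_id' t) ht0).congr_deriv (by simp)
    have := ((((solvesLegendre_legendreSeries ν) _ ⟨by linarith [hm.1], by linarith [hm.2]⟩).1.scomp
      t d).div_const (x : ℂ)).neg
    refine this.congr_deriv ?_
    rw [legendreP'_eq_legendreSeries' ν ⟨hm.1, by linarith [hm.2]⟩, Complex.real_smul]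
    push_cast
    field_simp
  have hlim : Tendsto (fun t : ℝ => -(legendreSeries ν (x / t) / x)) atTop
      (𝓝 (-(legendreSeries ν 0 / x))) := by
    have h1 : Tendsto (fun t : ℝ => x / t) atTop (𝓝 0) := tendsto_const_nhds.div_atTop tendsto_id
    have h2 : ContinuousAt (legendreSeries ν) 0 :=
      ((solvesLegendre_legendreSeries ν) 0 ⟨by norm_num, by norm_num⟩).1.continuousAt
    exact ((h2.tendsto.comp h1).div_const _).neg
  have := integral_Ioi_of_hasDerivAt_of_tendsto
    (hd 1 self_mem_Ici).continuousAt.continuousWithinAt (fun t ht => hd t (mem_Ici_of_Ioi ht)) hi hlim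
  rw [kernelOp, e, integral_indicator (measurableSet_Ioi (a := (1 : ℝ))), hres, this, div_one,
    legendreQuot]
  ring

theorem kernelOp_conj_kerA_eq (ν : ℂ) {x : ℝ} (hx : x ∈ Ioo (0 : ℝ) 1) {g : ℝ → ℂ}
    (hg : ∀ t ∈ Ioo (0 : ℝ) 1, g t = legendreQuot ν t) :
    kernelOp (fun x t => (starRingEnd ℂ) (kerA ν x t)) g x
      = ∫ r in (0 : ℝ)..1, (starRingEnd ℂ) (legendreP' ν r) * legendreQuot ν (x * r) := by
  have hx0 := hx.1.ne'
  have h1 := intervalIntegral.integral_comp_mul_left (a := 0) (b := 1)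
    (fun t => (starRingEnd ℂ) (legendreP' ν (t / x)) * legendreQuot ν t) hx0
  simp only [mul_div_cancel_left₀ _ hx0, mul_zero, mul_one] at h1
  rw [h1, ← intervalIntegral.integral_smul, ← integral_halfLine_ite le_rfl hx.1.le, kernelOp]
  refine integral_congr_ae (Eventually.of_forall fun t => ?_)
  by_cases h : 0 < t ∧ t < x
  · simp only
    rw [if_pos h, kerA, if_pos h, hg t ⟨h.1, h.2.trans hx.2⟩, map_div₀, Complex.conj_ofReal,
      Complex.real_smul]
    push_cast
    ring
  · simp only
    rw [if_neg h, kerA, if_neg h, map_zero, zero_mul]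

/-- The operator identity holds only almost everywhere; continuity of both sides upgrades it to
every point of (0, 1). -/
theorem continuousOn_integral_legendreQuot (ν : ℂ) : ContinuousOn (fun x : ℝ =>
    ∫ r in (0 : ℝ)..1, (starRingEnd ℂ) (legendreP' ν r) * legendreQuot ν (x * r)) (Ioo 0 1) := by
  -- At order 0 the polynomial has degree below 0, so it is zero and the estimate says that the
  -- quotient is bounded.
  obtain ⟨Q, C, hC, hQ, hb⟩ := exists_taylor_legendreQuot ν 0
  have hQ0 : Q = 0 := by simpa using hQ
  have hb' : ∀ x ∈ Ioc (0 : ℝ) 1, ‖legendreQuot ν x‖ ≤ C := fun x hx => by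
    simpa [hQ0] using hb x hx
  have hmem : ∀ x ∈ Ioo (0 : ℝ) 1, ∀ r ∈ Ioc (0 : ℝ) 1, x * r ∈ Ioo (0 : ℝ) 1 := fun x hx r hr =>
    ⟨mul_pos hx.1 hr.1, (mul_le_of_le_one_right hx.1.le hr.2).trans_lt hx.2⟩
  have hc := continuousOn_legendreQuot ν
  intro x hx
  have hnhds : Ioo (0 : ℝ) 1 ∈ 𝓝 x := Ioo_mem_nhds hx.1 hx.2
  refine ContinuousAt.continuousWithinAt
    (intervalIntegral.continuousAt_of_dominated_interval (bound := fun _ => boundP' ν * C) ?_ ?_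
      (by simp) ?_)
  · filter_upwards [hnhds] with y hy
    rw [uIoc_of_le zero_le_one]
    refine ContinuousOn.aestronglyMeasurable ?_ measurableSet_Ioc
    exact (Complex.continuous_conj.comp_continuousOn ((continuousOn_legendreP' ν).mono
      Ioc_subset_Ioi_self)).mul (hc.comp (continuous_const.mul continuous_id).continuousOn
        fun r hr => Ioo_subset_Ioc_self (hmem y hy r hr))
  · filter_upwards [hnhds] with y hy
    refine Eventually.of_forall fun r hr => ?_
    rw [uIoc_of_le zero_le_one] at hr
    rw [norm_mul, RCLike.norm_conj]
    exact mul_le_mul (norm_legendreP'_le ν hr.1 hr.2) (hb' _ (Ioo_subset_Ioc_self (hmem y hy r hr)))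
      (norm_nonneg _) (boundP'_nonneg ν)
  · refine Eventually.of_forall fun r hr => ?_
    rw [uIoc_of_le zero_le_one] at hr
    have h1 : ContinuousAt (legendreQuot ν) (x * r) :=
      (hc.mono Ioo_subset_Ioc_self).continuousAt
        (Ioo_mem_nhds (hmem x hx r hr).1 (hmem x hx r hr).2)
    exact continuousAt_const.mul (ContinuousAt.comp (f := fun y : ℝ => y * r) h1
      (continuous_mul_const r).continuousAt)

theorem exists_int_of_ae_legendreQuot_fixed {ν : ℂ} {g : ℝ → ℂ}
    (hg : ∀ t ∈ Ioo (0 : ℝ) 1, g t = legendreQuot ν t)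
    (h : ∀ᵐ x ∂halfLine, x < 1 →
      kernelOp (fun x t => (starRingEnd ℂ) (kerA ν x t)) g x = g x) : ∃ n : ℤ, ν = n := by
  refine exists_int_of_legendreQuot_fixed (Measure.eqOn_open_of_ae_eq (μ := volume) ?_ isOpen_Ioo
    ((continuousOn_legendreQuot ν).mono Ioo_subset_Ioc_self) (continuousOn_integral_legendreQuot ν))
  filter_upwards [ae_restrict_mem measurableSet_Ioo,
    ae_mono (Measure.restrict_mono (show Ioo (0 : ℝ) 1 ⊆ Ioi 0 from Ioo_subset_Ioi_self) le_rfl) h]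
    with x hx h1
  rw [← kernelOp_conj_kerA_eq ν hx hg, h1 hx.2, hg x hx]

/-- Expanding ⟨Vg, Vf⟩ = ⟨g, f⟩ with V = 1 - B leaves B*B = B + B*. -/
theorem adjoint_apply_of_isometry {B : L2 →L[ℂ] L2} (V : L2 ≃ₗᵢ[ℂ] L2) (hV : ∀ f, V f = f - B f)
    (f : L2) : ContinuousLinearMap.adjoint B (B f) = B f + ContinuousLinearMap.adjoint B f := by
  refine ext_inner_left ℂ fun g => ?_
  have h := V.inner_map_map g f
  rw [hV, hV, inner_sub_left, inner_sub_right, inner_sub_right] at h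
  rw [ContinuousLinearMap.adjoint_inner_right, inner_add_right,
    ContinuousLinearMap.adjoint_inner_right]
  linear_combination h

/-- On (0, 1) the adjoint of B annihilates the tail 1/t, since its kernel only looks at t < x. There
B*B = B + B* says that B* fixes the difference quotient. -/
theorem exists_int_of_isometry_opB {ν : ℂ} (V : L2 ≃ₗᵢ[ℂ] L2) (hV : ∀ f, V f = f - opB ν f) :
    ∃ n : ℤ, ν = n := by
  have h := adjoint_apply_of_isometry V hV (memLp_invTail.toLp _)
  have hf : (memLp_invTail.toLp _ : L2) =ᵐ[halfLine] invTail := memLp_invTail.coeFn_toLp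
  have hBf : opB ν (memLp_invTail.toLp _) =ᵐ[halfLine] kernelOp (fun x t => kerA ν t x) invTail := by
    rw [← kernelOp_congr hf]
    exact opB_ae ν _
  have hadj : ContinuousLinearMap.adjoint (opB ν) = (isHardyKernel_kerA ν).conj.op := by
    rw [opB, IsHardyKernel.adjoint_op]
  rw [hadj] at h
  refine exists_int_of_ae_legendreQuot_fixed
    (g := kernelOp (fun x t => kerA ν t x) invTail) (fun t ht => kernelOp_kerB_invTail ν ht) ?_
  filter_upwards [(isHardyKernel_kerA ν).conj.op_ae (opB ν (memLp_invTail.toLp _)),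
    (isHardyKernel_kerA ν).conj.op_ae (memLp_invTail.toLp _), hBf,
    Lp.coeFn_add (opB ν (memLp_invTail.toLp _))
      ((isHardyKernel_kerA ν).conj.op (memLp_invTail.toLp _))] with x h1 h2 h3 h4 hx
  rw [kernelOp_congr hBf] at h1
  have h5 := kernelOp_conj (kerA ν) invTail x
  simp only [conj_invTail] at h5
  rw [← h1, h, h4, Pi.add_apply, h2, h3, kernelOp_congr hf, h5,
    kernelOp_kerA_invTail ν hx.le, map_zero, add_zero]

/-- V is onto, so its inverse is the isometry 1 - A*, and A* is B with a conjugated kernel. The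
argument for B then applies after complex conjugation, with A in the role of the adjoint. -/
theorem exists_int_of_isometry_opA {ν : ℂ} (V : L2 ≃ₗᵢ[ℂ] L2) (hV : ∀ f, V f = f - opA ν f) :
    ∃ n : ℤ, ν = n := by
  have hW : ∀ f, V.symm f = f - ContinuousLinearMap.adjoint (opA ν) f := fun f => by
    refine ext_inner_right ℂ fun g => ?_
    rw [← V.inner_map_map, V.apply_symm_apply, hV, inner_sub_left, inner_sub_right,
      ContinuousLinearMap.adjoint_inner_left]
  have h := adjoint_apply_of_isometry V.symm hW (memLp_invTail.toLp _)
  have hadj : ContinuousLinearMap.adjoint (opA ν) = (isHardyKernel_kerB ν).conj.op := by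
    rw [opA, IsHardyKernel.adjoint_op]
  rw [ContinuousLinearMap.adjoint_adjoint, hadj] at h
  have hf : (memLp_invTail.toLp _ : L2) =ᵐ[halfLine] invTail := memLp_invTail.coeFn_toLp
  set g : ℝ → ℂ := kernelOp (fun x t => kerA ν t x) invTail with hg
  have hBf : (isHardyKernel_kerB ν).conj.op (memLp_invTail.toLp _)
      =ᵐ[halfLine] fun t => (starRingEnd ℂ) (g t) := by
    refine ((isHardyKernel_kerB ν).conj.op_ae _).trans (Eventually.of_forall fun x => ?_)
    have h5 := kernelOp_conj (fun x t => kerA ν t x) invTail x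
    simp only [conj_invTail] at h5
    rw [kernelOp_congr hf, h5]
  refine exists_int_of_ae_legendreQuot_fixed (g := g) (fun t ht => kernelOp_kerB_invTail ν ht) ?_
  filter_upwards [opA_ae ν ((isHardyKernel_kerB ν).conj.op (memLp_invTail.toLp _)),
    opA_ae ν (memLp_invTail.toLp _), hBf,
    Lp.coeFn_add ((isHardyKernel_kerB ν).conj.op (memLp_invTail.toLp _))
      (opA ν (memLp_invTail.toLp _))] with x h1 h2 h3 h4 hx
  rw [kernelOp_congr hBf] at h1
  have h5 := kernelOp_conj (kerA ν) (fun t => (starRingEnd ℂ) (g t)) x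
  simp only [Complex.conj_conj] at h5
  rw [h5, ← h1, h, h4, Pi.add_apply, h2, h3, kernelOp_congr hf, kernelOp_kerA_invTail ν hx.le,
    add_zero, Complex.conj_conj]

/-! ### The four operators -/

theorem eq_sub_of_eqOn_testSubmodule {B : L2 →L[ℂ] L2} (V : L2 ≃ₗᵢ[ℂ] L2)
    (hV : ∀ f ∈ testSubmodule, V f = f - B f) (f : L2) : V f = f - B f :=
  congrFun (Continuous.ext_on dense_testSubmodule V.continuous (continuous_id.sub B.continuous) hV) f

theorem sMinus_of_mem_testSubmodule (ν : ℂ) {f : L2} (hf : f ∈ testSubmodule) :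
    SMinus ν f (f - opB ν f) := by
  rw [sMinus_iff]
  refine ⟨fun x hx => ?_, rfl⟩
  obtain ⟨φ, hφ, hfφ⟩ := hf
  obtain ⟨a, b, ha, -, hab⟩ := hφ.exists_Ioo
  have hi : IntegrableOn (fun t => legendreP ν (x / t) * φ t) (Ioi x) := by
    rcases le_or_gt b x with hbx | hbx
    · refine IntegrableOn.congr_fun (f := fun _ => 0) integrableOn_zero (fun t ht => ?_)
        measurableSet_Ioi
      rw [eq_zero_of_notMem_Ioo hab fun h => not_lt.2 (hbx.trans (le_of_lt ht)) h.2, mul_zero]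
    · rw [← Ioc_union_Ioi_eq_Ioi hbx.le]
      refine IntegrableOn.union ?_ ?_
      · refine (ContinuousOn.integrableOn_Icc (a := x) (b := b) ?_).mono_set Ioc_subset_Icc_self
        exact ((continuousOn_legendreP ν).comp (continuousOn_const.div continuousOn_id
          fun t ht => (hx.trans_le ht.1).ne') fun t ht => mem_Ioi.2 (div_pos hx
            (hx.trans_le ht.1))).mul hφ.smooth.continuous.continuousOn
      · refine IntegrableOn.congr_fun (f := fun _ => 0) integrableOn_zero (fun t ht => ?_)
          measurableSet_Ioi
        rw [eq_zero_of_notMem_Ioo hab fun h => not_lt.2 (le_of_lt ht) h.2, mul_zero]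
  refine hi.congr ?_
  filter_upwards [ae_mono (Measure.restrict_mono (show Ioi x ⊆ Ioi 0 from Ioi_subset_Ioi hx.le)
    le_rfl) hfφ] with t ht
  rw [ht]

theorem exists_int_of_isUnitary_sMinus {ν : ℂ} (h : IsUnitary (SMinus ν)) : ∃ n : ℤ, ν = n := by
  obtain ⟨U, -, hU⟩ := h
  exact exists_int_of_isometry_opB U (eq_sub_of_eqOn_testSubmodule U fun f hf =>
    hU _ _ (sMinus_of_mem_testSubmodule ν hf))

theorem exists_int_of_isUnitary_pZeroPlus {ν : ℂ} (h : IsUnitary (PZeroPlus ν)) :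
    ∃ n : ℤ, ν = n := by
  obtain ⟨U, -, hU⟩ := h
  exact exists_int_of_isometry_opA U (eq_sub_of_eqOn_testSubmodule U fun f hf =>
    hU _ _ (pZeroPlus_of_mem_testSubmodule ν hf))

/-- The graph contains the pairs ((1 - A)φ, φ), so it is the inverse of the unitary extension that
agrees with 1 - A on test functions. -/
theorem exists_int_of_isUnitary_sZeroPlus {ν : ℂ} (h : IsUnitary (SZeroPlus ν)) :
    ∃ n : ℤ, ν = n := by
  obtain ⟨U, -, hU⟩ := h
  refine exists_int_of_isometry_opA U.symm (eq_sub_of_eqOn_testSubmodule U.symm fun f hf => ?_)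
  rw [← hU _ _ (sZeroPlus_of_mem_testSubmodule ν hf), U.symm_apply_apply,
    hU _ _ (sZeroPlus_of_mem_testSubmodule ν hf)]

theorem exists_int_of_isUnitary_pMinus {ν : ℂ} (h : IsUnitary (PMinus ν)) : ∃ n : ℤ, ν = n := by
  obtain ⟨U, -, hU⟩ := h
  refine exists_int_of_isometry_opB U.symm (eq_sub_of_eqOn_testSubmodule U.symm fun f hf => ?_)
  rw [← hU _ _ (pMinus_of_mem_testSubmodule ν hf), U.symm_apply_apply,
    hU _ _ (pMinus_of_mem_testSubmodule ν hf)]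

/-- For integral degree, `1 - B` extends `₁S_{0+}` and `₁S_-`, and its inverse `1 - A` extends
`₁P_-` and `₁P_{0+}`. -/
theorem exists_extendsTo {ν : ℂ} (hν : ∃ n : ℤ, ν = n) : ∃ U : L2 ≃ₗᵢ[ℂ] L2,
    ExtendsTo (SZeroPlus ν) U ∧ ExtendsTo (PMinus ν) U.symm ∧
      ExtendsTo (SMinus ν) U ∧ ExtendsTo (PZeroPlus ν) U.symm := by
  obtain ⟨n, hn⟩ := exists_legendrePoly hν
  obtain ⟨U, hU, hU'⟩ := exists_linearIsometryEquiv hn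
  -- The known elements of the domains of S_{0+} and P_- are images of test functions under 1 - A
  -- and 1 - B; unitarity keeps these images dense.
  have hdense : ∀ V : L2 ≃ₗᵢ[ℂ] L2, Dense (V '' (testSubmodule : Set L2)) := fun V =>
    V.surjective.denseRange.dense_image V.continuous dense_testSubmodule
  refine ⟨U, ⟨?_, fun f g h => ?_⟩, ⟨?_, fun f g h => ?_⟩, ⟨?_, fun f g h => ?_⟩,
    ⟨?_, fun f g h => ?_⟩⟩
  · refine (hdense U.symm).mono ?_
    rintro _ ⟨f, hf, rfl⟩
    exact ⟨f, by rw [hU']; exact sZeroPlus_of_mem_testSubmodule ν hf⟩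
  · rw [sZeroPlus_imp hn h, ← hU', U.apply_symm_apply]
  · refine (hdense U).mono ?_
    rintro _ ⟨f, hf, rfl⟩
    exact ⟨f, by rw [hU]; exact pMinus_of_mem_testSubmodule ν hf⟩
  · rw [pMinus_imp hn h, ← hU, U.symm_apply_apply]
  · exact dense_testSubmodule.mono fun f hf => ⟨_, sMinus_of_mem_testSubmodule ν hf⟩
  · rw [((sMinus_iff ν f g).1 h).2, hU]
  · exact dense_testSubmodule.mono fun f hf => ⟨_, pZeroPlus_of_mem_testSubmodule ν hf⟩
  · rw [pZeroPlus_imp hn h, hU']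

end BuschmanErdelyi

theorem theorem19 (ν : ℂ) :
    (BuschmanErdelyi.IsUnitary (BuschmanErdelyi.SZeroPlus ν) ↔ ∃ n : ℤ, ν = n) ∧
    (BuschmanErdelyi.IsUnitary (BuschmanErdelyi.PZeroPlus ν) ↔ ∃ n : ℤ, ν = n) ∧
    (BuschmanErdelyi.IsUnitary (BuschmanErdelyi.PMinus ν) ↔ ∃ n : ℤ, ν = n) ∧
    (BuschmanErdelyi.IsUnitary (BuschmanErdelyi.SMinus ν) ↔ ∃ n : ℤ, ν = n) ∧
    ((∃ n : ℤ, ν = n) →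
      (∃ U : BuschmanErdelyi.L2 ≃ₗᵢ[ℂ] BuschmanErdelyi.L2,
        BuschmanErdelyi.ExtendsTo (BuschmanErdelyi.SZeroPlus ν) U ∧
        BuschmanErdelyi.ExtendsTo (BuschmanErdelyi.PMinus ν) U.symm) ∧
      (∃ V : BuschmanErdelyi.L2 ≃ₗᵢ[ℂ] BuschmanErdelyi.L2,
        BuschmanErdelyi.ExtendsTo (BuschmanErdelyi.SMinus ν) V ∧
        BuschmanErdelyi.ExtendsTo (BuschmanErdelyi.PZeroPlus ν) V.symm)) := by
  refine ⟨⟨BuschmanErdelyi.exists_int_of_isUnitary_sZeroPlus, fun h => ?_⟩,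
    ⟨BuschmanErdelyi.exists_int_of_isUnitary_pZeroPlus, fun h => ?_⟩,
    ⟨BuschmanErdelyi.exists_int_of_isUnitary_pMinus, fun h => ?_⟩,
    ⟨BuschmanErdelyi.exists_int_of_isUnitary_sMinus, fun h => ?_⟩, fun h => ?_⟩ <;>
  obtain ⟨U, h1, h2, h3, h4⟩ := BuschmanErdelyi.exists_extendsTo h
  exacts [⟨U, h1⟩, ⟨U.symm, h4⟩, ⟨U.symm, h2⟩, ⟨U, h3⟩, ⟨⟨U, h1, h2⟩, ⟨U, h3, h4⟩⟩]
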